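/- Let $p_0,p_1,\dots,p_{n-1},p_n=p_0$ be points in $\mathbb R^2$, $n\ge 3$, with $p_0,\dots,p_{n-1}$ distinct. The set $P=\bigcup_{i=1}^n[p_{i-1},p_i]$ is called a *simple closed $n$-gon* if the segments $[p_{i-1},p_i]$ do not intersect except for common endpoints, i.e. two cyclically consecutive segments meet exactly in their common endpoint and any two other distinct segments are disjoint. Its interior $\operatorname{int}P$ [exterior $\operatorname{ext}P$] is the bounded [unbounded] connected component of $\mathbb R^2\setminus P$. For $S\subset\mathbb R^2$ and $a,b\in S$ let $\pi_S(a,b)$ be the smallest number of edges of a polygonal path that connects $a$ to $b$ within $S$ ($\pi_S(a,b)=\infty$ if there is no such path; $\pi_S(a,a)=0$). The *polygonal diameter* of $S$ is $\operatorname{poldiam}(S)=\sup\{\pi_S(a,b): a,b\in S\}$. **Theorem 4.1 (Main Theorem).** (a) For every $n\ge 3$ and every simple closed $n$-gon $P$ in $\mathbb R^2$, $$\operatorname{poldiam}(\operatorname{int}P)\le\left\lfloor \tfrac n2\right\rfloor\quad\text{and}\quad \operatorname{poldiam}(\operatorname{ext}P)\le\left\lceil \tfrac n2\right\rceil .$$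 (b) For every $n\ge 3$ there is a simple closed $n$-gon $P_n$ in $\mathbb R^2$ for which both bounds are attained simultaneously: $$\operatorname{poldiam}(\operatorname{int}P_n)=\left\lfloor \tfrac n2\right\rfloor\quad\text{and}\quad \operatorname{poldiam}(\operatorname{ext}P_n)=\left\lceil \tfrac n2\right\rceil .$$ -/

import Mathlib

/-- The Euclidean plane. -/
abbrev Plane : Type := EuclideanSpace ℝ (Fin 2)

namespace Polygon

/-- A closed polygon with vertices `p 0, …, p (n - 1)` and edges `[p i, p (i + 1)]` (indices
modulo `n`) is simple if its vertices are distinct and its edges meet only in common endpoints.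
This is used for `3 ≤ n` only. -/
structure IsSimpleClosed {n : ℕ} (P : Polygon Plane n) : Prop where
  vertices_injective : Function.Injective P.vertices
  /-- Consecutive edges meet exactly in their common vertex. -/
  edge_inter_next : ∀ i : Fin n,
    P.edgeSet ℝ i ∩ P.edgeSet ℝ (finRotate n i) = {P.vertices (finRotate n i)}
  /-- Distinct edges that are not consecutive are disjoint. -/
  edge_disjoint : ∀ i j : Fin n, i ≠ j → j ≠ finRotate n i → i ≠ finRotate n j →
    Disjoint (P.edgeSet ℝ i) (P.edgeSet ℝ j)

/-- The interior `int P`: the bounded part of the complement of the polygonal curve, that is, all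
points off the curve whose connected component in the complement is bounded. -/
def int {n : ℕ} (P : Polygon Plane n) : Set Plane :=
  {x | x ∉ P.boundary ℝ ∧ Bornology.IsBounded (connectedComponentIn (P.boundary ℝ)ᶜ x)}

/-- The exterior `ext P`: the unbounded part of the complement of the polygonal curve, that is,
all points off the curve whose connected component in the complement is unbounded. -/
def ext {n : ℕ} (P : Polygon Plane n) : Set Plane :=
  {x | x ∉ P.boundary ℝ ∧ ¬ Bornology.IsBounded (connectedComponentIn (P.boundary ℝ)ᶜ x)}

end Polygon

/-- `IsPolygonalPath S a b k q`: the points `q 0 = a, q 1, …, q k = b` are the successive vertices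
of a polygonal path with `k` edges that connects `a` to `b` within `S`. (The values `q i` with
`k < i` are irrelevant.) -/
def IsPolygonalPath (S : Set Plane) (a b : Plane) (k : ℕ) (q : ℕ → Plane) : Prop :=
  q 0 = a ∧ q k = b ∧ ∀ i < k, segment ℝ (q i) (q (i + 1)) ⊆ S

/-- `π_S(a, b)`: the smallest number of edges of a polygonal path that connects `a` to `b` within
`S`, and `∞` if there is no such path. It is used for `a, b ∈ S`. -/
noncomputable def polygonalDist (S : Set Plane) (a b : Plane) : ℕ∞ :=
  ⨅ (k : ℕ) (_ : ∃ q : ℕ → Plane, IsPolygonalPath S a b k q), (k : ℕ∞)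

/-- The polygonal diameter `poldiam S = sup {π_S(a, b) : a, b ∈ S}`. -/
noncomputable def poldiam (S : Set Plane) : ℕ∞ :=
  ⨆ (a ∈ S) (b ∈ S), polygonalDist S a b

/-! Upper bounds. Let `a` and `b` lie on the same side of P. If `a` sees a vertex and `b` sees the
vertex `d` steps further around P, then they are joined by a path with d + 2 edges: from `a` to a
point near the first vertex, along P at a small distance on the proper side, and on to `b`
(`Polygon.SeesFrom.linked`). So it suffices that the two points see vertices that are cyclically
close. This is a matter of counting: two nonempty subsets A, B of an n-cycle with n < 2t + |A| + |B|
have elements at most t steps apart (`exists_close`). Every point off P sees at least two vertices,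
and at least three unless a line strictly separates it from P (`three_le_card_visible`). Interior
points are never separated in this way, and two separated points are joined by two edges anyway.
Three and three visible vertices give ⌊n/2⌋ inside for n ≥ 4, while a triangle has a convex
interior; three and two give ⌈n/2⌉ outside. That interior points see P from one side and exterior
points from the other is the polygonal Jordan theorem. It comes from the total angle `Polygon.wind`,
which is locally constant off P, vanishes on the exterior and jumps across edges.

Lower bounds. The extremal polygon is a double spiral whose 2N + 2 long edges all cross the
horizontal axis. They form nested arches above the axis, and nested arches and a tip below it. The
level of a point counts the arches of its half-plane that do not enclose it, the tip being counted
the other way. Off P the level is constant along segments in a closed half-plane, and on the axis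
the levels from above and from below differ by exactly one. So an edge of a path changes the level
by at most one (`Barrier.level_le_of_segment`). On both sides of P there are points of level 0, near
the origin, and points of level N + 1, near the outermost left crossing. Hence both diameters are at
least N + 1, which settles n = 2N + 2. For n = 2N + 3 the top arch is truncated by a horizontal
edge. An edge that leads from just above this edge to below the axis is so flat that it ends far
away, from where the next edge cannot enter the spiral deep enough. This costs one more edge outside
(`Barrier.exists_add_two_le`). The case n = 3 is a triangle. -/

open Set Filter Topology

/-! ### Polygonal paths -/

/-- `a` and `b` are joined within `S` by a polygonal path with `k` edges. -/
def Linked (S : Set Plane) (k : ℕ) (a b : Plane) : Prop :=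
  ∃ q : ℕ → Plane, IsPolygonalPath S a b k q

namespace Linked

variable {S T : Set Plane} {a b c : Plane} {k l : ℕ}

theorem refl (S : Set Plane) (a : Plane) : Linked S 0 a a :=
  ⟨fun _ => a, rfl, rfl, by simp⟩

theorem cons (h : segment ℝ a b ⊆ S) (hb : Linked S k b c) : Linked S (k + 1) a c := by
  obtain ⟨q, h0, hk, hq⟩ := hb
  refine ⟨fun i => Nat.casesOn i a q, rfl, hk, ?_⟩
  rintro (_ | i) hi
  · simpa [h0] using h
  · exact hq i (by omega)

theorem exists_of_succ (h : Linked S (k + 1) a c) :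
    ∃ b, segment ℝ a b ⊆ S ∧ Linked S k b c := by
  obtain ⟨q, h0, hk, hq⟩ := h
  exact ⟨q 1, h0 ▸ hq 0 (by omega), fun i => q (i + 1), rfl, hk, fun i hi => hq (i + 1) (by omega)⟩

theorem zero_iff : Linked S 0 a b ↔ a = b :=
  ⟨fun ⟨_, h0, hk, _⟩ => h0.symm.trans hk, fun h => h ▸ refl S a⟩

theorem single (h : segment ℝ a b ⊆ S) : Linked S 1 a b := (refl S b).cons h

theorem trans (h : Linked S k a b) (h' : Linked S l b c) : Linked S (k + l) a c := by
  induction k generalizing a with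
  | zero => rw [zero_iff] at h; subst h; simpa using h'
  | succ k ih =>
    obtain ⟨d, hd, hk⟩ := h.exists_of_succ
    have := (ih hk).cons hd
    rwa [Nat.add_right_comm] at this

theorem symm (h : Linked S k a b) : Linked S k b a := by
  induction k generalizing a with
  | zero => rw [zero_iff] at h ⊢; exact h.symm
  | succ k ih =>
    obtain ⟨d, hd, hk⟩ := h.exists_of_succ
    exact (ih hk).trans (single (segment_symm ℝ a d ▸ hd))

/-- A path is lengthened by constant edges at its end, which is why `b ∈ S` is needed. -/
theorem mono (h : Linked S k a b) (hb : b ∈ S) (hkl : k ≤ l) : Linked S l a b := by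
  induction l, hkl using Nat.le_induction with
  | base => exact h
  | succ l _ ih => exact ih.trans (single (by simpa using hb))

/-- A property that is preserved along segments in `S` is preserved along polygonal paths. -/
theorem induct {p : Plane → Prop} (hp : ∀ x y, segment ℝ x y ⊆ S → p x → p y)
    (h : Linked S k a b) (ha : p a) : p b := by
  induction k generalizing a with
  | zero => rw [zero_iff] at h; exact h ▸ ha
  | succ k ih =>
    obtain ⟨d, hd, hk⟩ := h.exists_of_succ
    exact ih hk (hp _ _ hd ha)

/-- A polygonal path within `S` stays in every part of `S` that is saturated for segments. -/
theorem restrict (hT : ∀ x y, segment ℝ x y ⊆ S → x ∈ T → segment ℝ x y ⊆ T)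
    (h : Linked S k a b) (ha : a ∈ T) : Linked T k a b := by
  induction k generalizing a with
  | zero => rw [zero_iff] at h ⊢; exact h
  | succ k ih =>
    obtain ⟨d, hd, hk⟩ := h.exists_of_succ
    have := hT _ _ hd ha
    exact (ih hk (this (right_mem_segment ℝ a d))).cons this

theorem subset (hST : S ⊆ T) (h : Linked S k a b) : Linked T k a b :=
  h.imp fun _ hq => ⟨hq.1, hq.2.1, fun i hi => (hq.2.2 i hi).trans hST⟩

end Linked

theorem poldiam_le {S : Set Plane} {k : ℕ}
    (h : ∀ a ∈ S, ∀ b ∈ S, Linked S k a b) : poldiam S ≤ k :=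
  iSup₂_le fun a ha => iSup₂_le fun b hb => iInf₂_le_of_le k (h a ha b hb) le_rfl

theorem le_poldiam {S : Set Plane} {k : ℕ} {a b : Plane} (ha : a ∈ S) (hb : b ∈ S)
    (h : ∀ l, Linked S l a b → k ≤ l) : (k : ℕ∞) ≤ poldiam S := by
  refine le_iSup₂_of_le a ha (le_iSup₂_of_le b hb (le_iInf₂ fun l hl => ?_))
  exact_mod_cast h l hl

/-- The union of the bounded (or of the unbounded) components of `S` contains every segment in `S`
that starts in it. -/
theorem connectedComponentIn_eq_of_segment {S : Set Plane} {x y z : Plane}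
    (h : segment ℝ x y ⊆ S) (hz : z ∈ segment ℝ x y) :
    connectedComponentIn S z = connectedComponentIn S x :=
  (connectedComponentIn_eq ((convex_segment x y).isPreconnected.subset_connectedComponentIn
    (left_mem_segment ℝ x y) h hz)).symm

/-! ### Interior, exterior and edges -/

namespace Polygon

variable {n : ℕ} {P : Polygon Plane n}

theorem segment_subset_int {x y : Plane} (h : segment ℝ x y ⊆ (P.boundary ℝ)ᶜ) (hx : x ∈ P.int) :
    segment ℝ x y ⊆ P.int := fun z hz =>
  ⟨h hz, by rw [connectedComponentIn_eq_of_segment h hz]; exact hx.2⟩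

theorem segment_subset_ext {x y : Plane} (h : segment ℝ x y ⊆ (P.boundary ℝ)ᶜ) (hx : x ∈ P.ext) :
    segment ℝ x y ⊆ P.ext := fun z hz =>
  ⟨h hz, by rw [connectedComponentIn_eq_of_segment h hz]; exact hx.2⟩

theorem mem_int_or_mem_ext {x : Plane} (hx : x ∉ P.boundary ℝ) : x ∈ P.int ∨ x ∈ P.ext := by
  by_cases h : Bornology.IsBounded (connectedComponentIn (P.boundary ℝ)ᶜ x)
  · exact .inl ⟨hx, h⟩
  · exact .inr ⟨hx, h⟩

theorem notMem_ext_of_mem_int {x : Plane} (hx : x ∈ P.int) : x ∉ P.ext := fun h => h.2 hx.2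

theorem int_subset : P.int ⊆ (P.boundary ℝ)ᶜ := fun _ h => h.1

theorem ext_subset : P.ext ⊆ (P.boundary ℝ)ᶜ := fun _ h => h.1

theorem edgeSet_eq_segment (i : Fin n) :
    P.edgeSet ℝ i = segment ℝ (P.vertices i) (P.vertices (finRotate n i)) := by
  rw [edgeSet, affineSegment_eq_segment]

theorem edgeSet_subset_boundary (i : Fin n) : P.edgeSet ℝ i ⊆ P.boundary ℝ :=
  subset_iUnion (fun i => P.edgeSet ℝ i) i

theorem mem_boundary_iff {x : Plane} : x ∈ P.boundary ℝ ↔ ∃ i, x ∈ P.edgeSet ℝ i := mem_iUnion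

theorem isCompact_edgeSet (i : Fin n) : IsCompact (P.edgeSet ℝ i) := by
  rw [edgeSet_eq_segment, ← Path.range_segment]
  exact isCompact_range (Path.segment _ _).continuous

theorem isCompact_boundary : IsCompact (P.boundary ℝ) :=
  isCompact_iUnion fun i => isCompact_edgeSet i

theorem left_mem_edgeSet (i : Fin n) : P.vertices i ∈ P.edgeSet ℝ i := by
  rw [edgeSet_eq_segment]; exact left_mem_segment ..

theorem right_mem_edgeSet (i : Fin n) : P.vertices (finRotate n i) ∈ P.edgeSet ℝ i := by
  rw [edgeSet_eq_segment]; exact right_mem_segment ..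

theorem vertex_mem_boundary (i : Fin n) : P.vertices i ∈ P.boundary ℝ :=
  edgeSet_subset_boundary i (left_mem_edgeSet i)

theorem mem_edgeSet_iff {i : Fin n} {x : Plane} : x ∈ P.edgeSet ℝ i ↔ ∃ t ∈ Icc (0 : ℝ) 1,
    x = P.vertices i + t • (P.vertices (finRotate n i) - P.vertices i) := by
  rw [edgeSet_eq_segment, segment_eq_image']
  simp only [mem_image, eq_comm]

end Polygon

/-! ### Vectors of the plane -/

/-- The determinant of two vectors of the plane. -/
def cr (u v : Plane) : ℝ := u 0 * v 1 - u 1 * v 0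

/-- The dot product of two vectors of the plane. -/
def dt (u v : Plane) : ℝ := u 0 * v 0 + u 1 * v 1

/-- The vector `u` turned counterclockwise by a right angle. -/
def rot (u : Plane) : Plane := !₂[-u 1, u 0]

theorem plane_ext {u v : Plane} (h0 : u 0 = v 0) (h1 : u 1 = v 1) : u = v := by
  ext i; fin_cases i <;> assumption

theorem plane_eq_zero_iff {u : Plane} : u = 0 ↔ u 0 = 0 ∧ u 1 = 0 :=
  ⟨fun h => by simp [h], fun h => plane_ext (by simpa using h.1) (by simpa using h.2)⟩

theorem dt_self_pos {u : Plane} (h : u ≠ 0) : 0 < dt u u := by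
  by_contra! hu
  refine h (plane_eq_zero_iff.2 ⟨?_, ?_⟩) <;> unfold dt at hu <;> nlinarith [sq_nonneg (u 0), sq_nonneg (u 1)]

@[simp] theorem rot_zero (u : Plane) : rot u 0 = -u 1 := by simp [rot]

@[simp] theorem rot_one (u : Plane) : rot u 1 = u 0 := by simp [rot]

theorem rot_ne_zero {u : Plane} (h : u ≠ 0) : rot u ≠ 0 := by
  intro h'
  rw [plane_eq_zero_iff] at h'
  simp only [rot_zero, rot_one, neg_eq_zero] at h'
  exact h (plane_eq_zero_iff.2 ⟨h'.2, h'.1⟩)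

/-- Two vectors with zero determinant are proportional. -/
theorem eq_smul_of_cr_eq_zero {u v : Plane} (hu : u ≠ 0) (h : cr u v = 0) :
    v = (dt u v / dt u u) • u := by
  have h0 := dt_self_pos hu
  unfold cr at h
  apply plane_ext <;> simp only [PiLp.smul_apply, smul_eq_mul] <;> field_simp <;> unfold dt
  · linear_combination -u 1 * h
  · linear_combination u 0 * h

/-! ### The total angle under which the polygon is seen -/

/-- The plane as the complex numbers. -/
noncomputable def toComplex (x : Plane) : ℂ := ⟨x 0, x 1⟩

@[fun_prop] theorem continuous_toComplex : Continuous toComplex := by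
  have : toComplex = fun x => (x 0 : ℂ) + (x 1 : ℂ) * Complex.I := by
    funext x; apply Complex.ext <;> simp [toComplex]
  rw [this]; fun_prop

@[simp] theorem toComplex_re (x : Plane) : (toComplex x).re = x 0 := rfl

@[simp] theorem toComplex_im (x : Plane) : (toComplex x).im = x 1 := rfl

theorem toComplex_injective : Function.Injective toComplex := fun _ _ h =>
  plane_ext (congrArg Complex.re h) (congrArg Complex.im h)

theorem toComplex_sub_ne_zero {x y : Plane} (h : x ≠ y) : toComplex x - toComplex y ≠ 0 :=
  sub_ne_zero.2 fun h' => h (toComplex_injective h')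

/-- The quotient of the vectors from `x` to the two ends of a segment. -/
noncomputable def viewRatio (v w x : Plane) : ℂ :=
  (toComplex w - toComplex x) / (toComplex v - toComplex x)

theorem viewRatio_mem_slitPlane {v w x : Plane} (hx : x ∉ segment ℝ v w) :
    viewRatio v w x ∈ Complex.slitPlane := by
  have hv : toComplex v - toComplex x ≠ 0 :=
    toComplex_sub_ne_zero fun h => hx (h ▸ left_mem_segment ℝ v w)
  by_contra h
  rw [Complex.mem_slitPlane_iff] at h
  push Not at h
  obtain ⟨hre, him⟩ := h
  set r := -(viewRatio v w x).re with hr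
  have h1 : viewRatio v w x = ((-r : ℝ) : ℂ) := Complex.ext (by simp [hr]) (by simp [him])
  rw [viewRatio, div_eq_iff hv] at h1
  have hre' := congrArg Complex.re h1
  have him' := congrArg Complex.im h1
  rw [Complex.re_ofReal_mul] at hre'
  rw [Complex.im_ofReal_mul] at him'
  simp only [Complex.sub_re, Complex.sub_im, toComplex_re, toComplex_im] at hre' him'
  have hr0 : 0 ≤ r := by linarith
  have hr1 : (1 + r) ≠ 0 := by positivity
  apply hx
  -- A ratio `-r ≤ 0` means `w - x = -r • (v - x)`, and this is solved for `x`.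
  refine ⟨r / (1 + r), 1 / (1 + r), by positivity, by positivity, by field_simp; ring, ?_⟩
  apply plane_ext <;> simp only [PiLp.add_apply, PiLp.smul_apply, smul_eq_mul] <;> field_simp
  · linear_combination hre'
  · linear_combination him'

theorem continuousAt_arg_viewRatio {v w x : Plane} (hx : x ∉ segment ℝ v w) :
    ContinuousAt (fun x => Complex.arg (viewRatio v w x)) x := by
  have hv : toComplex v - toComplex x ≠ 0 :=
    toComplex_sub_ne_zero fun h => hx (h ▸ left_mem_segment ℝ v w)
  refine (Complex.continuousAt_arg (viewRatio_mem_slitPlane hx)).comp ?_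
  unfold viewRatio
  exact ContinuousAt.div (by fun_prop) (by fun_prop) hv

/-- Sign of the angle under which a segment is seen from points close to it. -/
theorem abs_arg_viewRatio {v w x : Plane} (hre : dt (w - x) (v - x) < 0) :
    Real.pi / 2 < |Complex.arg (viewRatio v w x)| := by
  rw [← not_le, Complex.abs_arg_le_pi_div_two_iff, not_le, viewRatio, Complex.div_re, ← add_div]
  refine div_neg_of_neg_of_pos (by simpa [dt] using hre) (Complex.normSq_pos.2 fun h => ?_)
  have h0 := congrArg Complex.re h
  have h1 := congrArg Complex.im h
  simp at h0 h1
  simp [dt, h0, h1] at hre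

theorem arg_viewRatio_nonneg_iff {v w x : Plane} (hx : v ≠ x) :
    0 ≤ Complex.arg (viewRatio v w x) ↔ 0 ≤ cr (v - x) (w - x) := by
  have hn : 0 < Complex.normSq (toComplex v - toComplex x) :=
    Complex.normSq_pos.2 (toComplex_sub_ne_zero hx)
  rw [Complex.arg_nonneg_iff, viewRatio, Complex.div_im, ← sub_div]
  rw [le_div_iff₀ hn, zero_mul]
  simp only [Complex.sub_im, Complex.sub_re, toComplex_re, toComplex_im, cr, PiLp.sub_apply]
  ring_nf

namespace Polygon

variable {n : ℕ} (P : Polygon Plane n)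

/-- The total angle by which the vector from `x` to a point of the polygon turns when the point runs
through the polygon. -/
noncomputable def wind (x : Plane) : ℝ :=
  ∑ i, Complex.arg (viewRatio (P.vertices i) (P.vertices (finRotate n i)) x)

variable {P}

theorem continuousAt_wind {x : Plane} (hx : x ∉ P.boundary ℝ) : ContinuousAt P.wind x := by
  unfold wind
  refine tendsto_finsetSum _ fun i _ => continuousAt_arg_viewRatio fun h => hx ?_
  exact mem_boundary_iff.2 ⟨i, by rwa [edgeSet_eq_segment]⟩

/-- Modulo 2π every summand is a difference of two arguments, and the differences cancel around the
cycle. -/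
theorem wind_mem_zmultiples {x : Plane} (hx : x ∉ P.boundary ℝ) :
    ∃ k : ℤ, P.wind x = k • (2 * Real.pi) := by
  have hv (i : Fin n) : toComplex (P.vertices i) - toComplex x ≠ 0 :=
    toComplex_sub_ne_zero fun h => hx (h ▸ vertex_mem_boundary i)
  have : ((P.wind x : ℝ) : Real.Angle) = 0 := by
    have h1 : ((P.wind x : ℝ) : Real.Angle) = ∑ i, ((Complex.arg (viewRatio (P.vertices i)
        (P.vertices (finRotate n i)) x) : ℝ) : Real.Angle) := by
      exact map_sum Real.Angle.coeHom (fun i => Complex.arg (viewRatio (P.vertices i)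
        (P.vertices (finRotate n i)) x)) Finset.univ
    rw [h1]
    simp only [viewRatio, Complex.arg_div_coe_angle (hv _) (hv _), Finset.sum_sub_distrib]
    rw [sub_eq_zero]
    exact Equiv.sum_comp (finRotate n)
      (fun i => ((Complex.arg (toComplex (P.vertices i) - toComplex x) : ℝ) : Real.Angle))
  obtain ⟨k, hk⟩ := Real.Angle.coe_eq_zero_iff.1 this
  exact ⟨k, hk.symm⟩

/-- A continuous function with values in a discrete set is constant on preconnected sets. -/
theorem wind_eq_of_isPreconnected {S : Set Plane} (hS : IsPreconnected S)
    (hSP : S ⊆ (P.boundary ℝ)ᶜ) {x y : Plane} (hx : x ∈ S) (hy : y ∈ S) : P.wind x = P.wind y := by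
  have hc : ContinuousOn (fun z => P.wind z / (2 * Real.pi)) S := fun z hz =>
    ((continuousAt_wind (hSP hz)).div_const _).continuousWithinAt
  have hd : IsDiscrete (range ((↑) : ℤ → ℝ)) := by
    constructor
    exact Int.isClosedEmbedding_coe_real.isEmbedding.toHomeomorph.discreteTopology
  have := hS.constant_of_mapsTo hd hc (fun z hz => by
    obtain ⟨k, hk⟩ := wind_mem_zmultiples (hSP hz)
    refine ⟨k, ?_⟩
    have := Real.pi_pos
    simp only [hk, zsmul_eq_mul]
    field_simp) hx hy
  have := Real.pi_pos
  field_simp at *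
  assumption

theorem wind_eq_of_segment {x y : Plane} (h : segment ℝ x y ⊆ (P.boundary ℝ)ᶜ) :
    P.wind x = P.wind y :=
  wind_eq_of_isPreconnected (convex_segment x y).isPreconnected h
    (left_mem_segment ..) (right_mem_segment ..)

/-- The total angle vanishes at points that are strictly separated from the polygon by a line. -/
theorem wind_eq_zero_of_free {x u : Plane} (hu : ∀ p ∈ P.boundary ℝ, dt u (p - x) < 0) :
    P.wind x = 0 := by
  -- Multiplication by `ζ`, the negated conjugate of `u`, moves the vectors from `x` to the polygon
  -- into the right half-plane. There arguments subtract without jumps, so the sum telescopes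
  -- exactly and not only modulo 2π.
  set ζ : ℂ := ⟨-u 0, u 1⟩ with hζ
  have hpos (i : Fin n) : 0 < ((toComplex (P.vertices i) - toComplex x) * ζ).re := by
    have := hu _ (vertex_mem_boundary i)
    simp only [dt, PiLp.sub_apply] at this
    simp [hζ]
    linarith
  have hn0 (i : Fin n) : (toComplex (P.vertices i) - toComplex x) * ζ ≠ 0 := fun h => by
    have := hpos i
    rw [h] at this
    simp at this
  have key (i j : Fin n) : Complex.arg (viewRatio (P.vertices i) (P.vertices j) x) =
      Complex.arg ((toComplex (P.vertices j) - toComplex x) * ζ) -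
        Complex.arg ((toComplex (P.vertices i) - toComplex x) * ζ) := by
    have hi := abs_lt.1 (Complex.abs_arg_lt_pi_div_two_iff.2 (.inl (hpos i)))
    have hj := abs_lt.1 (Complex.abs_arg_lt_pi_div_two_iff.2 (.inl (hpos j)))
    have hζ0 : ζ ≠ 0 := right_ne_zero_of_mul (hn0 i)
    have h1 : viewRatio (P.vertices i) (P.vertices j) x =
        ((toComplex (P.vertices j) - toComplex x) * ζ) /
          ((toComplex (P.vertices i) - toComplex x) * ζ) := by
      rw [viewRatio, mul_div_mul_right _ _ hζ0]
    rw [h1]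
    have h2 := Complex.arg_div_coe_angle (hn0 j) (hn0 i)
    rw [← Real.Angle.coe_sub, Complex.arg_coe_angle_eq_iff_eq_toReal,
      Real.Angle.toReal_coe_eq_self_iff_mem_Ioc.2 ⟨by linarith, by linarith⟩] at h2
    exact h2
  simp only [wind, key, Finset.sum_sub_distrib]
  rw [sub_eq_zero]
  exact Equiv.sum_comp (finRotate n)
    (fun i => Complex.arg ((toComplex (P.vertices i) - toComplex x) * ζ))

/-- The total angle jumps across an edge. -/
theorem eventually_wind_lt {i : Fin n} {z ν : Plane} {τ : ℝ} (hτ0 : 0 < τ) (hτ1 : τ < 1)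
    (hz : z = P.vertices i + τ • (P.vertices (finRotate n i) - P.vertices i))
    (hν : 0 < cr (P.vertices (finRotate n i) - P.vertices i) ν)
    (hzj : ∀ j ≠ i, z ∉ P.edgeSet ℝ j) :
    ∀ᶠ ε : ℝ in 𝓝[>] 0, P.wind (z - ε • ν) < P.wind (z + ε • ν) := by
  set v := P.vertices i
  set w := P.vertices (finRotate n i)
  let g : Plane → ℝ := fun x => ∑ j ∈ Finset.univ.erase i,
    Complex.arg (viewRatio (P.vertices j) (P.vertices (finRotate n j)) x)
  have hwind (x : Plane) : P.wind x = g x + Complex.arg (viewRatio v w x) := by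
    simp only [wind, g]
    rw [Finset.sum_erase_add _ _ (Finset.mem_univ i)]
  have hg : ContinuousAt g z := by
    refine tendsto_finsetSum _ fun j hj => continuousAt_arg_viewRatio ?_
    rw [← edgeSet_eq_segment]
    exact hzj j (Finset.ne_of_mem_erase hj)
  have hline (μ : ℝ) : Tendsto (fun ε : ℝ => z + (μ * ε) • ν) (𝓝[>] 0) (𝓝 z) := by
    have : Continuous fun ε : ℝ => z + (μ * ε) • ν := by fun_prop
    simpa using (this.tendsto 0).mono_left nhdsWithin_le_nhds
  have hclose (μ : ℝ) : ∀ᶠ ε : ℝ in 𝓝[>] 0, |g (z + (μ * ε) • ν) - g z| < 1 := by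
    have := hg.tendsto.comp (hline μ)
    simpa [Real.dist_eq] using Metric.tendsto_nhds.1 this 1 one_pos
  have hE : 0 < dt (w - v) (w - v) := dt_self_pos fun h => by
    rw [h] at hν; simp [cr] at hν
  have hre (μ : ℝ) : ∀ᶠ ε : ℝ in 𝓝[>] 0,
      dt (w - (z + (μ * ε) • ν)) (v - (z + (μ * ε) • ν)) < 0 := by
    have hc : Continuous fun x : Plane => dt (w - x) (v - x) := by unfold dt; fun_prop
    have hneg : dt (w - z) (v - z) < 0 := by
      have : dt (w - z) (v - z) = -(τ * (1 - τ)) * dt (w - v) (w - v) := by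
        rw [hz]; simp [dt]; ring
      rw [this]
      have := mul_pos hτ0 (sub_pos.2 hτ1)
      nlinarith
    exact ((hc.tendsto z).comp (hline μ)).eventually (Iio_mem_nhds hneg)
  have hcr (ε : ℝ) : cr (v - (z + ε • ν)) (w - (z + ε • ν)) = ε * cr (w - v) ν := by
    rw [hz]; simp [cr]; ring
  -- The other edges together contribute a difference below 2, the edge `i` one above π.
  filter_upwards [hclose 1, hclose (-1), hre 1, hre (-1), self_mem_nhdsWithin] with
    ε h1 h2 h3 h4 hε
  have hε : 0 < ε := hε
  simp only [one_mul, neg_mul, neg_smul, ← sub_eq_add_neg] at h1 h2 h3 h4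
  have hp := abs_arg_viewRatio h3
  have hm := abs_arg_viewRatio h4
  have hp0 : 0 ≤ Complex.arg (viewRatio v w (z + ε • ν)) := by
    rw [arg_viewRatio_nonneg_iff, hcr]
    · positivity
    · intro h; rw [← h] at h3; simp [dt] at h3
  have hm0 : Complex.arg (viewRatio v w (z - ε • ν)) < 0 := by
    rw [← not_le, arg_viewRatio_nonneg_iff]
    · have := hcr (-ε)
      rw [neg_smul, ← sub_eq_add_neg] at this
      rw [this]
      nlinarith
    · intro h; rw [← h] at h4; simp [dt] at h4
  rw [abs_of_nonneg hp0] at hp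
  rw [abs_of_neg hm0] at hm
  rw [abs_lt] at h1 h2
  rw [hwind, hwind]
  linarith [h1.1, h2.2, Real.pi_gt_three]

end Polygon

/-! ### The cyclic order of the vertices -/

theorem val_finRotate {n : ℕ} (i : Fin n) : (finRotate n i : ℕ) = (i + 1) % n := by
  obtain ⟨m, rfl⟩ : ∃ m, n = m + 1 := ⟨n - 1, by have := i.2; omega⟩
  rw [finRotate_apply, Fin.val_add, Fin.val_one', Nat.add_mod_mod]

theorem val_iterate_finRotate {n : ℕ} (i : Fin n) (k : ℕ) :
    ((finRotate n)^[k] i : ℕ) = (i + k) % n := by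
  induction k with
  | zero => simp [Nat.mod_eq_of_lt i.2]
  | succ k ih => rw [Function.iterate_succ_apply', val_finRotate, ih]; simp [Nat.add_assoc]

theorem finRotate_ne_self {n : ℕ} (hn : 3 ≤ n) (i : Fin n) : finRotate n i ≠ i := by
  intro h
  have := val_finRotate i
  rw [h] at this
  have hi := i.2
  rcases Nat.lt_or_ge (i + 1) n with h1 | h1
  · rw [Nat.mod_eq_of_lt h1] at this; omega
  · rw [show (i : ℕ) + 1 = n by omega, Nat.mod_self] at this; omega

theorem finRotate_finRotate_ne_self {n : ℕ} (hn : 3 ≤ n) (i : Fin n) :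
    finRotate n (finRotate n i) ≠ i := by
  intro h
  have := val_iterate_finRotate i 2
  rw [show (finRotate n)^[2] i = i from h] at this
  have hi := i.2
  rcases Nat.lt_or_ge (i + 2) n with h1 | h1
  · rw [Nat.mod_eq_of_lt h1] at this; omega
  · rw [Nat.mod_eq_sub_mod h1, Nat.mod_eq_of_lt (by omega)] at this; omega

/-! ### Visibility and the two sectors at a vertex -/

/-- The point `v` is visible from the point `x` off `B`. -/
def Sees (B : Set Plane) (x v : Plane) : Prop := x ∉ B ∧ ∀ y ∈ segment ℝ x v, y ∈ B → y = v

/-- `z` points into the open sector that is swept when `E` is turned to `F`, counterclockwise for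
`σ = 1` and clockwise for `σ = -1`. -/
def Sector (σ : ℝ) (E F z : Plane) : Prop :=
  if 0 < σ * cr E F then 0 < σ * cr E z ∧ 0 < σ * cr z F else 0 < σ * cr E z ∨ 0 < σ * cr z F

theorem cr_comb_right (u a b : Plane) (s t : ℝ) :
    cr u (s • a + t • b) = s * cr u a + t * cr u b := by simp [cr]; ring

theorem cr_comb_left (u a b : Plane) (s t : ℝ) :
    cr (s • a + t • b) u = s * cr a u + t * cr b u := by simp [cr]; ring

namespace Sector

variable {σ : ℝ} {E F z β : Plane}

/-- A reflex sector is not convex, but every sector is star-shaped with respect to the directions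
`β` that satisfy both inequalities. -/
theorem comb (h : Sector σ E F z) (hE : 0 < σ * cr E β) (hF : 0 < σ * cr β F) {s t : ℝ}
    (hs : 0 ≤ s) (ht : 0 ≤ t) (hst : 0 < s + t) : Sector σ E F (s • z + t • β) := by
  have key {x y : ℝ} (hx : 0 < x) (hy : 0 < y) : 0 < s * x + t * y := by
    rcases hs.eq_or_lt with rfl | hs
    · have : 0 < t := by linarith
      nlinarith [mul_pos this hy]
    · nlinarith [mul_pos hs hx, mul_nonneg ht hy.le]
  have h1 : σ * (s * cr E z + t * cr E β) = s * (σ * cr E z) + t * (σ * cr E β) := by ring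
  have h2 : σ * (s * cr z F + t * cr β F) = s * (σ * cr z F) + t * (σ * cr β F) := by ring
  unfold Sector at *
  rw [cr_comb_right, cr_comb_left, h1, h2]
  split_ifs at h ⊢
  · exact ⟨key h.1 hE, key h.2 hF⟩
  · exact h.imp (key · hE) (key · hF)

theorem ne_smul_left (h : Sector σ E F z) {r : ℝ} (hr : 0 ≤ r) : z ≠ r • E := by
  rintro rfl
  have h1 : cr E (r • E) = 0 := by simp [cr]; ring
  have h2 : σ * cr (r • E) F = r * (σ * cr E F) := by simp [cr]; ring
  unfold Sector at h
  rw [h1, h2] at h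
  split_ifs at h with h3
  · simpa using h.1
  · rcases h with h | h
    · simp at h
    · nlinarith

theorem ne_smul_right (h : Sector σ E F z) {r : ℝ} (hr : 0 ≤ r) : z ≠ r • F := by
  rintro rfl
  have h1 : cr (r • F) F = 0 := by simp [cr]; ring
  have h2 : σ * cr E (r • F) = r * (σ * cr E F) := by simp [cr]; ring
  unfold Sector at h
  rw [h1, h2] at h
  split_ifs at h with h3
  · simpa using h.2
  · rcases h with h | h
    · nlinarith
    · simp at h

end Sector

/-- The rays of `E` and `F` cut the plane into the two open sectors. The hypothesis `hEF` prevents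
the rays from coinciding. -/
theorem sector_or_sector_neg {E F z : Plane} (hE0 : E ≠ 0) (hEF : cr E F = 0 → dt E F < 0)
    (hE : ∀ r : ℝ, 0 ≤ r → z ≠ r • E) (hF : ∀ r : ℝ, 0 ≤ r → z ≠ r • F) :
    Sector 1 E F z ∨ Sector (-1) E F z := by
  have hEE := dt_self_pos hE0
  have hF0 : F ≠ 0 := by
    rintro rfl
    simp [dt, cr] at hEF
  have hFF := dt_self_pos hF0
  by_contra! hcon
  obtain ⟨h1, h2⟩ := hcon
  have hz1 : cr E z = 0 → dt E z < 0 := fun h0 => by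
    by_contra! h
    exact hE _ (by positivity) (eq_smul_of_cr_eq_zero hE0 h0)
  have hz2 : cr z F = 0 → dt F z < 0 := fun h0 => by
    by_contra! h
    exact hF _ (by positivity) (eq_smul_of_cr_eq_zero hF0 (by unfold cr at *; linarith))
  -- For independent `E` and `F` these identities settle the cases in which `z` is on the line of
  -- `E` or of `F`, and therefore opposite to that vector.
  have k1 : cr E z * dt E F = cr E F * dt E z - cr z F * dt E E := by
    simp only [cr, dt]; ring
  have k2 : cr z F * dt E F = cr E F * dt F z - cr E z * dt F F := by
    simp only [cr, dt]; ring
  unfold Sector at h1 h2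
  simp only [one_mul, neg_mul] at h1 h2
  rcases lt_trichotomy (cr E F) 0 with h | h | h
  · rw [if_neg (by linarith)] at h1
    rw [if_pos (by linarith)] at h2
    push Not at h1
    rcases h1.1.eq_or_lt with h3 | h3
    · have := hz1 h3
      rw [h3, zero_mul] at k1
      nlinarith [h1.2]
    · rcases h1.2.eq_or_lt with h4 | h4
      · have := hz2 h4
        rw [h4, zero_mul] at k2
        nlinarith [h1.1]
      · exact h2 ⟨by linarith, by linarith⟩
  · rw [if_neg (by linarith)] at h1 h2
    push Not at h1 h2
    have h3 : cr E z = 0 := by linarith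
    have h4 : cr z F = 0 := by linarith
    have h5 := hEF h
    have h6 := hz1 h3
    have h7 := hz2 h4
    have h8 := eq_smul_of_cr_eq_zero hE0 h
    have h9 : dt F z = dt E F / dt E E * dt E z := by
      conv_lhs => rw [h8]
      generalize dt E F / dt E E = c
      simp [dt]; ring
    have : 0 < dt E F / dt E E * dt E z :=
      mul_pos_of_neg_of_neg (div_neg_of_neg_of_pos h5 hEE) h6
    linarith
  · rw [if_pos h] at h1
    rw [if_neg (by linarith)] at h2
    push Not at h2
    rcases h2.1.eq_or_lt with h3 | h3
    · have h3 : cr E z = 0 := by linarith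
      have := hz1 h3
      rw [h3, zero_mul] at k1
      nlinarith [h2.2]
    · rcases h2.2.eq_or_lt with h4 | h4
      · have h4 : cr z F = 0 := by linarith
        have := hz2 h4
        rw [h4, zero_mul] at k2
        nlinarith [h2.1]
      · exact h1 ⟨by linarith, by linarith⟩

theorem exists_sector_direction {σ : ℝ} (hσ : σ ≠ 0) {E F : Plane} (hE0 : E ≠ 0)
    (hEF : cr E F = 0 → dt E F < 0) : ∃ β, 0 < σ * cr E β ∧ 0 < σ * cr β F := by
  have hσ2 : 0 < σ * σ := mul_self_pos.2 hσ
  rcases eq_or_ne (cr E F) 0 with h | h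
  · refine ⟨σ • rot E, ?_, ?_⟩
    · have : σ * cr E (σ • rot E) = (σ * σ) * dt E E := by simp [cr, dt]; ring
      rw [this]; exact mul_pos hσ2 (dt_self_pos hE0)
    · have : σ * cr (σ • rot E) F = (σ * σ) * -dt E F := by simp [cr, dt]; ring
      rw [this]; exact mul_pos hσ2 (by linarith [hEF h])
  · have h2 : 0 < (σ * cr E F) * (σ * cr E F) := mul_self_pos.2 (mul_ne_zero hσ h)
    -- `E + F` points into the convex sector; for the reflex one the factor is negative and reverses
    -- it.
    refine ⟨(σ * cr E F) • (E + F), ?_, ?_⟩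
    · have : σ * cr E ((σ * cr E F) • (E + F)) = (σ * cr E F) * (σ * cr E F) := by
        simp [cr]; ring
      rwa [this]
    · have : σ * cr ((σ * cr E F) • (E + F)) F = (σ * cr E F) * (σ * cr E F) := by
        simp [cr]; ring
      rwa [this]

/-- Segments that avoid a closed set still do so after a small move of their ends. -/
theorem eventually_disjoint_segment {ι : Type*} {l : Filter ι} {f g : ι → Plane} {a b : Plane}
    {C : Set Plane} (hC : IsClosed C) (hf : Tendsto f l (𝓝 a)) (hg : Tendsto g l (𝓝 b))
    (h : Disjoint (segment ℝ a b) C) : ∀ᶠ i in l, Disjoint (segment ℝ (f i) (g i)) C := by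
  have key : ∀ᶠ p : Plane × Plane in 𝓝 (a, b),
      ∀ t ∈ Icc (0 : ℝ) 1, p.1 + t • (p.2 - p.1) ∈ Cᶜ := by
    refine isCompact_Icc.eventually_forall_of_forall_eventually fun t ht => ?_
    have hc : Continuous fun q : (Plane × Plane) × ℝ => q.1.1 + q.2 • (q.1.2 - q.1.1) := by
      fun_prop
    refine hc.continuousAt.eventually (hC.isOpen_compl.mem_nhds ?_)
    refine fun hmem => h.le_bot ⟨?_, hmem⟩
    rw [segment_eq_image']
    exact ⟨t, ht, rfl⟩
  filter_upwards [(hf.prodMk_nhds hg).eventually key] with i hi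
  rw [Set.disjoint_left, segment_eq_image']
  rintro _ ⟨t, ht, rfl⟩
  exact hi t ht

/-! ### Paths that follow the polygon on one side -/

namespace Polygon

variable {n : ℕ} {P : Polygon Plane n}

namespace IsSimpleClosed

variable (hP : P.IsSimpleClosed) (hn : 3 ≤ n)
include hP

theorem eq_of_mem_of_mem {i j : Fin n} (hij : i ≠ j) {z : Plane} (hi : z ∈ P.edgeSet ℝ i)
    (hj : z ∈ P.edgeSet ℝ j) :
    (j = finRotate n i ∧ z = P.vertices j) ∨ (i = finRotate n j ∧ z = P.vertices i) := by
  by_cases h1 : j = finRotate n i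
  · subst h1
    have := (hP.edge_inter_next i).subset ⟨hi, hj⟩
    exact .inl ⟨rfl, this⟩
  · by_cases h2 : i = finRotate n j
    · subst h2
      have := (hP.edge_inter_next j).subset ⟨hj, hi⟩
      exact .inr ⟨rfl, this⟩
    · exact ((hP.edge_disjoint i j hij h1 h2).le_bot ⟨hi, hj⟩).elim

theorem eq_or_eq_of_vertex_mem {i j : Fin n} (h : P.vertices (finRotate n i) ∈ P.edgeSet ℝ j) :
    j = i ∨ j = finRotate n i := by
  by_contra! hcon
  rcases hP.eq_of_mem_of_mem hcon.2.symm (left_mem_edgeSet _) h with ⟨-, h'⟩ | ⟨h', -⟩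
  · exact hcon.2 (hP.vertices_injective h'.symm)
  · exact hcon.1 ((finRotate n).injective h').symm

include hn in
theorem sub_ne_zero (i : Fin n) : P.vertices (finRotate n i) - P.vertices i ≠ 0 :=
  _root_.sub_ne_zero.2 fun h => finRotate_ne_self hn i (hP.vertices_injective h)

include hn in
/-- Consecutive edges do not overlap. -/
theorem dt_neg (i : Fin n) :
    cr (P.vertices (finRotate n (finRotate n i)) - P.vertices (finRotate n i))
      (P.vertices i - P.vertices (finRotate n i)) = 0 →
    dt (P.vertices (finRotate n (finRotate n i)) - P.vertices (finRotate n i))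
      (P.vertices i - P.vertices (finRotate n i)) < 0 := by
  intro h
  set u := P.vertices i with hu
  set v := P.vertices (finRotate n i) with hv
  set w := P.vertices (finRotate n (finRotate n i)) with hw
  have hE := hP.sub_ne_zero hn (finRotate n i)
  by_contra! hd
  have hF := eq_smul_of_cr_eq_zero hE h
  set r := dt (w - v) (u - v) / dt (w - v) (w - v) with hr
  have hr0 : 0 ≤ r := div_nonneg hd (dt_self_pos hE).le
  have huv : u ≠ v := fun h' => finRotate_ne_self hn i (hP.vertices_injective h').symm
  have hwv : w ≠ v := fun h' => finRotate_ne_self hn _ (hP.vertices_injective h')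
  -- Both edges leave the common vertex in the same direction, so the far end of the shorter one
  -- lies on the other.
  rcases le_total r 1 with hr1 | hr1
  · have h1 : u ∈ P.edgeSet ℝ (finRotate n i) :=
      mem_edgeSet_iff.2 ⟨r, ⟨hr0, hr1⟩, by rw [← hv, ← hw, ← hF]; simp⟩
    have := (hP.edge_inter_next i).subset ⟨left_mem_edgeSet i, h1⟩
    exact huv this
  · have hpos : 0 < r := by linarith
    have h1 : w ∈ P.edgeSet ℝ i := by
      rw [edgeSet_eq_segment, segment_symm, segment_eq_image']
      refine ⟨r⁻¹, ⟨by positivity, inv_le_one_of_one_le₀ hr1⟩, ?_⟩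
      change v + r⁻¹ • (u - v) = w
      rw [hF, smul_smul, inv_mul_cancel₀ hpos.ne', one_smul]
      exact add_sub_cancel v w
    have := (hP.edge_inter_next i).subset ⟨h1, right_mem_edgeSet _⟩
    exact hwv this

end IsSimpleClosed

/-- The vector from the vertex after `i` to the next vertex. -/
abbrev outVec (P : Polygon Plane n) (i : Fin n) : Plane :=
  P.vertices (finRotate n (finRotate n i)) - P.vertices (finRotate n i)

/-- The vector from the vertex after `i` to the previous vertex. -/
abbrev inVec (P : Polygon Plane n) (i : Fin n) : Plane :=
  P.vertices i - P.vertices (finRotate n i)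

/-- The vertex after `i` is visible from `x`, on the left of the polygon for `σ = 1` and on its right
for `σ = -1`. -/
def SeesFrom (P : Polygon Plane n) (σ : ℝ) (x : Plane) (i : Fin n) : Prop :=
  Sees (P.boundary ℝ) x (P.vertices (finRotate n i)) ∧
    Sector σ (P.outVec i) (P.inVec i) (x - P.vertices (finRotate n i))

/-- Points in the sector at a vertex are not on the two edges at this vertex. -/
theorem notMem_edgeSet_of_sector {σ : ℝ} {i : Fin n} {x : Plane}
    (h : Sector σ (P.outVec i) (P.inVec i) (x - P.vertices (finRotate n i))) :
    x ∉ P.edgeSet ℝ i ∧ x ∉ P.edgeSet ℝ (finRotate n i) := by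
  constructor
  · intro hx
    rw [edgeSet_eq_segment, segment_symm, segment_eq_image'] at hx
    obtain ⟨t, ht, rfl⟩ := hx
    exact h.ne_smul_right ht.1 (by simp [inVec])
  · intro hx
    obtain ⟨t, ht, rfl⟩ := mem_edgeSet_iff.1 hx
    exact h.ne_smul_left ht.1 (by simp [outVec])

theorem Sees.exists_seesFrom (hP : P.IsSimpleClosed) (hn : 3 ≤ n) {x : Plane} {i : Fin n}
    (h : Sees (P.boundary ℝ) x (P.vertices (finRotate n i))) :
    P.SeesFrom 1 x i ∨ P.SeesFrom (-1) x i := by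
  -- If `x` were on the ray along an edge at the visible vertex, it would lie on that edge, or the
  -- far end of the edge would block the view.
  have key : ∀ j : Fin n, P.vertices j ≠ P.vertices (finRotate n i) →
      segment ℝ (P.vertices (finRotate n i)) (P.vertices j) ⊆ P.boundary ℝ → ∀ r : ℝ, 0 ≤ r →
      x - P.vertices (finRotate n i) ≠ r • (P.vertices j - P.vertices (finRotate n i)) := by
    intro j hj hseg r hr hx
    rw [sub_eq_iff_eq_add'] at hx
    rcases le_or_gt r 1 with hr1 | hr1
    · exact h.1 (hseg (by rw [segment_eq_image']; exact ⟨r, ⟨hr, hr1⟩, hx.symm⟩))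
    · refine hj (h.2 _ ?_ (vertex_mem_boundary j))
      rw [segment_symm, segment_eq_image']
      refine ⟨r⁻¹, ⟨by positivity, inv_le_one_of_one_le₀ hr1.le⟩, ?_⟩
      have : r ≠ 0 := by positivity
      simp only [hx, add_sub_cancel_left, smul_smul, inv_mul_cancel₀ this, one_smul]
      simp
  have := sector_or_sector_neg (z := x - P.vertices (finRotate n i))
    (hP.sub_ne_zero hn (finRotate n i)) (hP.dt_neg hn i)
    (key _ (fun h' => finRotate_ne_self hn _ (hP.vertices_injective h'))
      (by rw [← edgeSet_eq_segment]; exact edgeSet_subset_boundary _))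
    (key i (fun h' => finRotate_ne_self hn i (hP.vertices_injective h').symm)
      (by rw [segment_symm, ← edgeSet_eq_segment]; exact edgeSet_subset_boundary _))
  exact this.imp (⟨h, ·⟩) (⟨h, ·⟩)

/-- A direction into the sector at the vertex after `i`. -/
noncomputable def direction (P : Polygon Plane n) (σ : ℝ) (i : Fin n) : Plane :=
  open Classical in
  if h : ∃ β, 0 < σ * cr (P.outVec i) β ∧ 0 < σ * cr β (P.inVec i) then h.choose else 0

/-- A point near the vertex after `i` on the side `σ` of the polygon. -/
noncomputable def nearVertex (P : Polygon Plane n) (σ ε : ℝ) (i : Fin n) : Plane :=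
  P.vertices (finRotate n i) + ε • P.direction σ i

theorem direction_spec (hP : P.IsSimpleClosed) (hn : 3 ≤ n) {σ : ℝ} (hσ : σ ≠ 0) (i : Fin n) :
    0 < σ * cr (P.outVec i) (P.direction σ i) ∧ 0 < σ * cr (P.direction σ i) (P.inVec i) := by
  have h := exists_sector_direction hσ (hP.sub_ne_zero hn (finRotate n i)) (hP.dt_neg hn i)
  rw [direction, dif_pos h]
  exact h.choose_spec

theorem tendsto_nearVertex (σ : ℝ) (i : Fin n) :
    Tendsto (fun ε => P.nearVertex σ ε i) (𝓝[>] 0) (𝓝 (P.vertices (finRotate n i))) := by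
  have : Continuous fun ε => P.nearVertex σ ε i := by unfold nearVertex; fun_prop
  simpa [nearVertex] using (this.tendsto 0).mono_left nhdsWithin_le_nhds

theorem segment_nearVertex_disjoint (hP : P.IsSimpleClosed) (hn : 3 ≤ n) {σ ε : ℝ} (hσ : σ ≠ 0)
    (hε : 0 < ε) {i : Fin n} {x : Plane}
    (h : Sector σ (P.outVec i) (P.inVec i) (x - P.vertices (finRotate n i))) :
    Disjoint (segment ℝ x (P.nearVertex σ ε i)) (P.edgeSet ℝ i) ∧
      Disjoint (segment ℝ x (P.nearVertex σ ε i)) (P.edgeSet ℝ (finRotate n i)) := by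
  obtain ⟨h1, h2⟩ := direction_spec hP hn hσ i
  have key : ∀ z ∈ segment ℝ x (P.nearVertex σ ε i),
      Sector σ (P.outVec i) (P.inVec i) (z - P.vertices (finRotate n i)) := by
    rintro z ⟨s, t, hs, ht, hst, rfl⟩
    have : s • x + t • P.nearVertex σ ε i - P.vertices (finRotate n i) =
        s • (x - P.vertices (finRotate n i)) + (t * ε) • P.direction σ i := by
      rw [nearVertex]
      have : s = 1 - t := by linarith
      subst this
      module
    rw [this]
    refine h.comb h1 h2 hs (by positivity) ?_
    rcases hs.eq_or_lt with rfl | hs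
    · have : t = 1 := by linarith
      subst this; linarith
    · positivity
  exact ⟨Set.disjoint_left.2 fun z hz => (notMem_edgeSet_of_sector (key z hz)).1,
    Set.disjoint_left.2 fun z hz => (notMem_edgeSet_of_sector (key z hz)).2⟩

theorem subset_compl_boundary_iff {S : Set Plane} :
    S ⊆ (P.boundary ℝ)ᶜ ↔ ∀ j, Disjoint S (P.edgeSet ℝ j) := by
  rw [Set.subset_compl_iff_disjoint_right, boundary, Set.disjoint_iUnion_right]

/-- The two edges at the vertex are avoided because the segment stays in the sector. The others have
positive distance from the segment between `x` and the vertex. -/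
theorem SeesFrom.eventually_segment (hP : P.IsSimpleClosed) (hn : 3 ≤ n) {σ : ℝ} (hσ : σ ≠ 0)
    {i : Fin n} {x : Plane} (h : P.SeesFrom σ x i) :
    ∀ᶠ ε in 𝓝[>] 0, segment ℝ x (P.nearVertex σ ε i) ⊆ (P.boundary ℝ)ᶜ := by
  simp only [subset_compl_boundary_iff]
  rw [eventually_all]
  intro j
  by_cases hj : j = i ∨ j = finRotate n i
  · filter_upwards [self_mem_nhdsWithin] with ε hε
    have := segment_nearVertex_disjoint hP hn hσ hε h.2
    rcases hj with rfl | rfl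
    · exact this.1
    · exact this.2
  · refine eventually_disjoint_segment (isCompact_edgeSet j).isClosed tendsto_const_nhds
      (tendsto_nearVertex σ i) (Set.disjoint_left.2 fun z hz hzj => hj ?_)
    have := h.1.2 z hz (edgeSet_subset_boundary j hzj)
    subst this
    exact hP.eq_or_eq_of_vertex_mem hzj

/-- For small `ε` the segment is close to the edge that starts at the vertex after `i`. That edge
and its two neighbours are avoided by means of the sectors at its ends, all others by compactness.
-/
theorem eventually_segment_nearVertex (hP : P.IsSimpleClosed) (hn : 3 ≤ n) {σ : ℝ} (hσ : σ ≠ 0)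
    (i : Fin n) : ∀ᶠ ε in 𝓝[>] 0,
      segment ℝ (P.nearVertex σ ε i) (P.nearVertex σ ε (finRotate n i)) ⊆ (P.boundary ℝ)ᶜ := by
  simp only [subset_compl_boundary_iff]
  rw [eventually_all]
  intro j
  have hd := direction_spec hP hn hσ i
  have hd' := direction_spec hP hn hσ (finRotate n i)
  by_cases h1 : j = i ∨ j = finRotate n i
  · have hev : 0 < σ * cr (P.outVec i) (P.inVec i) → ∀ᶠ ε in 𝓝[>] 0, 0 < σ *
        cr (P.nearVertex σ ε (finRotate n i) - P.vertices (finRotate n i)) (P.inVec i) := by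
      intro h0
      have hc : Continuous fun q : Plane =>
          σ * cr (q - P.vertices (finRotate n i)) (P.inVec i) := by unfold cr; fun_prop
      exact ((hc.tendsto _).comp (tendsto_nearVertex σ (finRotate n i))).eventually
        (Ioi_mem_nhds h0)
    have hsec : ∀ᶠ ε in 𝓝[>] 0, Sector σ (P.outVec i) (P.inVec i)
        (P.nearVertex σ ε (finRotate n i) - P.vertices (finRotate n i)) := by
      have hE : ∀ ε : ℝ, 0 < ε → 0 < σ * cr (P.outVec i)
          (P.nearVertex σ ε (finRotate n i) - P.vertices (finRotate n i)) := fun ε hε => by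
        have : σ * cr (P.outVec i) (P.nearVertex σ ε (finRotate n i) - P.vertices (finRotate n i)) =
            ε * (σ * cr (P.direction σ (finRotate n i)) (P.inVec (finRotate n i))) := by
          simp [cr, nearVertex, outVec, inVec]; ring
        rw [this]
        exact mul_pos hε hd'.2
      unfold Sector
      split_ifs with h0
      · filter_upwards [self_mem_nhdsWithin, hev h0] with ε hε h2
        exact ⟨hE ε hε, h2⟩
      · filter_upwards [self_mem_nhdsWithin] with ε hε
        exact .inl (hE ε hε)
    filter_upwards [hsec, self_mem_nhdsWithin] with ε h2 hε
    rw [segment_symm]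
    have := segment_nearVertex_disjoint hP hn hσ hε h2
    rcases h1 with rfl | rfl
    · exact this.1
    · exact this.2
  · push Not at h1
    by_cases h2 : j = finRotate n (finRotate n i)
    · have hev : 0 < σ * cr (P.outVec (finRotate n i)) (P.inVec (finRotate n i)) →
          ∀ᶠ ε in 𝓝[>] 0, 0 < σ * cr (P.outVec (finRotate n i))
          (P.nearVertex σ ε i - P.vertices (finRotate n (finRotate n i))) := by
        intro h0
        have hc : Continuous fun q : Plane => σ * cr (P.outVec (finRotate n i))
            (q - P.vertices (finRotate n (finRotate n i))) := by unfold cr; fun_prop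
        exact ((hc.tendsto _).comp (tendsto_nearVertex σ i)).eventually (Ioi_mem_nhds h0)
      have hsec : ∀ᶠ ε in 𝓝[>] 0, Sector σ (P.outVec (finRotate n i)) (P.inVec (finRotate n i))
          (P.nearVertex σ ε i - P.vertices (finRotate n (finRotate n i))) := by
        have hE : ∀ ε : ℝ, 0 < ε → 0 < σ * cr
            (P.nearVertex σ ε i - P.vertices (finRotate n (finRotate n i)))
            (P.inVec (finRotate n i)) := fun ε hε => by
          have : σ * cr (P.nearVertex σ ε i - P.vertices (finRotate n (finRotate n i)))
              (P.inVec (finRotate n i)) = ε * (σ * cr (P.outVec i) (P.direction σ i)) := by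
            simp [cr, nearVertex, outVec, inVec]; ring
          rw [this]
          exact mul_pos hε hd.1
        unfold Sector
        split_ifs with h0
        · filter_upwards [self_mem_nhdsWithin, hev h0] with ε hε h2
          exact ⟨h2, hE ε hε⟩
        · filter_upwards [self_mem_nhdsWithin] with ε hε
          exact .inr (hE ε hε)
      filter_upwards [hsec, self_mem_nhdsWithin] with ε h3 hε
      subst h2
      exact (segment_nearVertex_disjoint hP hn hσ hε h3).2
    · refine eventually_disjoint_segment (isCompact_edgeSet j).isClosed (tendsto_nearVertex σ i)
        (tendsto_nearVertex σ (finRotate n i)) ?_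
      rw [← edgeSet_eq_segment]
      exact hP.edge_disjoint _ _ (Ne.symm h1.2) h2 fun h => h1.1 ((finRotate n).injective h).symm

/-- Points that see vertices on the same side are joined by a path along the polygon. -/
theorem SeesFrom.linked (hP : P.IsSimpleClosed) (hn : 3 ≤ n) {σ : ℝ} (hσ : σ ≠ 0) {i : Fin n}
    {d : ℕ} {a b : Plane} (ha : P.SeesFrom σ a i) (hb : P.SeesFrom σ b ((finRotate n)^[d] i)) :
    Linked (P.boundary ℝ)ᶜ (d + 2) a b := by
  obtain ⟨ε, h1, h2, h3⟩ := ((ha.eventually_segment hP hn hσ).and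
    ((hb.eventually_segment hP hn hσ).and
      (eventually_all.2 (eventually_segment_nearVertex hP hn hσ)))).exists
  have key : ∀ m, Linked (P.boundary ℝ)ᶜ m (P.nearVertex σ ε i)
      (P.nearVertex σ ε ((finRotate n)^[m] i)) := by
    intro m
    induction m with
    | zero => exact Linked.refl _ _
    | succ m ih =>
      rw [Function.iterate_succ_apply']
      exact ih.trans (Linked.single (h3 _))
  exact ((key d).trans (Linked.single (segment_symm ℝ b _ ▸ h2))).cons h1

end Polygon

/-! ### Existence of visible vertices -/

theorem mem_segment_iff_add_smul {a b z : Plane} :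
    z ∈ segment ℝ a b ↔ ∃ t : ℝ, 0 ≤ t ∧ t ≤ 1 ∧ z = a + t • (b - a) := by
  rw [segment_eq_image']
  exact ⟨fun ⟨t, ht, h⟩ => ⟨t, ht.1, ht.2, h.symm⟩, fun ⟨t, h0, h1, h⟩ => ⟨t, ⟨h0, h1⟩, h.symm⟩⟩

/-- Every point of a closed set is hidden from an outside point by a visible point. -/
theorem exists_sees_on_segment {B : Set Plane} (hB : IsClosed B) {x p : Plane} (hx : x ∉ B)
    (hp : p ∈ B) : ∃ t : ℝ, 0 < t ∧ t ≤ 1 ∧ x + t • (p - x) ∈ B ∧ Sees B x (x + t • (p - x)) := by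
  have hc : Continuous fun t : ℝ => x + t • (p - x) := by fun_prop
  have hK : IsCompact (Icc (0 : ℝ) 1 ∩ (fun t : ℝ => x + t • (p - x)) ⁻¹' B) :=
    isCompact_Icc.inter_right (hB.preimage hc)
  obtain ⟨t, ⟨ht, htB⟩, hmin⟩ := hK.exists_isMinOn ⟨1, by simp, by simpa using hp⟩
    continuousOn_id
  have ht0 : 0 < t := by
    rcases ht.1.eq_or_lt with h | h
    · subst h; simp at htB; exact (hx htB).elim
    · exact h
  refine ⟨t, ht0, ht.2, htB, hx, fun z hz hzB => ?_⟩
  obtain ⟨s, hs0, hs1, rfl⟩ := mem_segment_iff_add_smul.1 hz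
  have h1 : x + s • (x + t • (p - x) - x) = x + (s * t) • (p - x) := by module
  rw [h1] at hzB ⊢
  have h2 : t ≤ s * t := hmin (a := s * t) ⟨⟨by positivity, by nlinarith [ht.2]⟩, hzB⟩
  have : s = 1 := by nlinarith
  rw [this, one_mul]

theorem eq_smul_add_smul {e f : Plane} (h : cr e f ≠ 0) (p : Plane) :
    p = (cr p f / cr e f) • e + (cr e p / cr e f) • f := by
  apply plane_ext <;>
    simp only [PiLp.add_apply, PiLp.smul_apply, smul_eq_mul, div_mul_eq_mul_div, ← add_div] <;>
    rw [eq_div_iff h] <;> simp only [cr] <;> ring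

/-- The affine coordinates for which `x`, `y`, `v` are the origin and the two unit points. -/
theorem exists_affine_coords {x y v : Plane} (hΔ : cr (y - x) (v - x) ≠ 0) :
    ∃ A B : Plane → ℝ, (∀ p, p = x + A p • (y - x) + B p • (v - x)) ∧
      (∀ (p q : Plane) (s : ℝ), A (p + s • (q - p)) = (1 - s) * A p + s * A q) ∧
      (∀ (p q : Plane) (s : ℝ), B (p + s • (q - p)) = (1 - s) * B p + s * B q) ∧
      A x = 0 ∧ B x = 0 ∧ A y = 1 ∧ B y = 0 ∧ A v = 0 ∧ B v = 1 := by
  refine ⟨fun p => cr (p - x) (v - x) / cr (y - x) (v - x),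
    fun p => cr (y - x) (p - x) / cr (y - x) (v - x), fun p => ?_, fun p q s => ?_,
    fun p q s => ?_, ?_, ?_, div_self hΔ, ?_, ?_, div_self hΔ⟩
  · have := eq_smul_add_smul hΔ (p - x)
    rw [add_assoc, ← this]; simp
  · rw [div_eq_iff hΔ, add_mul, mul_assoc, mul_assoc, div_mul_cancel₀ _ hΔ, div_mul_cancel₀ _ hΔ]
    simp [cr]; ring
  · rw [div_eq_iff hΔ, add_mul, mul_assoc, mul_assoc, div_mul_cancel₀ _ hΔ, div_mul_cancel₀ _ hΔ]
    simp [cr]; ring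
  · simp [cr]
  · simp [cr]
  · rw [div_eq_zero_iff]; left; simp only [cr]; ring
  · rw [div_eq_zero_iff]; left; simp only [cr]; ring

namespace Polygon.IsSimpleClosed

variable {n : ℕ} {P : Polygon Plane n} (hP : P.IsSimpleClosed)
include hP

set_option maxHeartbeats 1000000 in
/-- If an inner point of an edge is visible from `x`, then a vertex is visible within the triangle that
`x` forms with a part of this edge. -/
theorem exists_sees_in_triangle {x y c : Plane} {i k : Fin n} (hxy : Sees (P.boundary ℝ) x y)
    (hyB : y ∈ P.boundary ℝ) (hyv : ∀ j, y ≠ P.vertices j)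
    (hi : P.edgeSet ℝ i = segment ℝ (P.vertices k) c) (hy : y ∈ openSegment ℝ (P.vertices k) c)
    (hΔ : cr (y - x) (P.vertices k - x) ≠ 0) :
    ∃ (j : Fin n) (a b : ℝ), 0 ≤ a ∧ 0 ≤ b ∧
      P.vertices j = x + a • (y - x) + b • (P.vertices k - x) ∧
        Sees (P.boundary ℝ) x (P.vertices j) := by
  classical
  set v := P.vertices k with hv
  obtain ⟨A, B, hdec, hAaff, hBaff, hAx, hBx, hAy, hBy, hAv, hBv⟩ := exists_affine_coords hΔ
  have hedge : ∀ z ∈ P.edgeSet ℝ i, A z + B z = 1 := by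
    obtain ⟨s, t, hs, ht, hst, rfl⟩ := hy
    have h1 : s • v + t • c = v + t • (c - v) := by
      have : s = 1 - t := by linarith
      subst this; module
    rw [h1, hAaff, hAv] at hAy
    rw [h1, hBaff, hBv] at hBy
    have hc : A c + B c = 1 := by
      have : t * (A c + B c - 1) = 0 := by linarith
      rcases mul_eq_zero.1 this with h | h <;> linarith
    intro z hz
    rw [hi] at hz
    obtain ⟨r, -, -, rfl⟩ := mem_segment_iff_add_smul.1 hz
    rw [hAaff, hBaff, hAv, hBv]
    linear_combination r * hc
  have hyi : y ∈ P.edgeSet ℝ i := hi ▸ openSegment_subset_segment ℝ _ _ hy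
  let C : Finset (Fin n) := Finset.univ.filter fun j =>
    0 ≤ A (P.vertices j) ∧ 0 ≤ B (P.vertices j) ∧ A (P.vertices j) + B (P.vertices j) ≤ 1
  -- Among the vertices in the triangle, the one closest in angle to the ray through `y` is taken,
  -- and on this ray the one closest to `x`.
  let key : Fin n → ℝ ×ₗ ℝ := fun j => toLex
    (B (P.vertices j) / (A (P.vertices j) + B (P.vertices j)), A (P.vertices j) + B (P.vertices j))
  obtain ⟨m, hmC, hmin⟩ := C.exists_min_image key ⟨k, by simp [C, ← hv, hAv, hBv]⟩
  have hxv (j : Fin n) : x ≠ P.vertices j := fun h => hxy.1 (h ▸ vertex_mem_boundary j)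
  have hpos : ∀ j ∈ C, 0 < A (P.vertices j) + B (P.vertices j) := by
    intro j hj
    obtain ⟨h1, h2, h3⟩ := (Finset.mem_filter.1 hj).2
    rcases (add_nonneg h1 h2).eq_or_lt with h | h
    · have h4 : A (P.vertices j) = 0 := by linarith
      have h5 : B (P.vertices j) = 0 := by linarith
      have := hdec (P.vertices j)
      rw [h4, h5] at this
      simp at this
      exact (hxv j this.symm).elim
    · exact h
  obtain ⟨hA0, hB0, hAB0⟩ := (Finset.mem_filter.1 hmC).2
  have hm0 := hpos m hmC
  refine ⟨m, A (P.vertices m), B (P.vertices m), hA0, hB0, hdec _, hxy.1, ?_⟩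
  set w := P.vertices m with hw
  have hB0' : 0 < B w := by
    rcases hB0.eq_or_lt with h | h
    · have h1 := hdec w
      rw [← h, zero_smul, add_zero] at h1
      have h2 := hxy.2 w (mem_segment_iff_add_smul.2 ⟨A w, hA0, by linarith, h1⟩)
        (vertex_mem_boundary m)
      exact (hyv m h2.symm).elim
    · exact h
  have hangle : ∀ j ∈ C, ¬ A w * B (P.vertices j) < B w * A (P.vertices j) := by
    intro j hj hlt
    have h1 := hmin j hj
    have h2 := hpos j hj
    rw [Prod.Lex.le_iff] at h1
    have h3 : B (P.vertices j) / (A (P.vertices j) + B (P.vertices j)) < B w / (A w + B w) := by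
      rw [div_lt_div_iff₀ h2 hm0]; linarith
    rcases h1 with h1 | h1
    · exact absurd h1 h3.le.not_gt
    · exact absurd h1.1 h3.ne'
  have hray : ∀ (j : Fin n) (μ : ℝ), 0 < μ → μ < 1 → P.vertices j ≠ x + μ • (w - x) := by
    intro j μ hμ0 hμ1 hj
    have h1 : A (P.vertices j) = μ * A w := by rw [hj, hAaff, hAx]; ring
    have h2 : B (P.vertices j) = μ * B w := by rw [hj, hBaff, hBx]; ring
    have hjC : j ∈ C := Finset.mem_filter.2 ⟨Finset.mem_univ _, by rw [h1]; positivity,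
      by rw [h2]; positivity, by rw [h1, h2]; nlinarith⟩
    have h3 := hmin j hjC
    rw [Prod.Lex.le_iff] at h3
    have h4 : B (P.vertices j) / (A (P.vertices j) + B (P.vertices j)) = B w / (A w + B w) := by
      rw [h1, h2]; field_simp
    rcases h3 with h3 | h3
    · exact absurd h3 (not_lt.2 h4.le)
    · have : A w + B w ≤ A (P.vertices j) + B (P.vertices j) := h3.2
      rw [h1, h2] at this
      nlinarith
  intro z hz hzB
  by_contra hzw
  obtain ⟨l, hl0, hl1, rfl⟩ := mem_segment_iff_add_smul.1 hz
  have hl0' : 0 < l := by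
    rcases hl0.eq_or_lt with h | h
    · subst h; simp at hzB; exact (hxy.1 hzB).elim
    · exact h
  have hl1' : l < 1 := by
    rcases hl1.eq_or_lt with h | h
    · subst h; simp at hzw
    · exact h
  set z := x + l • (w - x) with hzdef
  have hzA : A z = l * A w := by rw [hzdef, hAaff, hAx]; ring
  have hzBB : B z = l * B w := by rw [hzdef, hBaff, hBx]; ring
  obtain ⟨g, hg⟩ := mem_boundary_iff.1 hzB
  have hgi : g ≠ i := by
    rintro rfl
    have := hedge z hg
    rw [hzA, hzBB] at this
    nlinarith
  -- No end of the blocking edge `g` lies strictly on the side of `y`. By minimality such an end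
  -- would be outside the triangle, so `g` would leave it either through the side `xy`, which meets
  -- the polygon only in `y`, or through the edge `i`, which it can meet only in a vertex.
  have hend : ∀ j : Fin n, segment ℝ z (P.vertices j) ⊆ P.edgeSet ℝ g →
      ¬ A w * B (P.vertices j) < B w * A (P.vertices j) := by
    intro j hj hlt
    have hvert : ∀ p ∈ P.edgeSet ℝ g, p ∈ P.edgeSet ℝ i → ∃ j', p = P.vertices j' := by
      intro p hpg hpi
      rcases hP.eq_of_mem_of_mem hgi hpg hpi with h | h
      exacts [⟨_, h.2⟩, ⟨_, h.2⟩]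
    by_cases hjC : j ∈ C
    · exact hangle j hjC hlt
    -- The side `A = 0` needs no control, since `A > 0` follows from `B ≥ 0` and the strict
    -- inequality.
    have hcont : Continuous fun s : ℝ => min (B (z + s • (P.vertices j - z)))
        (1 - A (z + s • (P.vertices j - z)) - B (z + s • (P.vertices j - z))) := by
      simp only [hAaff, hBaff]; fun_prop
    have hj1 : min (B (P.vertices j)) (1 - A (P.vertices j) - B (P.vertices j)) ≤ 0 := by
      by_contra! h
      rw [lt_min_iff] at h
      refine hjC (Finset.mem_filter.2 ⟨Finset.mem_univ _, ?_, h.1.le, by linarith⟩)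
      by_contra! h3
      nlinarith [mul_nonneg hA0 h.1.le]
    have hz1 : 0 < min (B z) (1 - A z - B z) := by
      rw [lt_min_iff, hzA, hzBB]
      exact ⟨by positivity, by nlinarith⟩
    obtain ⟨s, hs, hs0⟩ := intermediate_value_Icc' zero_le_one hcont.continuousOn
      (show (0 : ℝ) ∈ Icc _ _ from ⟨by simpa using hj1, by simpa using hz1.le⟩)
    simp only at hs0
    have hsne : 0 < s := by
      rcases hs.1.eq_or_lt with h | h
      · subst h; simp at hs0; simp at hz1; rcases min_choice (B z) (1 - A z - B z) with h | h <;>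
          rw [h] at hs0 <;> linarith
      · exact h
    set p := z + s • (P.vertices j - z) with hp
    have hpg : p ∈ P.edgeSet ℝ g := hj (mem_segment_iff_add_smul.2 ⟨s, hs.1, hs.2, rfl⟩)
    have hpD : A w * B p < B w * A p := by
      rw [hp, hAaff, hBaff, hzA, hzBB]
      nlinarith
    rcases min_eq_iff.1 hs0 with ⟨h1, h2⟩ | ⟨h1, h2⟩
    · have hAp : 0 < A p := by
        rw [h1, mul_zero] at hpD
        exact pos_of_mul_pos_right hpD hB0'.le
      have h3 := hdec p
      rw [h1, zero_smul, add_zero] at h3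
      have h4 := hxy.2 p (mem_segment_iff_add_smul.2 ⟨A p, hAp.le, by linarith, h3⟩)
        (edgeSet_subset_boundary g hpg)
      obtain ⟨j', hj'⟩ := hvert p hpg (h4 ▸ hyi)
      exact hyv j' (h4 ▸ hj')
    · replace h2 : 0 ≤ B p := by linarith
      have hAp : 0 < A p := by
        have : 0 < B w * A p := lt_of_le_of_lt (mul_nonneg hA0 h2) hpD
        exact pos_of_mul_pos_right this hB0'.le
      have hpi : p ∈ P.edgeSet ℝ i := by
        rw [hi]
        refine (convex_segment v c).segment_subset (hi ▸ hyi) (left_mem_segment ..)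
          (mem_segment_iff_add_smul.2 ⟨B p, h2, by linarith, ?_⟩)
        have : A p = 1 - B p := by linarith
        conv_lhs => rw [hdec p, this]
        module
      obtain ⟨j', hj'⟩ := hvert p hpg hpi
      rw [hj'] at h1 h2 hAp hpD
      exact hangle j' (Finset.mem_filter.2 ⟨Finset.mem_univ _, hAp.le, h2, by linarith⟩) hpD
  have h1 := hend g (by
    rw [edgeSet_eq_segment] at hg ⊢
    exact (convex_segment _ _).segment_subset hg (left_mem_segment ..))
  have h2 := hend (finRotate n g) (by
    rw [edgeSet_eq_segment] at hg ⊢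
    exact (convex_segment _ _).segment_subset hg (right_mem_segment ..))
  obtain ⟨τ, ⟨hτ0, hτ1⟩, hτ⟩ := mem_edgeSet_iff.1 hg
  have hτ0' : 0 < τ := by
    rcases hτ0.eq_or_lt with h | h
    · subst h; rw [zero_smul, add_zero] at hτ; exact (hray g l hl0' hl1' hτ.symm).elim
    · exact h
  have hτ1' : τ < 1 := by
    rcases hτ1.eq_or_lt with h | h
    · subst h; rw [one_smul, add_sub_cancel] at hτ
      exact (hray _ l hl0' hl1' hτ.symm).elim
    · exact h
  have hA' : l * A w = (1 - τ) * A (P.vertices g) + τ * A (P.vertices (finRotate n g)) := by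
    rw [← hzA, hτ, hAaff]
  have hB' : l * B w = (1 - τ) * B (P.vertices g) + τ * B (P.vertices (finRotate n g)) := by
    rw [← hzBB, hτ, hBaff]
  have hD : (1 - τ) * (A w * B (P.vertices g) - B w * A (P.vertices g)) +
      τ * (A w * B (P.vertices (finRotate n g)) - B w * A (P.vertices (finRotate n g))) = 0 := by
    linear_combination B w * hA' - A w * hB'
  have hτ2 : 0 < 1 - τ := by linarith
  have hD1 : A w * B (P.vertices g) = B w * A (P.vertices g) := by
    nlinarith [mul_nonneg hτ2.le (sub_nonneg.2 (not_lt.1 h1)),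
      mul_nonneg hτ0'.le (sub_nonneg.2 (not_lt.1 h2))]
  have hD2 : A w * B (P.vertices (finRotate n g)) = B w * A (P.vertices (finRotate n g)) := by
    nlinarith [mul_nonneg hτ2.le (sub_nonneg.2 (not_lt.1 h1)),
      mul_nonneg hτ0'.le (sub_nonneg.2 (not_lt.1 h2))]
  -- Now `g` lies on the line `xw`. Its ends are not strictly between `x` and `w`, but its point `z`
  -- is, so `g` contains `x`.
  have hline : ∀ p : Plane, A w * B p = B w * A p → p = x + (B p / B w) • (w - x) := by
    intro p hp
    conv_lhs => rw [hdec p]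
    have h3 := hdec w
    have : w - x = A w • (y - x) + B w • (v - x) := by rw [sub_eq_iff_eq_add', ← add_assoc]; exact h3
    rw [this, smul_add, smul_smul, smul_smul, div_mul_cancel₀ _ hB0'.ne', div_mul_eq_mul_div,
      mul_comm (B p), hp, mul_comm (B w), mul_div_cancel_right₀ _ hB0'.ne', add_assoc]
  have hμ : l = (1 - τ) * (B (P.vertices g) / B w) + τ * (B (P.vertices (finRotate n g)) / B w) := by
    field_simp; linarith
  have hc1 := hline _ hD1
  have hc2 := hline _ hD2
  set μ1 := B (P.vertices g) / B w
  set μ2 := B (P.vertices (finRotate n g)) / B w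
  have hμ1 : μ1 ≤ 0 ∨ 1 ≤ μ1 := by
    by_contra! h
    exact hray _ μ1 h.1 h.2 hc1
  have hμ2 : μ2 ≤ 0 ∨ 1 ≤ μ2 := by
    by_contra! h
    exact hray _ μ2 h.1 h.2 hc2
  have hfin : ∀ a b : ℝ, a ≤ 0 → 0 < b → x ∈ segment ℝ (x + a • (w - x)) (x + b • (w - x)) := by
    intro a b ha hb
    have : 0 < b - a := by linarith
    refine mem_segment_iff_add_smul.2 ⟨-a / (b - a), by apply div_nonneg <;> linarith,
      by rw [div_le_one this]; linarith, ?_⟩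
    have h3 : x + a • (w - x) + (-a / (b - a)) • (x + b • (w - x) - (x + a • (w - x))) =
        x + (a + (-a / (b - a)) * (b - a)) • (w - x) := by module
    rw [h3, div_mul_cancel₀ _ this.ne']; simp
  refine hxy.1 (edgeSet_subset_boundary g ?_)
  rw [edgeSet_eq_segment, hc1, hc2]
  rcases hμ1 with h3 | h3 <;> rcases hμ2 with h4 | h4
  · nlinarith
  · exact hfin _ _ h3 (by linarith)
  · rw [segment_symm]; exact hfin _ _ h4 (by linarith)
  · nlinarith

/-- Every open half-plane whose boundary line contains `x` and that meets the polygon contains a vertex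
that is visible from `x`. -/
theorem exists_sees_of_dt_pos {x p u : Plane} (hx : x ∉ P.boundary ℝ) (hp : p ∈ P.boundary ℝ)
    (hu : 0 < dt u (p - x)) :
    ∃ j, Sees (P.boundary ℝ) x (P.vertices j) ∧ 0 < dt u (P.vertices j - x) := by
  obtain ⟨t, ht0, ht1, hyB, hy⟩ := exists_sees_on_segment isCompact_boundary.isClosed hx hp
  set y := x + t • (p - x) with hydef
  have huy : 0 < dt u (y - x) := by
    have : dt u (y - x) = t * dt u (p - x) := by simp [hydef, dt]; ring
    rw [this]; positivity
  by_cases hyv : ∃ j, y = P.vertices j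
  · obtain ⟨j, hj⟩ := hyv
    exact ⟨j, hj ▸ hy, hj ▸ huy⟩
  push Not at hyv
  obtain ⟨i, hi⟩ := mem_boundary_iff.1 hyB
  have core : ∀ (k : Fin n) (c : Plane), P.edgeSet ℝ i = segment ℝ (P.vertices k) c →
      c ≠ y → dt u (y - x) ≤ dt u (P.vertices k - x) →
      ∃ j, Sees (P.boundary ℝ) x (P.vertices j) ∧ 0 < dt u (P.vertices j - x) := by
    intro k c hk hcy hle
    have hyo : y ∈ openSegment ℝ (P.vertices k) c :=
      mem_openSegment_of_ne_left_right (hyv k).symm hcy (hk ▸ hi)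
    -- If the edge were in line with `x`, its end `k` would lie beyond `y` and the edge would extend
    -- from `y` towards `x`, hiding `y`.
    have hΔ : cr (y - x) (P.vertices k - x) ≠ 0 := by
      intro h0
      have hyx : y - x ≠ 0 := fun h => by rw [h] at huy; simp [dt] at huy
      have h1 := eq_smul_of_cr_eq_zero hyx h0
      obtain ⟨s, s', hs, hs', hss, hys⟩ := hyo
      set r := dt (y - x) (P.vertices k - x) / dt (y - x) (y - x) with hr
      have h2 : dt u (P.vertices k - x) = r * dt u (y - x) := by rw [h1]; simp [dt]; ring
      have hr1 : 1 ≤ r := by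
        by_contra! h
        nlinarith
      have hr1' : 1 < r := by
        rcases hr1.eq_or_lt with h | h
        · rw [← h, one_smul, sub_left_inj] at h1
          exact (hyv k h1.symm).elim
        · exact h
      -- a point of the edge on the near side of `y`
      have hdir : c - y = -((s * (r - 1)) / s') • (y - x) := by
        have h3 : s' • (c - y) = -(s * (r - 1)) • (y - x) := by
          have h4 : P.vertices k = x + r • (y - x) := by rw [← h1]; simp
          have h5 : s' • c = y - s • P.vertices k := by rw [← hys]; simp
          rw [smul_sub, h5, h4]
          have : s = 1 - s' := by linarith
          subst this; module
        rw [neg_div', neg_mul_eq_neg_mul] at *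
        rw [div_eq_inv_mul, mul_smul, ← h3, smul_smul, inv_mul_cancel₀ hs'.ne', one_smul]
      set q := s * (r - 1) / s' with hq
      have hq0 : 0 < q := by
        have : 0 < r - 1 := by linarith
        positivity
      set ρ := min 1 (1 / q) with hρ
      have hρ0 : 0 < ρ := by positivity
      have hρ1 : ρ ≤ 1 := min_le_left _ _
      have hρq : ρ * q ≤ 1 := by
        have : ρ ≤ 1 / q := min_le_right _ _
        rwa [le_div_iff₀ hq0] at this
      have hmem1 : y + ρ • (c - y) ∈ P.edgeSet ℝ i := by
        rw [hk]
        exact (convex_segment _ _).segment_subset (hk ▸ hi) (right_mem_segment ..)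
          (mem_segment_iff_add_smul.2 ⟨ρ, hρ0.le, hρ1, rfl⟩)
      have hmem2 : y + ρ • (c - y) ∈ segment ℝ x y := by
        refine mem_segment_iff_add_smul.2 ⟨1 - ρ * q, by linarith, by nlinarith, ?_⟩
        rw [hdir]; module
      have h6 := hy.2 _ hmem2 (edgeSet_subset_boundary i hmem1)
      rw [add_eq_left, smul_eq_zero] at h6
      rcases h6 with h6 | h6
      · exact hρ0.ne' h6
      · exact hcy (sub_eq_zero.1 h6)
    obtain ⟨j, a, b, ha, hb, hj, hsee⟩ := hP.exists_sees_in_triangle hy hyB hyv hk hyo hΔ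
    refine ⟨j, hsee, ?_⟩
    have h1 : dt u (P.vertices j - x) = a * dt u (y - x) + b * dt u (P.vertices k - x) := by
      rw [hj]; simp [dt]; ring
    rw [h1]
    have hab : 0 < a + b := by
      by_contra! h
      have ha0 : a = 0 := by linarith
      have hb0 : b = 0 := by linarith
      subst ha0; subst hb0
      simp at hj
      exact hx (hj ▸ vertex_mem_boundary j)
    nlinarith [mul_nonneg hb (sub_nonneg.2 hle)]
  have hseg := edgeSet_eq_segment (P := P) i
  -- One end of the edge reaches at least as far as `y` in the direction `u`. The triangle formed
  -- with this end lies in the half-plane, apart from `x`.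
  rcases le_total (dt u (y - x)) (dt u (P.vertices i - x)) with h | h
  · exact core i _ hseg (hyv _).symm h
  · refine core (finRotate n i) (P.vertices i) (by rw [segment_symm]; exact hseg) (hyv _).symm ?_
    rw [hseg] at hi
    obtain ⟨s, s', hs, hs', hss, hys⟩ := hi
    have h1 : dt u (y - x) = s * dt u (P.vertices i - x) + s' * dt u (P.vertices (finRotate n i) - x) := by
      rw [← hys]
      have : s = 1 - s' := by linarith
      subst this
      simp only [dt, PiLp.sub_apply, PiLp.add_apply, PiLp.smul_apply, smul_eq_mul]; ring
    have hs'0 : 0 < s' := by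
      rcases hs'.eq_or_lt with h2 | h2
      · have hs1 : s = 1 := by linarith
        rw [← h2, hs1] at hys
        simp at hys
        exact (hyv i hys.symm).elim
      · exact h2
    have : s = 1 - s' := by linarith
    subst this
    nlinarith

end Polygon.IsSimpleClosed

/-! ### Points separated from the polygon by a line -/

/-- `x` is strictly separated from `B` by a line. -/
def IsFree (B : Set Plane) (x : Plane) : Prop := ∃ u, ∀ p ∈ B, dt u (p - x) < 0

theorem IsFree.notMem {B : Set Plane} {x : Plane} (h : IsFree B x) : x ∉ B := fun hx => by
  obtain ⟨u, hu⟩ := h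
  simpa [dt] using hu x hx

theorem segment_subset_compl_of_dt_pos {B : Set Plane} {x y u : Plane}
    (hu : ∀ p ∈ B, dt u (p - x) < 0) (hy : 0 ≤ dt u (y - x)) : segment ℝ x y ⊆ Bᶜ := by
  intro z hz hzB
  obtain ⟨t, ht0, -, rfl⟩ := mem_segment_iff_add_smul.1 hz
  have h1 := hu _ hzB
  have h2 : dt u (x + t • (y - x) - x) = t * dt u (y - x) := by simp [dt]; ring
  rw [h2] at h1
  nlinarith

/-- Two points that are strictly separated from a compact set by lines are joined by a path with two edges. -/
theorem IsFree.linked_two {B : Set Plane} (hB : IsCompact B) {x y : Plane} (hx : IsFree B x)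
    (hy : IsFree B y) : Linked Bᶜ 2 x y := by
  rcases B.eq_empty_or_nonempty with rfl | ⟨p0, hp0⟩
  · exact (Linked.single (by simp)).cons (b := y) (by simp)
  obtain ⟨u, hu⟩ := hx
  obtain ⟨w, hw⟩ := hy
  have hw0 : w ≠ 0 := by
    rintro rfl
    simpa [dt] using hw p0 hp0
  -- Half-planes with parallel normals may be disjoint, but compactness of `B` allows the first
  -- normal to be tilted a little.
  have key : ∃ u', (∀ p ∈ B, dt u' (p - x) < 0) ∧ cr u' w ≠ 0 := by
    by_cases h : cr u w = 0
    · have hev : ∀ᶠ ε : ℝ in 𝓝 0, ∀ p ∈ B, dt (u + ε • rot w) (p - x) < 0 := by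
        refine hB.eventually_forall_of_forall_eventually fun p hp => ?_
        have hc : Continuous fun q : ℝ × Plane => dt (u + q.1 • rot w) (q.2 - x) := by
          simp only [dt, rot, PiLp.add_apply, PiLp.smul_apply]
          fun_prop
        exact hc.continuousAt.eventually (Iio_mem_nhds (by simpa using hu p hp))
      obtain ⟨ε, h1, h2⟩ := ((hev.filter_mono nhdsWithin_le_nhds).and
        (self_mem_nhdsWithin : Ioi (0 : ℝ) ∈ 𝓝[>] 0)).exists
      refine ⟨_, h1, ?_⟩
      have h3 : cr (u + ε • rot w) w = cr u w - ε * dt w w := by simp [cr, dt]; ring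
      rw [h3, h]
      have h2 : 0 < ε := h2
      have := mul_pos h2 (dt_self_pos hw0)
      linarith
    · exact ⟨u, hu, h⟩
  obtain ⟨u', hu', hΔ⟩ := key
  -- a point far out in both half-planes
  obtain ⟨m, hm1, hm2⟩ : ∃ m, 0 < dt u' m ∧ 0 < dt w m := by
    refine ⟨(cr u' w) • (rot u' - rot w), ?_, ?_⟩
    · have : dt u' ((cr u' w) • (rot u' - rot w)) = cr u' w * cr u' w := by simp [cr, dt]; ring
      rw [this]; exact mul_self_pos.2 hΔ
    · have : dt w ((cr u' w) • (rot u' - rot w)) = cr u' w * cr u' w := by simp [cr, dt]; ring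
      rw [this]; exact mul_self_pos.2 hΔ
  set t := max (-(dt u' (y - x)) / dt u' m) 0 with ht
  have h1 : 0 ≤ dt u' (y + t • m - x) := by
    have h2 : dt u' (y + t • m - x) = dt u' (y - x) + t * dt u' m := by simp [dt]; ring
    rw [h2]
    have := le_max_left (-(dt u' (y - x)) / dt u' m) 0
    rw [div_le_iff₀ hm1] at this
    linarith
  have h3 : 0 ≤ dt w (y + t • m - y) := by
    have h2 : dt w (y + t • m - y) = t * dt w m := by simp [dt]; ring
    rw [h2]
    exact mul_nonneg (le_max_right _ _) hm2.le
  refine Linked.cons (segment_subset_compl_of_dt_pos hu' h1) (Linked.single ?_)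
  rw [segment_symm]
  exact segment_subset_compl_of_dt_pos hw h3

namespace Polygon

variable {n : ℕ} {P : Polygon Plane n}

/-- The ray from `x` in the separating direction avoids the polygon and is unbounded. -/
theorem _root_.IsFree.mem_ext {x : Plane} (hn : 0 < n) (h : IsFree (P.boundary ℝ) x) : x ∈ P.ext := by
  refine ⟨h.notMem, fun hb => ?_⟩
  obtain ⟨u, hu⟩ := h
  have hu0 : u ≠ 0 := by
    rintro rfl
    simpa [dt] using hu _ (vertex_mem_boundary ⟨0, hn⟩)
  have huu := dt_self_pos hu0
  have hmem (t : ℝ) (ht : 0 ≤ t) : x + t • u ∈ connectedComponentIn (P.boundary ℝ)ᶜ x := by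
    refine (convex_segment x (x + t • u)).isPreconnected.subset_connectedComponentIn
      (left_mem_segment ..) (segment_subset_compl_of_dt_pos hu ?_) (right_mem_segment ..)
    have : dt u (x + t • u - x) = t * dt u u := by simp [dt]; ring
    rw [this]; positivity
  obtain ⟨C, hC⟩ := hb.exists_norm_le
  have hunorm : 0 < ‖u‖ := norm_pos_iff.2 hu0
  have h1 := hC _ (hmem ((C + ‖x‖ + 1) / ‖u‖) (by
    have := (norm_nonneg x).trans (hC x (by simpa using hmem 0 le_rfl))
    positivity))
  have h2 : ‖((C + ‖x‖ + 1) / ‖u‖) • u‖ = |C + ‖x‖ + 1| := by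
    rw [norm_smul, Real.norm_eq_abs, abs_div, abs_norm, div_mul_cancel₀ _ hunorm.ne']
  have h3 := norm_sub_norm_le (((C + ‖x‖ + 1) / ‖u‖) • u) (-x)
  rw [sub_neg_eq_add, norm_neg, h2, add_comm _ x] at h3
  have := le_abs_self (C + ‖x‖ + 1)
  linarith

theorem not_isFree_of_mem_int {x : Plane} (hn : 0 < n) (h : x ∈ P.int) :
    ¬ IsFree (P.boundary ℝ) x := fun h' => notMem_ext_of_mem_int h (h'.mem_ext hn)

theorem dt_eq_inner (u v : Plane) : dt u v = inner ℝ u v := by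
  simp [dt, PiLp.inner_apply, Fin.sum_univ_two, mul_comm]

/-- Points that are far away are strictly separated from the polygon. -/
theorem isFree_of_norm_lt {C : ℝ} (hC : ∀ p ∈ P.boundary ℝ, ‖p‖ ≤ C) {x : Plane} (hx : C < ‖x‖) :
    IsFree (P.boundary ℝ) x := by
  refine ⟨x, fun p hp => ?_⟩
  have h1 : dt x (p - x) = inner ℝ x p - ‖x‖ * ‖x‖ := by
    rw [dt_eq_inner, inner_sub_right, real_inner_self_eq_norm_mul_norm]
  rw [h1]
  have h2 := real_inner_le_norm x p
  have h3 := hC p hp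
  have := norm_nonneg p
  nlinarith

theorem exists_isFree : ∃ x, IsFree (P.boundary ℝ) x := by
  obtain ⟨C, hC⟩ := isCompact_boundary.isBounded.exists_norm_le
  obtain ⟨x, hx⟩ := NormedSpace.exists_lt_norm ℝ Plane C
  exact ⟨x, isFree_of_norm_lt hC hx⟩

/-- An unbounded component contains points far away, and these are free. -/
theorem wind_eq_zero_of_mem_ext {x : Plane} (hx : x ∈ P.ext) : P.wind x = 0 := by
  obtain ⟨C, hC⟩ := (isCompact_boundary (P := P)).isBounded.exists_norm_le
  have : ∃ y ∈ connectedComponentIn (P.boundary ℝ)ᶜ x, C < ‖y‖ := by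
    by_contra! h
    exact hx.2 (isBounded_iff_forall_norm_le.2 ⟨C, h⟩)
  obtain ⟨y, hy, hyC⟩ := this
  rw [wind_eq_of_isPreconnected isPreconnected_connectedComponentIn
    (connectedComponentIn_subset _ _) (mem_connectedComponentIn hx.1) hy]
  obtain ⟨u, hu⟩ := isFree_of_norm_lt hC hyC
  exact wind_eq_zero_of_free hu

/-! ### The number of visible vertices -/

section Visible

variable (P) in
open Classical in
/-- The vertices that are visible from `x`. -/
noncomputable def visible (x : Plane) : Finset (Fin n) :=
  Finset.univ.filter fun i => Sees (P.boundary ℝ) x (P.vertices i)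

theorem mem_visible {x : Plane} {i : Fin n} :
    i ∈ P.visible x ↔ Sees (P.boundary ℝ) x (P.vertices i) := by simp [visible]

variable (hP : P.IsSimpleClosed) (hn : 3 ≤ n)
include hP hn

/-- If the polygon were contained in a line, the two edges at an extreme vertex would overlap. -/
theorem IsSimpleClosed.not_collinear {u : Plane} (hu : u ≠ 0) (x : Plane) :
    ∃ p ∈ P.boundary ℝ, dt u (p - x) ≠ 0 := by
  by_contra! h
  have hne : Nonempty (Fin n) := ⟨⟨0, by omega⟩⟩
  obtain ⟨j, hj⟩ := Finite.exists_max fun i : Fin n => cr u (P.vertices i)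
  obtain ⟨i, rfl⟩ := (finRotate n).surjective j
  have hd := hP.dt_neg hn i
  have hvec (k l : Fin n) : dt u (P.vertices k - P.vertices l) = 0 := by
    have h1 := h _ (vertex_mem_boundary k)
    have h2 := h _ (vertex_mem_boundary l)
    simp only [dt, PiLp.sub_apply] at *
    linarith
  have huu := dt_self_pos hu
  have key : ∀ a b : Plane, dt u a = 0 → dt u b = 0 →
      cr a b * dt u u = 0 ∧ dt a b * dt u u = cr u a * cr u b := by
    intro a b ha hb
    constructor
    · have : cr a b * dt u u = dt u a * cr u b - cr u a * dt u b := by simp only [cr, dt]; ring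
      rw [this, ha, hb]; ring
    · have : dt a b * dt u u = dt u a * dt u b + cr u a * cr u b := by simp only [cr, dt]; ring
      rw [this, ha, hb]; ring
  obtain ⟨h1, h2⟩ := key _ _ (hvec (finRotate n (finRotate n i)) (finRotate n i)) (hvec i (finRotate n i))
  have h3 := hd ((mul_eq_zero.1 h1).resolve_right huu.ne')
  have h4 := hj (finRotate n (finRotate n i))
  have h5 := hj i
  have h6 : ∀ a b : Plane, cr u (a - b) = cr u a - cr u b := fun a b => by simp [cr]; ring
  rw [h6, h6] at h2
  have h7 := mul_nonneg_of_nonpos_of_nonpos (sub_nonpos.2 h4) (sub_nonpos.2 h5)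
  nlinarith

theorem IsSimpleClosed.exists_sees_dt_ne_zero {x u : Plane} (hx : x ∉ P.boundary ℝ) (hu : u ≠ 0) :
    ∃ i ∈ P.visible x, dt u (P.vertices i - x) ≠ 0 := by
  obtain ⟨p, hp, hne⟩ := hP.not_collinear hn hu x
  rcases hne.lt_or_gt with h | h
  · have h' : 0 < dt (-u) (p - x) := by simp [dt] at h ⊢; linarith
    obtain ⟨j, hj, hj'⟩ := hP.exists_sees_of_dt_pos hx hp h'
    refine ⟨j, mem_visible.2 hj, fun h0 => ?_⟩
    simp [dt] at h0 hj'
    linarith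
  · obtain ⟨j, hj, hj'⟩ := hP.exists_sees_of_dt_pos hx hp h
    exact ⟨j, mem_visible.2 hj, hj'.ne'⟩

/-- If at most one vertex were visible, some line through `x` would contain all visible vertices,
against `exists_sees_dt_ne_zero`. -/
theorem IsSimpleClosed.two_le_card_visible {x : Plane} (hx : x ∉ P.boundary ℝ) :
    2 ≤ (P.visible x).card := by
  by_contra! h
  have hxv (j : Fin n) : P.vertices j - x ≠ 0 :=
    _root_.sub_ne_zero.2 fun h => hx (h ▸ vertex_mem_boundary j)
  rcases (P.visible x).eq_empty_or_nonempty with h0 | ⟨i, hi⟩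
  · obtain ⟨i, hi, -⟩ := hP.exists_sees_dt_ne_zero hn hx (hxv ⟨0, by omega⟩)
    simp [h0] at hi
  · obtain ⟨j, hj, hne⟩ := hP.exists_sees_dt_ne_zero hn hx (rot_ne_zero (hxv i))
    rw [Finset.card_le_one.1 (by omega : (P.visible x).card ≤ 1) j hj i hi] at hne
    exact hne (by simp [dt]; ring)

/-- Suppose that only two vertices are visible. If they are not in line with `x`, they lie in a
common open half-plane at `x`; the opposite half-plane contains no visible vertex, hence no point of
the polygon, and `x` is free. Otherwise one line through `x` contains all visible vertices, which is
impossible. -/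
theorem IsSimpleClosed.three_le_card_visible {x : Plane} (hx : x ∉ P.boundary ℝ)
    (hfree : ¬ IsFree (P.boundary ℝ) x) : 3 ≤ (P.visible x).card := by
  by_contra! hlt
  have hcard : (P.visible x).card = 2 := by have := hP.two_le_card_visible hn hx; omega
  obtain ⟨i, j, hij, hvis⟩ := Finset.card_eq_two.1 hcard
  have hxi : P.vertices i - x ≠ 0 :=
    _root_.sub_ne_zero.2 fun h => hx (h ▸ vertex_mem_boundary i)
  set e := P.vertices i - x with he
  set f := P.vertices j - x with hf
  have hpos : ∀ u : Plane, dt u e < 0 → dt u f < 0 → ∀ p ∈ P.boundary ℝ, dt u (p - x) ≤ 0 := by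
    intro u h1 h2 p hp
    by_contra! h3
    obtain ⟨k, hk, hk'⟩ := hP.exists_sees_of_dt_pos hx hp h3
    have := mem_visible.2 hk
    rw [hvis, Finset.mem_insert, Finset.mem_singleton] at this
    rcases this with rfl | rfl
    · linarith
    · linarith
  have hno : ∀ u : Plane, ¬ (dt u e < 0 ∧ dt u f < 0) := by
    rintro u ⟨h1, h2⟩
    refine hfree ⟨u, fun p hp => lt_of_le_of_ne (hpos u h1 h2 p hp) fun h0 => ?_⟩
    have hpx : p - x ≠ 0 := _root_.sub_ne_zero.2 fun h => hx (h ▸ hp)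
    -- If the polygon met the bounding line in `p`, then tilting `u` towards `p` would give a
    -- half-plane that contains `p` but still neither of the two vertices.
    have hlim (a : Plane) (ha : dt u a < 0) : ∀ᶠ ε : ℝ in 𝓝[>] 0, dt (u + ε • (p - x)) a < 0 := by
      have hc : Continuous fun ε : ℝ => dt (u + ε • (p - x)) a := by
        simp only [dt, PiLp.add_apply, PiLp.smul_apply]; fun_prop
      exact (hc.continuousAt.eventually (Iio_mem_nhds (by simpa using ha))).filter_mono
        nhdsWithin_le_nhds
    obtain ⟨ε, h3, h4, h5⟩ := ((hlim e h1).and ((hlim f h2).and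
      (self_mem_nhdsWithin : Ioi (0 : ℝ) ∈ 𝓝[>] 0))).exists
    have h5 : 0 < ε := h5
    have h6 := hpos _ h3 h4 p hp
    have h7 : dt (u + ε • (p - x)) (p - x) = dt u (p - x) + ε * dt (p - x) (p - x) := by
      simp [dt]; ring
    rw [h7, h0] at h6
    have := mul_pos h5 (dt_self_pos hpx)
    linarith
  have hcr : cr e f = 0 := by
    by_contra hne
    refine hno ((cr e f) • (rot f - rot e)) ?_
    have h2 := mul_self_pos.2 hne
    constructor
    · have : dt ((cr e f) • (rot f - rot e)) e = -(cr e f * cr e f) := by simp [cr, dt]; ring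
      rw [this]; linarith
    · have : dt ((cr e f) • (rot f - rot e)) f = -(cr e f * cr e f) := by simp [cr, dt]; ring
      rw [this]; linarith
  obtain ⟨k, hk, hne⟩ := hP.exists_sees_dt_ne_zero hn hx (rot_ne_zero hxi)
  rw [hvis, Finset.mem_insert, Finset.mem_singleton] at hk
  rcases hk with rfl | rfl
  · apply hne
    change dt (rot e) e = 0
    simp [dt]; ring
  · apply hne
    change dt (rot e) f = 0
    rw [← hcr]; simp [dt, cr]; ring

end Visible

/-! ### The two sides of the polygon -/

section Sides

variable (hP : P.IsSimpleClosed) (hn : 3 ≤ n)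
include hP hn

theorem SeesFrom.wind_eq {σ : ℝ} (hσ : σ ≠ 0) {a b : Plane} {i j : Fin n} (ha : P.SeesFrom σ a i)
    (hb : P.SeesFrom σ b j) : P.wind a = P.wind b := by
  obtain ⟨d, rfl⟩ : ∃ d, j = (finRotate n)^[d] i := by
    refine ⟨n - i + j, Fin.ext ?_⟩
    rw [val_iterate_finRotate, show (i : ℕ) + (n - i + j) = n + j by omega]
    simp [Nat.mod_eq_of_lt j.2]
  have := (ha.linked hP hn hσ hb).induct (p := fun z => P.wind a = P.wind z)
    (fun x y h hx => hx.trans (wind_eq_of_segment h)) rfl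
  exact this

/-- Points close to an edge on the side `σ` see the first vertex of this edge on this side. -/
theorem eventually_seesFrom {σ : ℝ} (i : Fin n) {z ν : Plane} {τ : ℝ}
    (hτ0 : 0 < τ) (hτ1 : τ < 1) (hz : z = P.vertices (finRotate n i) + τ • P.outVec i)
    (hν : 0 < σ * cr (P.outVec i) ν) :
    ∀ᶠ ε : ℝ in 𝓝[>] 0, P.SeesFrom σ (z + ε • ν) i := by
  set v := P.vertices (finRotate n i) with hv
  have hline : Tendsto (fun ε : ℝ => z + ε • ν) (𝓝[>] 0) (𝓝 z) := by
    have : Continuous fun ε : ℝ => z + ε • ν := by fun_prop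
    simpa using (this.tendsto 0).mono_left nhdsWithin_le_nhds
  have hsec : ∀ᶠ ε : ℝ in 𝓝[>] 0, Sector σ (P.outVec i) (P.inVec i) (z + ε • ν - v) := by
    have h1 : ∀ ε : ℝ, 0 < ε → 0 < σ * cr (P.outVec i) (z + ε • ν - v) := fun ε hε => by
      have : σ * cr (P.outVec i) (z + ε • ν - v) = ε * (σ * cr (P.outVec i) ν) := by
        rw [hz]; generalize P.outVec i = E; simp [cr]; ring
      rw [this]
      exact mul_pos hε hν
    unfold Sector
    split_ifs with h0
    · have hc : Continuous fun q : Plane => σ * cr (q - v) (P.inVec i) := by unfold cr; fun_prop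
      have h2 : 0 < σ * cr (z - v) (P.inVec i) := by
        have : σ * cr (z - v) (P.inVec i) = τ * (σ * cr (P.outVec i) (P.inVec i)) := by
          rw [hz]; generalize P.outVec i = E; simp [cr]; ring
        rw [this]
        exact mul_pos hτ0 h0
      filter_upwards [self_mem_nhdsWithin, ((hc.tendsto _).comp hline).eventually
        (Ioi_mem_nhds h2)] with ε hε h3
      exact ⟨h1 ε hε, h3⟩
    · filter_upwards [self_mem_nhdsWithin] with ε hε
      exact .inl (h1 ε hε)
  have hzmem : z ∈ P.edgeSet ℝ (finRotate n i) := mem_edgeSet_iff.2 ⟨τ, ⟨hτ0.le, hτ1.le⟩, hz⟩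
  have hothers : ∀ᶠ ε : ℝ in 𝓝[>] 0, ∀ j, j ≠ i → j ≠ finRotate n i →
      Disjoint (segment ℝ (z + ε • ν) v) (P.edgeSet ℝ j) := by
    rw [eventually_all]; intro j
    by_cases hj : j ≠ i ∧ j ≠ finRotate n i
    · filter_upwards [eventually_disjoint_segment (isCompact_edgeSet j).isClosed hline
        (tendsto_const_nhds (x := v)) (by
          rw [Set.disjoint_left]
          intro q hq hqj
          obtain ⟨t, ht0, ht1, rfl⟩ := mem_segment_iff_add_smul.1 hq
          have hrep : z + t • (v - z) = v + ((1 - t) * τ) • P.outVec i := by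
            rw [hz]; module
          have hq' : z + t • (v - z) ∈ P.edgeSet ℝ (finRotate n i) :=
            mem_edgeSet_iff.2 ⟨(1 - t) * τ, ⟨mul_nonneg (by linarith) hτ0.le, by nlinarith⟩, hrep⟩
          rcases hP.eq_of_mem_of_mem hj.2 hqj hq' with ⟨h1, h2⟩ | ⟨h1, h2⟩
          · exact hj.1 ((finRotate n).injective h1).symm
          · rw [hrep, h1] at h2
            have h3 : (1 - (1 - t) * τ) • P.outVec i = 0 := by
              rw [sub_smul, one_smul, sub_eq_zero]
              exact (eq_sub_of_add_eq' h2).symm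
            rw [smul_eq_zero] at h3
            rcases h3 with h3 | h3
            · nlinarith
            · exact hP.sub_ne_zero hn (finRotate n i) h3)] with ε h _ _
      exact h
    · exact Eventually.of_forall fun ε h1 h2 => (hj ⟨h1, h2⟩).elim
  filter_upwards [hsec, hothers] with ε h1 h2
  have hmem : ∀ q ∈ segment ℝ (z + ε • ν) v, q ∈ P.boundary ℝ → q = v := by
    intro q hq hqB
    obtain ⟨j, hj⟩ := mem_boundary_iff.1 hqB
    obtain ⟨t, ht0, ht1, rfl⟩ := mem_segment_iff_add_smul.1 hq
    by_contra hne
    have ht1' : t < 1 := by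
      rcases ht1.eq_or_lt with h | h
      · subst h; simp at hne
      · exact h
    have hs : Sector σ (P.outVec i) (P.inVec i) (z + ε • ν + t • (v - (z + ε • ν)) - v) := by
      have h3 : z + ε • ν + t • (v - (z + ε • ν)) - v = (1 - t) • (z + ε • ν - v) := by module
      rw [h3]
      have h4 : σ * cr (P.outVec i) ((1 - t) • (z + ε • ν - v)) =
          (1 - t) * (σ * cr (P.outVec i) (z + ε • ν - v)) := by simp [cr]; ring
      have h5 : σ * cr ((1 - t) • (z + ε • ν - v)) (P.inVec i) =
          (1 - t) * (σ * cr (z + ε • ν - v) (P.inVec i)) := by simp [cr]; ring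
      have h6 : 0 < 1 - t := by linarith
      unfold Sector at h1 ⊢
      rw [h4, h5]
      simpa only [mul_pos_iff_of_pos_left h6] using h1
    have := notMem_edgeSet_of_sector hs
    by_cases hji : j = i
    · exact this.1 (hji ▸ hj)
    · by_cases hjs : j = finRotate n i
      · exact this.2 (hjs ▸ hj)
      · exact (h2 j hji hjs).le_bot ⟨hq, hj⟩
  refine ⟨⟨fun hB => ?_, hmem⟩, h1⟩
  have h3 := hmem _ (left_mem_segment ..) hB
  exact h1.ne_smul_left le_rfl (by rw [h3]; simp)

theorem notMem_edgeSet_of_inner {i j : Fin n} {z : Plane} {τ : ℝ} (hτ0 : 0 < τ) (hτ1 : τ < 1)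
    (hz : z = P.vertices i + τ • (P.vertices (finRotate n i) - P.vertices i)) (hji : j ≠ i) :
    z ∉ P.edgeSet ℝ j := by
  intro hzj
  have hzi : z ∈ P.edgeSet ℝ i := mem_edgeSet_iff.2 ⟨τ, ⟨hτ0.le, hτ1.le⟩, hz⟩
  have hE := hP.sub_ne_zero hn i
  rcases hP.eq_of_mem_of_mem hji hzj hzi with ⟨-, h⟩ | ⟨h1, h2⟩
  · rw [hz, add_eq_left, smul_eq_zero] at h
    exact h.elim hτ0.ne' hE
  · rw [hz, h1, ← sub_eq_zero] at h2
    have h3 : (1 - τ) • (P.vertices (finRotate n i) - P.vertices i) = 0 := by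
      rw [← neg_eq_zero, ← h2]; module
    rw [smul_eq_zero] at h3
    exact h3.elim (by intro h; linarith) hE

/-- The total angle depends only on the side from which a vertex is seen, so it is enough to compare
two points on either side of the midpoint of one edge. -/
theorem SeesFrom.wind_ne {a b : Plane} {i j : Fin n} (ha : P.SeesFrom 1 a i)
    (hb : P.SeesFrom (-1) b j) : P.wind a ≠ P.wind b := by
  set E := P.outVec i with hE
  have hE0 : E ≠ 0 := hP.sub_ne_zero hn (finRotate n i)
  have hν : 0 < cr E (rot E) := by
    have : cr E (rot E) = dt E E := by simp [cr, dt]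
    rw [this]; exact dt_self_pos hE0
  have h1 := eventually_seesFrom hP hn (σ := 1) i (z := P.vertices (finRotate n i) + (1 / 2 : ℝ) • E)
    (ν := rot E) (by norm_num) (by norm_num) rfl (by rw [one_mul]; exact hν)
  have h2 := eventually_seesFrom hP hn (σ := -1) i
    (z := P.vertices (finRotate n i) + (1 / 2 : ℝ) • E)
    (ν := -rot E) (by norm_num) (by norm_num) rfl (by
      have : -1 * cr E (-rot E) = cr E (rot E) := by simp [cr]; ring
      rw [this]; exact hν)
  have h3 := eventually_wind_lt (P := P) (i := finRotate n i)
    (z := P.vertices (finRotate n i) + (1 / 2 : ℝ) • E) (ν := rot E) (τ := 1 / 2)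
    (by norm_num) (by norm_num) rfl hν
    fun j hj => notMem_edgeSet_of_inner hP hn (by norm_num) (by norm_num) rfl hj
  obtain ⟨ε, h1, h2, h3⟩ := (h1.and (h2.and h3)).exists
  rw [ha.wind_eq hP hn one_ne_zero h1, hb.wind_eq hP hn (by norm_num) h2, smul_neg,
    ← sub_eq_add_neg]
  exact h3.ne'

theorem exists_seesFrom {x : Plane} {i : Fin n} (h : i ∈ P.visible x) :
    ∃ j, i = finRotate n j ∧ (P.SeesFrom 1 x j ∨ P.SeesFrom (-1) x j) := by
  obtain ⟨j, rfl⟩ := (finRotate n).surjective i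
  exact ⟨j, rfl, Sees.exists_seesFrom hP hn (mem_visible.1 h)⟩

theorem exists_seesFrom_of_notMem {x : Plane} (hx : x ∉ P.boundary ℝ) :
    ∃ j, P.SeesFrom 1 x j ∨ P.SeesFrom (-1) x j := by
  have := hP.two_le_card_visible hn hx
  obtain ⟨i, hi⟩ := Finset.card_pos.1 (by omega : 0 < (P.visible x).card)
  obtain ⟨j, -, hj⟩ := exists_seesFrom hP hn hi
  exact ⟨j, hj⟩

/-- Points off the polygon at which the total angle is the same are joined by a path. -/
theorem exists_linked_of_wind_eq {a b : Plane} (ha : a ∉ P.boundary ℝ) (hb : b ∉ P.boundary ℝ)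
    (h : P.wind a = P.wind b) : ∃ k, Linked (P.boundary ℝ)ᶜ k a b := by
  obtain ⟨i, hi⟩ := exists_seesFrom_of_notMem hP hn ha
  obtain ⟨j, hj⟩ := exists_seesFrom_of_notMem hP hn hb
  obtain ⟨d, rfl⟩ : ∃ d, j = (finRotate n)^[d] i := by
    refine ⟨n - i + j, Fin.ext ?_⟩
    rw [val_iterate_finRotate, show (i : ℕ) + (n - i + j) = n + j by omega]
    simp [Nat.mod_eq_of_lt j.2]
  rcases hi with hi | hi <;> rcases hj with hj | hj
  · exact ⟨_, hi.linked hP hn one_ne_zero hj⟩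
  · exact (hi.wind_ne hP hn hj h).elim
  · exact (hj.wind_ne hP hn hi h.symm).elim
  · exact ⟨_, hi.linked hP hn (by norm_num) hj⟩

/-- A point at which the total angle vanishes is joined by a path to a free point. In particular the
exterior is connected. -/
theorem mem_ext_iff {x : Plane} (hx : x ∉ P.boundary ℝ) : x ∈ P.ext ↔ P.wind x = 0 := by
  refine ⟨wind_eq_zero_of_mem_ext, fun h => ?_⟩
  obtain ⟨y, hy⟩ := exists_isFree (P := P)
  have hye := hy.mem_ext (by omega : 0 < n)
  obtain ⟨k, hk⟩ := exists_linked_of_wind_eq hP hn hye.1 hx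
    ((wind_eq_zero_of_mem_ext hye).trans h.symm)
  exact hk.induct (p := (· ∈ P.ext))
    (fun a b hab ha => segment_subset_ext hab ha (right_mem_segment ..)) hye

/-- Points of the interior see all vertices from one side, and points of the exterior do. -/
theorem SeesFrom.same_side {a b : Plane} {i j : Fin n} (ha : P.SeesFrom 1 a i)
    (hb : P.SeesFrom (-1) b j) : ¬ (a ∈ P.ext ↔ b ∈ P.ext) := by
  have hne := ha.wind_ne hP hn hb
  obtain ⟨y, hy⟩ := exists_isFree (P := P)
  have hye := hy.mem_ext (by omega : 0 < n)
  have hy0 := wind_eq_zero_of_mem_ext hye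
  -- The free point sees the polygon from one of the sides. The total angle vanishes for this side,
  -- hence not for the other.
  obtain ⟨k, hk⟩ := exists_seesFrom_of_notMem hP hn hye.1
  rw [mem_ext_iff hP hn ha.1.1, mem_ext_iff hP hn hb.1.1]
  rcases hk with hk | hk
  · have := ha.wind_eq hP hn one_ne_zero hk
    rw [hy0] at this
    exact fun h => hne (this.trans (h.1 this).symm)
  · have := hb.wind_eq hP hn (by norm_num) hk
    rw [hy0] at this
    exact fun h => hne ((h.2 this).trans this.symm)

theorem linked_of_sees {a b : Plane} {i : Fin n} {d : ℕ} (hab : a ∈ P.ext ↔ b ∈ P.ext)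
    (ha : i ∈ P.visible a) (hb : (finRotate n)^[d] i ∈ P.visible b) :
    Linked (P.boundary ℝ)ᶜ (d + 2) a b := by
  obtain ⟨i, rfl, hi⟩ := exists_seesFrom hP hn ha
  -- `SeesFrom` is indexed by the predecessor of the visible vertex, hence the shift by one.
  rw [← Function.iterate_succ_apply, Function.iterate_succ_apply'] at hb
  obtain ⟨j, hj', hj⟩ := exists_seesFrom hP hn hb
  obtain rfl := (finRotate n).injective hj'
  rcases hi with hi | hi <;> rcases hj with hj | hj
  · exact hi.linked hP hn one_ne_zero hj
  · exact (hi.same_side hP hn hj hab).elim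
  · exact (hj.same_side hP hn hi hab.symm).elim
  · exact hi.linked hP hn (by norm_num) hj

/-- Of two points that are opposite to each other and close to an inner point of an edge, one is in the
interior and the other in the exterior. -/
theorem eventually_mem_int_ext (i : Fin n) {z ν : Plane} {τ : ℝ} (hτ0 : 0 < τ) (hτ1 : τ < 1)
    (hz : z = P.vertices i + τ • (P.vertices (finRotate n i) - P.vertices i))
    (hν : cr (P.vertices (finRotate n i) - P.vertices i) ν ≠ 0) :
    ∀ᶠ ε : ℝ in 𝓝[>] 0, (z + ε • ν ∈ P.int ∧ z - ε • ν ∈ P.ext) ∨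
      (z + ε • ν ∈ P.ext ∧ z - ε • ν ∈ P.int) := by
  have key : ∀ μ : Plane, 0 < cr (P.vertices (finRotate n i) - P.vertices i) μ →
      ∀ᶠ ε : ℝ in 𝓝[>] 0, (z + ε • μ ∈ P.int ∧ z - ε • μ ∈ P.ext) ∨
      (z + ε • μ ∈ P.ext ∧ z - ε • μ ∈ P.int) := by
    intro μ hμ
    obtain ⟨k, rfl⟩ := (finRotate n).surjective i
    have h1 := eventually_seesFrom hP hn (σ := 1) k (ν := μ) hτ0 hτ1 hz (by rw [one_mul]; exact hμ)
    have h2 := eventually_seesFrom hP hn (σ := -1) k (ν := -μ) hτ0 hτ1 hz (by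
      have : -1 * cr (P.outVec k) (-μ) = cr (P.outVec k) μ := by simp [cr]; ring
      rw [this]; exact hμ)
    filter_upwards [h1, h2] with ε h1 h2
    rw [smul_neg, ← sub_eq_add_neg] at h2
    have := h1.same_side hP hn h2
    have h3 := mem_int_or_mem_ext h1.1.1
    have h4 := mem_int_or_mem_ext h2.1.1
    tauto
  rcases hν.lt_or_gt with h | h
  · filter_upwards [key (-ν) (by simp [cr] at h ⊢; linarith)] with ε hε
    simp only [smul_neg, ← sub_eq_add_neg, sub_neg_eq_add] at hε
    tauto
  · exact key ν h

end Sides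

end Polygon

/-! ### Counting on a cycle -/

section Cyclic

variable {n : ℕ}

theorem exists_iterate_finRotate_eq (i j : Fin n) : ∃ d, (finRotate n)^[d] i = j := by
  refine ⟨n - i + j, Fin.ext ?_⟩
  rw [val_iterate_finRotate, show (i : ℕ) + (n - i + j) = n + j by omega]
  simp [Nat.mod_eq_of_lt j.2]

/-- The elements that are reached from `A` in at most `t` steps around the cycle. -/
def cyclicGrowth (A : Finset (Fin n)) : ℕ → Finset (Fin n)
  | 0 => A
  | t + 1 => cyclicGrowth A t ∪ (cyclicGrowth A t).map (finRotate n).toEmbedding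

theorem exists_of_mem_cyclicGrowth {A : Finset (Fin n)} {t : ℕ} {j : Fin n}
    (h : j ∈ cyclicGrowth A t) : ∃ d ≤ t, ∃ i ∈ A, (finRotate n)^[d] i = j := by
  induction t generalizing j with
  | zero => exact ⟨0, le_rfl, j, h, rfl⟩
  | succ t ih =>
    rcases Finset.mem_union.1 h with h | h
    · obtain ⟨d, hd, i, hi, rfl⟩ := ih h
      exact ⟨d, by omega, i, hi, rfl⟩
    · obtain ⟨k, hk, rfl⟩ := Finset.mem_map.1 h
      obtain ⟨d, hd, i, hi, rfl⟩ := ih hk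
      exact ⟨d + 1, by omega, i, hi, Function.iterate_succ_apply' ..⟩

theorem subset_cyclicGrowth (A : Finset (Fin n)) (t : ℕ) : A ⊆ cyclicGrowth A t := by
  induction t with
  | zero => exact subset_rfl
  | succ t ih => exact ih.trans Finset.subset_union_left

/-- A nonempty set that is closed under the rotation is the whole cycle, so each step adds an
element until the cycle is full. -/
theorem le_card_cyclicGrowth {A : Finset (Fin n)} (hA : A.Nonempty) (t : ℕ) :
    min n (A.card + t) ≤ (cyclicGrowth A t).card := by
  induction t with
  | zero => exact min_le_right _ _
  | succ t ih =>
    set X := cyclicGrowth A t with hX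
    by_cases hc : ∀ i ∈ X, finRotate n i ∈ X
    · obtain ⟨i, hi⟩ := hA
      have hall : ∀ d, (finRotate n)^[d] i ∈ X := by
        intro d
        induction d with
        | zero => exact subset_cyclicGrowth A t hi
        | succ d ihd => rw [Function.iterate_succ_apply']; exact hc _ ihd
      have huniv : X = Finset.univ := Finset.eq_univ_iff_forall.2 fun j => by
        obtain ⟨d, rfl⟩ := exists_iterate_finRotate_eq i j
        exact hall d
      have hcard : X.card = n := by rw [huniv, Finset.card_univ, Fintype.card_fin]
      refine (min_le_left _ _).trans (hcard.symm.le.trans (Finset.card_le_card ?_))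
      exact Finset.subset_union_left
    · push Not at hc
      obtain ⟨i, hi, hi'⟩ := hc
      have hss : X ⊂ cyclicGrowth A (t + 1) := by
        refine Finset.ssubset_iff_subset_ne.2 ⟨Finset.subset_union_left, fun h => hi' ?_⟩
        rw [h]
        exact Finset.mem_union_right _ (Finset.mem_map_of_mem _ hi)
      have := Finset.card_lt_card hss
      omega

/-- Two large subsets of a cycle contain elements that are close to each other. -/
theorem exists_close {A B : Finset (Fin n)} (hA : A.Nonempty) (hB : B.Nonempty) {t : ℕ}
    (h : n < 2 * t + A.card + B.card) :
    ∃ d ≤ t, (∃ i ∈ A, (finRotate n)^[d] i ∈ B) ∨ (∃ i ∈ B, (finRotate n)^[d] i ∈ A) := by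
  by_contra! hcon
  -- Both sets grow in the same direction. If `a` and `b` reach a common element in `d` and `e`
  -- steps, one of them reaches the other in `|d - e| ≤ t` steps.
  have hdisj : Disjoint (cyclicGrowth A t) (cyclicGrowth B t) := by
    rw [Finset.disjoint_left]
    intro j hjA hjB
    obtain ⟨d, hd, a, ha, had⟩ := exists_of_mem_cyclicGrowth hjA
    obtain ⟨e, he, b, hb, hbe⟩ := exists_of_mem_cyclicGrowth hjB
    have hinj := (finRotate n).injective
    rcases le_total d e with hde | hde
    · have : (finRotate n)^[e - d] b = a := by
        apply hinj.iterate d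
        rw [← Function.iterate_add_apply, had, ← hbe]
        congr 2; omega
      exact (hcon (e - d) (by omega)).2 b hb (this ▸ ha)
    · have : (finRotate n)^[d - e] a = b := by
        apply hinj.iterate e
        rw [← Function.iterate_add_apply, hbe, ← had]
        congr 2; omega
      exact (hcon (d - e) (by omega)).1 a ha (this ▸ hb)
  have h1 := le_card_cyclicGrowth hA t
  have h2 := le_card_cyclicGrowth hB t
  have h3 := Finset.card_union_of_disjoint hdisj
  have h4 := Finset.card_le_univ (cyclicGrowth A t ∪ cyclicGrowth B t)
  rw [Fintype.card_fin] at h4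
  have h5 := hA.card_pos
  have h6 := hB.card_pos
  have h7 : A.card ≤ n := by simpa using Finset.card_le_univ A
  omega

end Cyclic

/-! ### Convexity of the interior of a triangle -/

section Triangle

theorem cr_sub_eq_zero_of_mem_segment {u v z : Plane} (hz : z ∈ segment ℝ u v) :
    cr (v - u) (z - u) = 0 := by
  obtain ⟨t, -, -, rfl⟩ := mem_segment_iff_add_smul.1 hz
  simp [cr]; ring

theorem cr_sub_of_mem_segment {a b v w z : Plane} (hz : z ∈ segment ℝ a b) :
    ∃ s t : ℝ, 0 ≤ s ∧ 0 ≤ t ∧ s + t = 1 ∧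
      cr v (z - w) = s * cr v (a - w) + t * cr v (b - w) := by
  obtain ⟨s, t, hs, ht, hst, rfl⟩ := hz
  refine ⟨s, t, hs, ht, hst, ?_⟩
  have : s = 1 - t := by linarith
  subst this
  simp [cr]; ring

/-- A point strictly beyond the line `uv`, seen from `w`, is separated from the triangle by a
parallel to this line. -/
theorem triangle_cr_nonneg {u v w a : Plane} {B : Set Plane}
    (hB : B ⊆ segment ℝ u v ∪ segment ℝ v w ∪ segment ℝ w u) (hD : cr (v - u) (w - u) ≠ 0)
    (hfree : ¬ IsFree B a) : 0 ≤ cr (v - u) (w - u) * cr (v - u) (a - u) := by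
  by_contra! hneg
  set D := cr (v - u) (w - u) with hDdef
  have hDD : 0 < D * D := mul_self_pos.2 hD
  have h0 : cr (v - u) (u - u) = 0 := by simp [cr]
  have h1 : cr (v - u) (v - u) = 0 := by simp [cr]; ring
  have hpos : ∀ p ∈ B, 0 ≤ D * cr (v - u) (p - u) := by
    intro p hp
    rcases hB hp with (hp | hp) | hp <;>
      obtain ⟨s, t, hs, ht, -, h⟩ := cr_sub_of_mem_segment (v := v - u) (w := u) hp
    · rw [h, h0, h1]; simp
    · rw [h, h1, ← hDdef]; nlinarith [mul_nonneg ht hDD.le]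
    · rw [h, h0, ← hDdef]; nlinarith [mul_nonneg hs hDD.le]
  refine hfree ⟨-(D • rot (v - u)), fun p hp => ?_⟩
  have : dt (-(D • rot (v - u))) (p - a) =
      D * cr (v - u) (a - u) - D * cr (v - u) (p - u) := by simp [dt, cr]; ring
  rw [this]
  linarith [hpos p hp]

/-- The three determinants are barycentric coordinates up to the factor `D`. If one vanishes and the
others have the sign of `D`, the point is on an edge. -/
theorem triangle_cr_pos {u v w a : Plane} {B : Set Plane}
    (hB : B = segment ℝ u v ∪ segment ℝ v w ∪ segment ℝ w u) (hD : cr (v - u) (w - u) ≠ 0)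
    (hfree : ¬ IsFree B a) (ha : a ∉ B) : 0 < cr (v - u) (w - u) * cr (v - u) (a - u) := by
  have e1 : cr (w - v) (u - v) = cr (v - u) (w - u) := by simp [cr]; ring
  have e2 : cr (u - w) (v - w) = cr (v - u) (w - u) := by simp [cr]; ring
  have h1 := triangle_cr_nonneg hB.subset hD hfree
  have h2 := triangle_cr_nonneg (u := v) (v := w) (w := u) (hB.subset.trans (by
    rintro z ((hz | hz) | hz)
    exacts [.inr hz, .inl (.inl hz), .inl (.inr hz)])) (e1 ▸ hD) hfree
  have h3 := triangle_cr_nonneg (u := w) (v := u) (w := v) (hB.subset.trans (by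
    rintro z ((hz | hz) | hz)
    exacts [.inl (.inr hz), .inr hz, .inl (.inl hz)])) (e2 ▸ hD) hfree
  rw [e1] at h2
  rw [e2] at h3
  set D := cr (v - u) (w - u) with hDdef
  have hDD : 0 < D * D := mul_self_pos.2 hD
  have hsum : cr (v - u) (a - u) + cr (w - v) (a - v) + cr (u - w) (a - w) = D := by
    simp [cr, hDdef]; ring
  refine lt_of_le_of_ne h1 fun h0 => ha ?_
  have h0' : cr (v - u) (a - u) = 0 := (mul_eq_zero.1 h0.symm).resolve_left hD
  rw [hB]
  refine .inl (.inl (mem_segment_iff_add_smul.2 ⟨D * cr (u - w) (a - w) / (D * D),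
    by positivity, ?_, ?_⟩))
  · rw [div_le_one hDD]
    have : D * (cr (v - u) (a - u) + cr (w - v) (a - v) + cr (u - w) (a - w)) = D * D := by rw [hsum]
    rw [h0'] at this
    linarith
  · have := eq_smul_add_smul hD (a - u)
    rw [h0', zero_div, zero_smul, add_zero] at this
    rw [mul_div_mul_left _ _ hD, ← sub_eq_iff_eq_add', this]
    congr 2
    simp [cr] at h0' ⊢
    linarith

theorem triangle_segment_subset {u v w a b : Plane} {B : Set Plane}
    (hB : B = segment ℝ u v ∪ segment ℝ v w ∪ segment ℝ w u) (hD : cr (v - u) (w - u) ≠ 0)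
    (ha : ¬ IsFree B a) (haB : a ∉ B) (hb : ¬ IsFree B b) (hbB : b ∉ B) :
    segment ℝ a b ⊆ Bᶜ := by
  have e1 : cr (w - v) (u - v) = cr (v - u) (w - u) := by simp [cr]; ring
  have e2 : cr (u - w) (v - w) = cr (v - u) (w - u) := by simp [cr]; ring
  have key : ∀ x y q : Plane, cr (y - x) (q - x) = cr (v - u) (w - u) →
      B = segment ℝ x y ∪ segment ℝ y q ∪ segment ℝ q x → ∀ z ∈ segment ℝ a b,
      z ∉ segment ℝ x y := by
    intro x y q hq hB' z hz hzx
    have h1 := triangle_cr_pos hB' (hq ▸ hD) ha haB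
    have h2 := triangle_cr_pos hB' (hq ▸ hD) hb hbB
    obtain ⟨s, t, hs, ht, hst, h⟩ := cr_sub_of_mem_segment (v := y - x) (w := x) hz
    rw [cr_sub_eq_zero_of_mem_segment hzx] at h
    have h3 : s * (cr (y - x) (q - x) * cr (y - x) (a - x)) +
        t * (cr (y - x) (q - x) * cr (y - x) (b - x)) = 0 := by
      linear_combination -cr (y - x) (q - x) * h
    rcases hs.eq_or_lt with h4 | h4
    · have ht1 : t = 1 := by linarith
      rw [← h4, ht1] at h3
      linarith
    · nlinarith [mul_pos h4 h1, mul_nonneg ht h2.le]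
  intro z hz hzB
  have hB1 := hzB
  rw [hB] at hB1
  rcases hB1 with (h | h) | h
  · exact key u v w rfl hB z hz h
  · exact key v w u e1 (by rw [hB, union_assoc, union_comm]) z hz h
  · exact key w u v e2 (by rw [hB, union_comm, union_assoc]) z hz h

end Triangle

/-! ### The upper bounds -/

namespace Polygon

theorem boundary_three (P : Polygon Plane 3) : P.boundary ℝ =
    segment ℝ (P.vertices 0) (P.vertices 1) ∪ segment ℝ (P.vertices 1) (P.vertices 2) ∪
      segment ℝ (P.vertices 2) (P.vertices 0) := by
  ext z
  rw [mem_boundary_iff, Fin.exists_fin_succ, Fin.exists_fin_two]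
  simp only [edgeSet_eq_segment, mem_union, or_assoc]
  rfl

theorem IsSimpleClosed.cr_ne_zero {P : Polygon Plane 3} (hP : P.IsSimpleClosed) :
    cr (P.vertices 1 - P.vertices 0) (P.vertices 2 - P.vertices 0) ≠ 0 := by
  intro h
  have h01 : P.vertices 1 - P.vertices 0 ≠ 0 :=
    _root_.sub_ne_zero.2 fun h => by simpa using hP.vertices_injective h
  obtain ⟨p, hp, hne⟩ := hP.not_collinear le_rfl (rot_ne_zero h01) (P.vertices 0)
  apply hne
  have hrot : ∀ q : Plane, dt (rot (P.vertices 1 - P.vertices 0)) q =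
      cr (P.vertices 1 - P.vertices 0) q := fun q => by simp [dt, cr]; ring
  rw [hrot]
  have h0 : cr (P.vertices 1 - P.vertices 0) (P.vertices 0 - P.vertices 0) = 0 := by simp [cr]
  have h1 : cr (P.vertices 1 - P.vertices 0) (P.vertices 1 - P.vertices 0) = 0 := by
    simp [cr]; ring
  rw [boundary_three] at hp
  rcases hp with (hp | hp) | hp <;>
    obtain ⟨s, t, -, -, -, h'⟩ :=
      cr_sub_of_mem_segment (v := P.vertices 1 - P.vertices 0) (w := P.vertices 0) hp <;>
    (rw [h']; simp only [h, h0, h1]; simp)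

variable {n : ℕ} {P : Polygon Plane n} (hP : P.IsSimpleClosed) (hn : 3 ≤ n)
include hP hn

theorem exists_linked_of_card {a b : Plane} (hab : a ∈ P.ext ↔ b ∈ P.ext)
    (ha : a ∉ P.boundary ℝ) (hb : b ∉ P.boundary ℝ) {t : ℕ}
    (h : n < 2 * t + (P.visible a).card + (P.visible b).card) :
    Linked (P.boundary ℝ)ᶜ (t + 2) a b := by
  have h1 := hP.two_le_card_visible hn ha
  have h2 := hP.two_le_card_visible hn hb
  obtain ⟨d, hd, hij⟩ := exists_close (Finset.card_pos.1 (by omega : 0 < (P.visible a).card))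
    (Finset.card_pos.1 (by omega : 0 < (P.visible b).card)) h
  rcases hij with ⟨i, hi, hj⟩ | ⟨i, hi, hj⟩
  · exact (linked_of_sees hP hn hab hi hj).mono hb (by omega)
  · exact (linked_of_sees hP hn hab.symm hi hj).symm.mono hb (by omega)

theorem linked_int {a b : Plane} (ha : a ∈ P.int) (hb : b ∈ P.int) : Linked P.int (n / 2) a b := by
  refine Linked.restrict (fun x y h hx => segment_subset_int h hx) ?_ ha
  have hfa := not_isFree_of_mem_int (by omega) ha
  have hfb := not_isFree_of_mem_int (by omega) hb
  -- Paths along the polygon have at least two edges, so n = 3, where a single edge is required, is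
  -- treated by convexity.
  rcases hn.eq_or_lt with rfl | h4
  · exact Linked.single (triangle_segment_subset (boundary_three P) hP.cr_ne_zero hfa ha.1 hfb hb.1)
  · have h1 := hP.three_le_card_visible hn ha.1 hfa
    have h2 := hP.three_le_card_visible hn hb.1 hfb
    -- Three visible vertices on each end suffice, since 2(⌊n/2⌋ - 2) + 6 > n.
    have h3 := exists_linked_of_card hP hn (t := n / 2 - 2) (a := a) (b := b)
      (iff_of_false (notMem_ext_of_mem_int ha) (notMem_ext_of_mem_int hb)) ha.1 hb.1 (by omega)
    rwa [show n / 2 - 2 + 2 = n / 2 by omega] at h3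

theorem linked_ext {a b : Plane} (ha : a ∈ P.ext) (hb : b ∈ P.ext) :
    Linked P.ext ((n + 1) / 2) a b := by
  refine Linked.restrict (fun x y h hx => segment_subset_ext h hx) ?_ ha
  by_cases hfree : IsFree (P.boundary ℝ) a ∧ IsFree (P.boundary ℝ) b
  · exact (hfree.1.linked_two isCompact_boundary hfree.2).mono hb.1 (by omega)
  -- A point that is not free sees three vertices, and 2(⌈n/2⌉ - 2) + 5 > n.
  · have h5 : 5 ≤ (P.visible a).card + (P.visible b).card := by
      have h1 := hP.two_le_card_visible hn ha.1
      have h2 := hP.two_le_card_visible hn hb.1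
      by_cases hfa : IsFree (P.boundary ℝ) a
      · have := hP.three_le_card_visible hn hb.1 fun hfb => hfree ⟨hfa, hfb⟩
        omega
      · have := hP.three_le_card_visible hn ha.1 hfa
        omega
    have h3 := exists_linked_of_card hP hn (t := (n + 1) / 2 - 2) (a := a) (b := b)
      (iff_of_true ha hb) ha.1 hb.1 (by omega)
    rwa [show (n + 1) / 2 - 2 + 2 = (n + 1) / 2 by omega] at h3

theorem poldiam_int_le : poldiam P.int ≤ (n / 2 : ℕ) :=
  poldiam_le fun _ ha _ hb => linked_int hP hn ha hb

theorem poldiam_ext_le : poldiam P.ext ≤ ((n + 1) / 2 : ℕ) :=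
  poldiam_le fun _ ha _ hb => linked_ext hP hn ha hb

end Polygon

theorem floor_half (n : ℕ) : ⌊(n : ℝ) / 2⌋₊ = n / 2 := by
  have := Nat.floor_div_natCast (n : ℝ) 2
  simpa using this

theorem ceil_half (n : ℕ) : ⌈(n : ℝ) / 2⌉₊ = (n + 1) / 2 := by
  have h : (n + 1) / 2 ≠ 0 ∨ n = 0 := by omega
  rcases h with h | rfl
  · rw [Nat.ceil_eq_iff h]
    have h1 : 2 * ((n + 1) / 2 - 1) < n := by omega
    have h2 : n ≤ 2 * ((n + 1) / 2) := by omega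
    have h1' : (2 : ℝ) * (((n + 1) / 2 - 1 : ℕ) : ℝ) < n := by exact_mod_cast h1
    have h2' : (n : ℝ) ≤ 2 * (((n + 1) / 2 : ℕ) : ℝ) := by exact_mod_cast h2
    constructor <;> linarith
  · simp

/-! ### The lines carrying the edges of the extremal polygons -/

namespace Spiral

/-- The abscissas of the crossings with the axis are `± intercept s`. -/
def intercept (s : ℕ) : ℝ := 4 ^ s - 1

/-- The slopes (with respect to the axis) of the lines crossing the axis on the left. -/
noncomputable def leftSlope (N s : ℕ) : ℝ :=
  if s < N then s else if s = N then N + 2 / 3 else N + 1 / 3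

/-- Abscissa at height `y` of the `s`-th line crossing the axis on the left. -/
noncomputable def left (N s : ℕ) (y : ℝ) : ℝ := -intercept s + leftSlope N s * y

/-- Abscissa at height `y` of the `s`-th line crossing the axis on the right. -/
def right (s : ℕ) (y : ℝ) : ℝ := intercept s + s * y

/-- The height of the apex of the `s`-th upper arch. -/
noncomputable def apex (N s : ℕ) : ℝ :=
  if s + 1 < N then intercept s + intercept (s + 1)
  else if s + 1 = N then 3 / 5 * (intercept s + intercept (s + 1))
  else 3 * (intercept s + intercept (s + 1))

/-- The depth of the lowest point of the `s`-th lower arch. -/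
noncomputable def depth (N s : ℕ) : ℝ :=
  if s < N then intercept s + intercept (s + 1) else 3 * (intercept (s + 1) - intercept s)

theorem intercept_zero : intercept 0 = 0 := by simp [intercept]

theorem intercept_succ (s : ℕ) : intercept (s + 1) = 4 * intercept s + 3 := by
  simp only [intercept, pow_succ]; ring

theorem intercept_nonneg (s : ℕ) : 0 ≤ intercept s := by
  induction s with
  | zero => simp [intercept_zero]
  | succ s ih => rw [intercept_succ]; linarith

theorem intercept_strictMono : StrictMono intercept :=
  strictMono_nat_of_lt_succ fun s => by
    rw [intercept_succ]; linarith [intercept_nonneg s]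

variable {N : ℕ}

theorem left_zero_right (s : ℕ) : left N s 0 = -intercept s := by simp [left]

theorem right_zero_right (s : ℕ) : right s 0 = intercept s := by simp [right]

theorem right_zero_left (y : ℝ) : right 0 y = 0 := by simp [right, intercept_zero]

theorem left_zero_left (hN : 1 ≤ N) (y : ℝ) : left N 0 y = 0 := by
  simp [left, leftSlope, intercept_zero, show 0 < N from hN]

theorem apex_pos (s : ℕ) : 0 < apex N s := by
  have := intercept_nonneg s
  unfold apex
  rw [intercept_succ]
  split_ifs <;> linarith

theorem depth_pos (s : ℕ) : 0 < depth N s := by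
  have := intercept_nonneg s
  unfold depth
  rw [intercept_succ]
  split_ifs <;> linarith

/-- The legs of an upper arch have to converge upwards, so `left N (s + 1)` needs a larger slope
than `right s`. The legs of the tip have to converge downwards, so `left N N` needs a larger slope
than `left N (N + 1)`. The slopes N + 2/3 > N + 1/3 > N meet both demands. -/
theorem right_sub_left {s : ℕ} (hs : s ≤ N) (hN : 1 ≤ N) : ∃ κ : ℝ, 0 < κ ∧ κ ≤ 5 / 3 ∧
    (s < N → 1 ≤ κ) ∧ (s = N → κ = 1 / 3) ∧
    ∀ y, right s y - left N (s + 1) y = κ * (apex N s - y) := by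
  unfold right left leftSlope apex
  rcases lt_trichotomy (s + 1) N with h | h | h
  · refine ⟨1, by norm_num, by norm_num, by simp, by omega, fun y => ?_⟩
    simp only [h, if_true]; push_cast; ring
  · refine ⟨5 / 3, by norm_num, by norm_num, by norm_num, by omega, fun y => ?_⟩
    subst h
    simp; ring
  · obtain rfl : s = N := by omega
    refine ⟨1 / 3, by norm_num, by norm_num, by simp, by simp, fun y => ?_⟩
    simp; ring

theorem right_sub_left' {s : ℕ} (hs : s < N) (y : ℝ) :
    right (s + 1) y - left N s y = y + depth N s := by
  simp only [right, left, leftSlope, depth, hs, if_true]; push_cast; ring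

theorem left_sub_left (y : ℝ) : left N N y - left N (N + 1) y = (y + depth N N) / 3 := by
  simp [left, leftSlope, depth]; ring

theorem left_le_right {s : ℕ} (hs : s ≤ N) (hN : 1 ≤ N) {y : ℝ} :
    left N (s + 1) y ≤ right s y ↔ y ≤ apex N s := by
  obtain ⟨κ, h0, -, -, -, h⟩ := right_sub_left hs hN
  rw [← sub_nonneg, h, mul_nonneg_iff_of_pos_left h0, sub_nonneg]

theorem left_eq_right {s : ℕ} (hs : s ≤ N) (hN : 1 ≤ N) {y : ℝ} :
    left N (s + 1) y = right s y ↔ y = apex N s := by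
  obtain ⟨κ, h0, -, -, -, h⟩ := right_sub_left hs hN
  rw [eq_comm, ← sub_eq_zero, h, mul_eq_zero, or_iff_right h0.ne', sub_eq_zero, eq_comm]

theorem right_lt_right {s s' : ℕ} (h : s < s') {y : ℝ} (hy : 0 ≤ y) : right s y < right s' y := by
  unfold right
  have : (s : ℝ) ≤ s' := by exact_mod_cast h.le
  nlinarith [intercept_strictMono h, mul_le_mul_of_nonneg_right this hy]

/-- The intercepts grow at least by the factor 4, which outweighs the factor 3/5 at the last arch
but one. -/
theorem apex_lt_apex {s s' : ℕ} (h : s < s') (hs : s' ≤ N) : apex N s < apex N s' := by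
  induction s', h using Nat.le_induction with
  | base =>
    have := intercept_nonneg s
    unfold apex
    simp only [intercept_succ]
    split_ifs <;> first | omega | linarith
  | succ k _ ih =>
    refine (ih (by omega)).trans ?_
    have := intercept_nonneg k
    unfold apex
    simp only [intercept_succ]
    split_ifs <;> first | omega | linarith

/-- Left legs of different arches lie on lines that may cross, but only above the apex of the
smaller arch. This makes the upper arches nested. -/
theorem left_lt_left {s s' : ℕ} (h : s < s') (hs : s' ≤ N) {y : ℝ} (hy : 0 ≤ y)
    (hys : y ≤ apex N s) : left N (s' + 1) y < left N (s + 1) y := by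
  have step : ∀ k, s ≤ k → k + 1 ≤ N → left N (k + 1 + 1) y < left N (k + 1) y := by
    intro k hk hkN
    have hya : y ≤ apex N k := by
      rcases hk.eq_or_lt with rfl | hk
      · exact hys
      · exact hys.trans (apex_lt_apex hk (by omega)).le
    have := intercept_nonneg k
    revert hya
    unfold left leftSlope apex
    simp only [intercept_succ]
    rcases lt_trichotomy (k + 1 + 1) N with h | h | h
    · simp only [h, show k + 1 < N by omega, if_true]; push_cast; intro hya; nlinarith
    · subst h
      simp; intro hya; nlinarith
    · obtain rfl : N = k + 1 := by omega
      simp; intro hya; nlinarith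
  induction s', h using Nat.le_induction with
  | base => exact step s le_rfl (by omega)
  | succ k hk ih => exact (step k (by omega) hs).trans (ih (by omega))

theorem depth_lt_depth {s s' : ℕ} (h : s < s') (hs : s' ≤ N) : depth N s < depth N s' := by
  induction s', h using Nat.le_induction with
  | base =>
    have := intercept_nonneg s
    unfold depth
    simp only [intercept_succ]
    split_ifs <;> first | omega | linarith
  | succ k _ ih =>
    refine (ih (by omega)).trans ?_
    have := intercept_nonneg k
    unfold depth
    simp only [intercept_succ]
    split_ifs <;> first | omega | linarith

theorem left_lt_left' {s s' : ℕ} (h : s < s') (hs : s' ≤ N) {y : ℝ} (hy : y ≤ 0) :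
    left N s' y < left N s y := by
  have h1 : leftSlope N s ≤ leftSlope N s' := by
    have : (s : ℝ) ≤ s' := by exact_mod_cast h.le
    unfold leftSlope
    rw [if_pos (by omega)]
    split_ifs with h1
    · exact this
    · obtain rfl : s' = N := by omega
      linarith
    · omega
  unfold left
  nlinarith [intercept_strictMono h, mul_le_mul_of_nonpos_right h1 hy]

/-- The counterpart for the lower arches: the lines of right legs cross only beneath the lowest
point of the smaller arch. -/
theorem right_lt_right' {s s' : ℕ} (h : s < s') (hs : s' < N) {y : ℝ}
    (hys : -depth N s ≤ y) : right (s + 1) y < right (s' + 1) y := by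
  have step : ∀ k, s ≤ k → k + 1 < N → right (k + 1) y < right (k + 1 + 1) y := by
    intro k hk hkN
    have hya : -depth N k ≤ y := by
      rcases hk.eq_or_lt with rfl | hk
      · exact hys
      · linarith [depth_lt_depth hk (show k ≤ N by omega)]
    have := intercept_nonneg k
    revert hya
    unfold right depth
    simp only [intercept_succ, show k < N by omega, if_true]
    push_cast; intro hya; nlinarith
  induction s', h using Nat.le_induction with
  | base => exact step s le_rfl (by omega)
  | succ k hk ih => exact (ih (by omega)).trans (step k (by omega) hs)

end Spiral

/-! ### Lower bounds for paths that avoid a double spiral -/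

theorem pos_iff_pos_of_segment {f : Plane → ℝ} (hf : Continuous f) {x y : Plane}
    (h : ∀ z ∈ segment ℝ x y, f z ≠ 0) : 0 < f x ↔ 0 < f y := by
  have key : ∀ a ∈ segment ℝ x y, ∀ b ∈ segment ℝ x y, 0 < f a → 0 < f b := by
    intro a ha b hb hpos
    by_contra! hneg
    obtain ⟨z, hz, hz0⟩ := (convex_segment (𝕜 := ℝ) x y).isPreconnected.intermediate_value hb ha
      hf.continuousOn ⟨hneg, hpos.le⟩
    exact h z hz hz0
  exact ⟨key _ (left_mem_segment ..) _ (right_mem_segment ..),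
    key _ (right_mem_segment ..) _ (left_mem_segment ..)⟩

theorem exists_mem_segment_eq_zero {x y : Plane} (hx : 0 ≤ x 1) (hy : y 1 ≤ 0) :
    ∃ z ∈ segment ℝ x y, z 1 = 0 := by
  obtain ⟨z, hz, hz0⟩ := (convex_segment (𝕜 := ℝ) x y).isPreconnected.intermediate_value
    (right_mem_segment ..) (left_mem_segment ..)
    (f := fun z : Plane => z 1) (by fun_prop) ⟨hy, hx⟩
  exact ⟨z, hz, hz0⟩

theorem convex_nonneg : Convex ℝ {z : Plane | 0 ≤ z 1} := by
  intro x hx y hy a b ha hb _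
  simp only [mem_ofPred_eq, PiLp.add_apply, PiLp.smul_apply, smul_eq_mul] at *
  positivity

theorem convex_nonpos : Convex ℝ {z : Plane | z 1 ≤ 0} := by
  intro x hx y hy a b ha hb _
  simp only [mem_ofPred_eq, PiLp.add_apply, PiLp.smul_apply, smul_eq_mul] at *
  nlinarith [mul_nonneg ha (neg_nonneg.2 hx), mul_nonneg hb (neg_nonneg.2 hy)]

theorem segment_subset_left {x y z : Plane} (hz : z ∈ segment ℝ x y) :
    segment ℝ x z ⊆ segment ℝ x y :=
  (convex_segment (𝕜 := ℝ) x y).segment_subset (left_mem_segment ..) hz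

theorem segment_subset_right {x y z : Plane} (hz : z ∈ segment ℝ x y) :
    segment ℝ z y ⊆ segment ℝ x y :=
  (convex_segment (𝕜 := ℝ) x y).segment_subset hz (right_mem_segment ..)

namespace Spiral

/-- `B` contains a double spiral: the upper arches cut off at height `H`, the lower arches, and the
tip. -/
structure Barrier (N : ℕ) (H : ℝ) (B : Set Plane) : Prop where
  one_le : 1 ≤ N
  pos : 0 < H
  up : ∀ s ≤ N, ∀ z : Plane, 0 ≤ z 1 → z 1 ≤ H → left N (s + 1) (z 1) ≤ z 0 →
    z 0 ≤ right s (z 1) → z 0 = left N (s + 1) (z 1) ∨ z 0 = right s (z 1) ∨ z 1 = H → z ∈ B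
  low : ∀ s < N, ∀ z : Plane, z 1 ≤ 0 → left N s (z 1) ≤ z 0 → z 0 ≤ right (s + 1) (z 1) →
    z 0 = left N s (z 1) ∨ z 0 = right (s + 1) (z 1) → z ∈ B
  tip : ∀ z : Plane, z 1 ≤ 0 → left N (N + 1) (z 1) ≤ z 0 → z 0 ≤ left N N (z 1) →
    z 0 = left N (N + 1) (z 1) ∨ z 0 = left N N (z 1) → z ∈ B

variable {N : ℕ} {H : ℝ} {B : Set Plane}

/-- The function is positive exactly below the `s`-th upper arch. -/
noncomputable def upFun (N : ℕ) (H : ℝ) (s : ℕ) (z : Plane) : ℝ :=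
  min (z 0 - left N (s + 1) (z 1)) (min (right s (z 1) - z 0) (H - z 1))

/-- The function is positive exactly above the `s`-th lower arch. -/
noncomputable def lowFun (N s : ℕ) (z : Plane) : ℝ :=
  min (z 0 - left N s (z 1)) (right (s + 1) (z 1) - z 0)

/-- The function is positive exactly above the tip. -/
noncomputable def tipFun (N : ℕ) (z : Plane) : ℝ :=
  min (z 0 - left N (N + 1) (z 1)) (left N N (z 1) - z 0)

theorem continuous_left (s : ℕ) : Continuous (left N s) := by unfold left; fun_prop

theorem continuous_right (s : ℕ) : Continuous (right s) := by unfold right; fun_prop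

theorem continuous_upFun (s : ℕ) : Continuous (upFun N H s) := by
  have := continuous_left (N := N) (s + 1)
  have := continuous_right s
  unfold upFun; fun_prop

theorem continuous_lowFun (s : ℕ) : Continuous (lowFun N s) := by
  have := continuous_left (N := N) s
  have := continuous_right (s + 1)
  unfold lowFun; fun_prop

theorem continuous_tipFun : Continuous (tipFun N) := by
  have := continuous_left (N := N) N
  have := continuous_left (N := N) (N + 1)
  unfold tipFun; fun_prop

open Classical in
/-- The number of upper arches that do not enclose a point of the upper half plane. -/
noncomputable def upLevel (N : ℕ) (H : ℝ) (z : Plane) : ℕ :=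
  ∑ s ∈ Finset.range (N + 1), if 0 < upFun N H s z then 0 else 1

open Classical in
/-- The analogue of `upLevel` in the lower half plane. -/
noncomputable def lowLevel (N : ℕ) (z : Plane) : ℕ :=
  (∑ s ∈ Finset.range N, if 0 < lowFun N s z then 0 else 1) + if 0 < tipFun N z then 1 else 0

open Classical in
/-- A lower bound for the number of edges needed to reach `z` from a point of level zero. -/
noncomputable def level (N : ℕ) (H : ℝ) (z : Plane) : ℕ :=
  if 0 ≤ z 1 then upLevel N H z else lowLevel N z

theorem min_eq_zero_iff {a b : ℝ} : min a b = 0 ↔ 0 ≤ a ∧ 0 ≤ b ∧ (a = 0 ∨ b = 0) := by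
  constructor
  · intro h
    have h1 : 0 ≤ a := h ▸ min_le_left a b
    have h2 : 0 ≤ b := h ▸ min_le_right a b
    refine ⟨h1, h2, ?_⟩
    rcases min_choice a b with h3 | h3 <;> rw [h3] at h <;> simp [h]
  · rintro ⟨h1, h2, rfl | rfl⟩
    exacts [min_eq_left h2, min_eq_right h1]

namespace Barrier

variable (hB : Barrier N H B)
include hB

/-- In the upper half-plane the zeros of every `upFun` belong to the barrier, so no summand changes
along the segment. -/
theorem upLevel_eq {x y : Plane} (h : segment ℝ x y ⊆ Bᶜ) (hx : 0 ≤ x 1) (hy : 0 ≤ y 1) :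
    upLevel N H x = upLevel N H y := by
  refine Finset.sum_congr rfl fun s hs => ?_
  refine if_congr (pos_iff_pos_of_segment (continuous_upFun s) ?_) rfl rfl
  intro z hz h0
  have hz1 : 0 ≤ z 1 := convex_nonneg.segment_subset hx hy hz
  refine h hz ?_
  rw [upFun, min_eq_zero_iff] at h0
  obtain ⟨h1, h2, h3⟩ := h0
  rw [min_eq_zero_iff] at h3
  rw [le_min_iff] at h2
  refine hB.up s (by simpa [Nat.lt_succ_iff] using hs) z hz1 (by linarith) (by linarith)
    (by linarith) ?_
  rcases h3 with h3 | ⟨-, -, h3 | h3⟩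
  · left; linarith
  · right; left; linarith
  · right; right; linarith

theorem lowLevel_eq {x y : Plane} (h : segment ℝ x y ⊆ Bᶜ) (hx : x 1 ≤ 0) (hy : y 1 ≤ 0) :
    lowLevel N x = lowLevel N y := by
  unfold lowLevel
  congr 1
  · refine Finset.sum_congr rfl fun s hs => ?_
    refine if_congr (pos_iff_pos_of_segment (continuous_lowFun s) ?_) rfl rfl
    intro z hz h0
    have hz1 : z 1 ≤ 0 := convex_nonpos.segment_subset hx hy hz
    refine h hz ?_
    rw [lowFun, min_eq_zero_iff] at h0
    obtain ⟨h1, h2, h3⟩ := h0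
    exact hB.low s (by simpa using hs) z hz1 (by linarith) (by linarith)
      (h3.imp (by intro; linarith) (by intro; linarith))
  · refine if_congr (pos_iff_pos_of_segment continuous_tipFun ?_) rfl rfl
    intro z hz h0
    have hz1 : z 1 ≤ 0 := convex_nonpos.segment_subset hx hy hz
    refine h hz ?_
    rw [tipFun, min_eq_zero_iff] at h0
    obtain ⟨h1, h2, h3⟩ := h0
    exact hB.tip z hz1 (by linarith) (by linarith)
      (h3.imp (by intro; linarith) (by intro; linarith))

theorem ne_intercept {z : Plane} (hz : z ∉ B) (h1 : z 1 = 0) {s : ℕ} (hs : s ≤ N) :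
    z 0 ≠ intercept s := by
  intro h
  refine hz (hB.up s hs z h1.ge (h1.trans_le hB.pos.le) ?_ ?_ ?_) <;>
    simp only [h1, left_zero_right, right_zero_right, h]
  · linarith [intercept_nonneg s, intercept_nonneg (s + 1)]
  · rfl
  · simp

theorem ne_neg_intercept {z : Plane} (hz : z ∉ B) (h1 : z 1 = 0) {s : ℕ} (hs : s ≤ N + 1) :
    z 0 ≠ -intercept s := by
  rcases s with _ | s
  · simpa [intercept_zero] using hB.ne_intercept hz h1 (Nat.zero_le N)
  intro h
  refine hz (hB.up s (by omega) z h1.ge (h1.trans_le hB.pos.le) ?_ ?_ ?_) <;>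
    simp only [h1, left_zero_right, right_zero_right, h]
  · rfl
  · linarith [intercept_nonneg s, intercept_nonneg (s + 1)]
  · simp

theorem upLevel_of_neg {z : Plane} (h1 : z 1 = 0) (h0 : z 0 < 0) :
    upLevel N H z = ∑ s ∈ Finset.range (N + 1), if intercept (s + 1) ≤ -z 0 then 1 else 0 := by
  refine Finset.sum_congr rfl fun s _ => ?_
  have := intercept_nonneg s
  have := hB.pos
  simp only [upFun, lt_min_iff, h1, left_zero_right, right_zero_right]
  split_ifs with h2 h3 h3
  · linarith
  · rfl
  · rfl
  · exact absurd ⟨by linarith, by linarith, by linarith⟩ h2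

-- The tip covers the axis between `-intercept (N + 1)` and `-intercept N`. Counting it makes
-- `lowLevel` the number of crossings `-intercept s`, s ≤ N, that are passed on the way from the
-- origin, except beyond the outermost crossing.
omit hB in
theorem lowLevel_of_neg {z : Plane} (h1 : z 1 = 0) (h0 : z 0 < 0) (hN : z 0 ≠ -intercept N) :
    lowLevel N z + (if intercept (N + 1) ≤ -z 0 then 1 else 0) =
      (∑ s ∈ Finset.range (N + 1), if intercept s ≤ -z 0 then 1 else 0) := by
  rw [Finset.sum_range_succ, lowLevel, add_assoc]
  congr 1
  · refine Finset.sum_congr rfl fun s _ => ?_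
    have := intercept_nonneg (s + 1)
    simp only [lowFun, lt_min_iff, h1, left_zero_right, right_zero_right]
    split_ifs with h2 h3 h3
    · linarith
    · rfl
    · rfl
    · exact absurd ⟨by linarith, by linarith⟩ h2
  · have := intercept_strictMono (Nat.lt_succ_self N)
    simp only [tipFun, lt_min_iff, h1, left_zero_right]
    split_ifs with h2 h3 h4 h5 h6 h7 <;> first | rfl | linarith | skip
    exact absurd ⟨by linarith, lt_of_le_of_ne (by linarith) (fun h => hN (by linarith))⟩ h2

theorem upLevel_of_pos {z : Plane} (h1 : z 1 = 0) (h0 : 0 < z 0) :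
    upLevel N H z = lowLevel N z + 1 := by
  have h2 : upLevel N H z = ∑ s ∈ Finset.range (N + 1), if intercept s ≤ z 0 then 1 else 0 := by
    refine Finset.sum_congr rfl fun s _ => ?_
    have := intercept_nonneg (s + 1)
    have := hB.pos
    simp only [upFun, lt_min_iff, h1, left_zero_right, right_zero_right]
    split_ifs with h2 h3 h3
    · linarith
    · rfl
    · rfl
    · exact absurd ⟨by linarith, by linarith, by linarith⟩ h2
  have h3 : lowLevel N z = ∑ s ∈ Finset.range N, if intercept (s + 1) ≤ z 0 then 1 else 0 := by
    rw [lowLevel, if_neg, add_zero]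
    · refine Finset.sum_congr rfl fun s _ => ?_
      have := intercept_nonneg s
      simp only [lowFun, lt_min_iff, h1, left_zero_right, right_zero_right]
      split_ifs with h2 h3 h3
      · linarith
      · rfl
      · rfl
      · exact absurd ⟨by linarith, by linarith⟩ h2
    · have := intercept_nonneg N
      simp only [tipFun, lt_min_iff, h1, left_zero_right]
      intro h
      linarith
  rw [h2, h3, Finset.sum_range_succ', if_pos (by rw [intercept_zero]; exact h0.le)]

/-- The upper arch `s` spans the axis from `-intercept (s + 1)` to `intercept s`, the lower one from
`-intercept s` to `intercept (s + 1)`. This shift of indices makes the two levels differ by one. -/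
theorem level_axis {z : Plane} (hz : z ∉ B) (h1 : z 1 = 0) :
    upLevel N H z = lowLevel N z + 1 ∨ lowLevel N z = upLevel N H z + 1 := by
  rcases lt_trichotomy (z 0) 0 with h0 | h0 | h0
  · have h2 := hB.upLevel_of_neg h1 h0
    have h3 := lowLevel_of_neg h1 h0 (hB.ne_neg_intercept hz h1 (Nat.le_succ N))
    rw [Finset.sum_range_succ] at h2
    rw [Finset.sum_range_succ', if_pos (show intercept 0 ≤ -z 0 by rw [intercept_zero]; linarith)]
      at h3
    rw [h2]
    split_ifs at h3 ⊢ <;> omega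
  · exact absurd (h0.trans intercept_zero.symm) (hB.ne_intercept hz h1 (Nat.zero_le N))
  · exact .inl (hB.upLevel_of_pos h1 h0)

/-- A segment passes from one closed half-plane to the other at most once, and the level changes
only there. -/
theorem level_le_of_segment {x y : Plane} (h : segment ℝ x y ⊆ Bᶜ) :
    level N H y ≤ level N H x + 1 := by
  have aux : ∀ {x y : Plane}, segment ℝ x y ⊆ Bᶜ → 0 ≤ x 1 → y 1 < 0 →
      upLevel N H x = lowLevel N y + 1 ∨ lowLevel N y = upLevel N H x + 1 := by
    intro x y h hx hy
    obtain ⟨z, hz, hz0⟩ := exists_mem_segment_eq_zero hx hy.le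
    rw [hB.upLevel_eq ((segment_subset_left hz).trans h) hx hz0.ge,
      ← hB.lowLevel_eq ((segment_subset_right hz).trans h) hz0.le hy.le]
    exact hB.level_axis (h hz) hz0
  unfold level
  split_ifs with h1 h2 h2
  · rw [hB.upLevel_eq h h2 h1]; omega
  · have := aux (segment_symm ℝ x y ▸ h) h1 (not_le.1 h2); omega
  · have := aux h h2 (not_le.1 h1); omega
  · rw [hB.lowLevel_eq h (not_le.1 h2).le (not_le.1 h1).le]; omega

theorem level_le {x y : Plane} {k : ℕ} (h : Linked Bᶜ k x y) :
    level N H y ≤ level N H x + k := by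
  induction k generalizing x with
  | zero => rw [Linked.zero_iff.1 h]; rfl
  | succ k ih =>
    obtain ⟨z, hz, h⟩ := h.exists_of_succ
    have := ih h
    have := hB.level_le_of_segment hz
    omega

end Barrier

end Spiral

/-! ### Levels near the two distinguished crossings; the additional edge in the odd case -/

namespace Spiral

variable {N : ℕ} {H : ℝ} {B : Set Plane}

theorem three_mul_le_intercept (s : ℕ) : 3 * (s : ℝ) ≤ intercept s := by
  induction s with
  | zero => simp [intercept_zero]
  | succ s ih =>
    have := intercept_nonneg s
    rw [intercept_succ]; push_cast; linarith

theorem leftSlope_nonneg (s : ℕ) : 0 ≤ leftSlope N s := by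
  unfold leftSlope; split_ifs <;> positivity

theorem leftSlope_le {s : ℕ} (hs : s ≤ N + 1) : leftSlope N s ≤ s + 2 / 3 := by
  unfold leftSlope
  split_ifs with h1 h2
  · linarith
  · rw [h2]
  · obtain rfl : s = N + 1 := by omega
    push_cast; linarith

/-- Near the crossing at the origin, the points to the lower right and to the upper left are
enclosed by all arches of their half-plane. Displacements along (1, -1) thus give level zero on both
sides of the polygon. -/
theorem level_origin_right {ε : ℝ} (h0 : 0 < ε) (h1 : ε < 1) : level N H !₂[ε, -ε] = 0 := by
  rw [level, if_neg (by simpa using h0), lowLevel, if_neg, add_zero]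
  · refine Finset.sum_eq_zero fun s hs => if_pos ?_
    have h2 := intercept_nonneg s
    have h3 := mul_nonneg (leftSlope_nonneg (N := N) s) h0.le
    have h4 := three_mul_le_intercept (s + 1)
    have h5 : (0 : ℝ) ≤ s := by positivity
    push_cast at h4
    simp [lowFun, left, right]
    constructor <;> nlinarith
  · have h2 := intercept_nonneg N
    have h3 := mul_nonneg (leftSlope_nonneg (N := N) N) h0.le
    simp [tipFun, left]
    intro
    nlinarith

theorem level_origin_left {ε : ℝ} (h0 : 0 < ε) (h1 : ε < 1) (hH : ε < H) :
    level N H !₂[-ε, ε] = 0 := by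
  rw [level, if_pos (by simpa using h0.le)]
  refine Finset.sum_eq_zero fun s hs => if_pos ?_
  have h2 := intercept_nonneg s
  have h3 := mul_le_mul_of_nonneg_right (leftSlope_le (N := N) (s := s + 1)
    (by simp at hs; omega)) h0.le
  have h4 := three_mul_le_intercept (s + 1)
  have h5 : (0 : ℝ) ≤ s := by positivity
  push_cast at h3 h4
  simp [upFun, left, right, hH]
  constructor <;> nlinarith

/-- The lower right point is in the tip and outside all lower arches, so the tip contributes the
last unit. -/
theorem level_end_right {ε : ℝ} (h0 : 0 < ε) (h1 : ε < 1) :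
    level N H !₂[-intercept (N + 1) + ε, -ε] = N + 1 := by
  have h6 := intercept_succ N
  have h7 := three_mul_le_intercept N
  rw [level, if_neg (by simpa using h0), lowLevel, if_pos]
  · congr 1
    rw [Finset.sum_congr rfl (g := fun _ => 1), Finset.sum_const, Finset.card_range, smul_eq_mul,
      mul_one]
    intro s hs
    refine if_neg ?_
    have hs : s < N := by simpa using hs
    have h2 := intercept_strictMono hs
    have h3 := mul_le_mul_of_nonneg_right (leftSlope_le (N := N) (s := s) (by omega)) h0.le
    have h4 : (s : ℝ) ≤ N := by exact_mod_cast hs.le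
    have h5 : (0 : ℝ) ≤ s := by positivity
    simp [lowFun, left]
    intro
    nlinarith
  · have h3 := mul_le_mul_of_nonneg_right (leftSlope_le (N := N) (s := N) (by omega)) h0.le
    have h4 := mul_nonneg (leftSlope_nonneg (N := N) (N + 1)) h0.le
    have h5 : (0 : ℝ) ≤ N := by positivity
    simp [tipFun, left]
    constructor <;> nlinarith

theorem level_end_left {ε : ℝ} (h0 : 0 < ε) :
    level N H !₂[-intercept (N + 1) - ε, ε] = N + 1 := by
  rw [level, if_pos (by simpa using h0.le), upLevel, Finset.sum_congr rfl (g := fun _ => 1),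
    Finset.sum_const, Finset.card_range, smul_eq_mul, mul_one]
  intro s hs
  refine if_neg ?_
  have h2 : intercept (s + 1) ≤ intercept (N + 1) :=
    intercept_strictMono.monotone (by simp at hs; omega)
  have h4 := mul_nonneg (leftSlope_nonneg (N := N) (s + 1)) h0.le
  simp [upFun, left]
  intro
  nlinarith

namespace Barrier

variable (hB : Barrier N H B)
include hB

/-- To the right of the origin `upLevel` would exceed `lowLevel`. To the left `upLevel` counts the
crossings passed, which determines the interval. -/
theorem mem_Ioo_of_level {z : Plane} (hz : z ∉ B) (h1 : z 1 = 0) (hlow : lowLevel N z = N)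
    (hup : upLevel N H z + 1 = N) : z 0 ∈ Ioo (-intercept N) (-intercept (N - 1)) := by
  obtain ⟨M, rfl⟩ : ∃ M, N = M + 1 := ⟨N - 1, by have := hB.one_le; omega⟩
  rcases lt_trichotomy (z 0) 0 with h0 | h0 | h0
  · have h2 := hB.upLevel_of_neg h1 h0
    constructor
    · by_contra! h
      rw [Finset.sum_range_succ, Finset.sum_congr rfl (g := fun _ => 1), Finset.sum_const,
        Finset.card_range, smul_eq_mul, mul_one] at h2
      · omega
      · intro s hs
        refine if_pos ?_
        have : intercept (s + 1) ≤ intercept (M + 1) :=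
          intercept_strictMono.monotone (by simp at hs; omega)
        linarith
    · refine lt_of_le_of_ne ?_ (hB.ne_neg_intercept hz h1 (by omega))
      by_contra! h
      obtain ⟨M, rfl⟩ : ∃ K, M = K + 1 := by
        refine ⟨M - 1, ?_⟩
        rcases M with _ | M
        · simp [intercept_zero] at h; linarith
        · rfl
      simp only [Nat.add_sub_cancel] at h
      have h3 := intercept_strictMono (show M + 1 < M + 1 + 1 by omega)
      have h4 := intercept_strictMono (show M + 1 + 1 < M + 1 + 1 + 1 by omega)
      rw [Finset.sum_range_succ, Finset.sum_range_succ, Finset.sum_range_succ, if_neg (by linarith),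
        if_neg (by linarith), if_neg (by linarith)] at h2
      have h5 : (∑ s ∈ Finset.range M, if intercept (s + 1) ≤ -z 0 then 1 else 0) ≤ M := by
        refine (Finset.sum_le_card_nsmul _ _ 1 fun s _ => ?_).trans (by simp)
        split_ifs <;> simp
      omega
  · exact absurd (h0.trans intercept_zero.symm) (hB.ne_intercept hz h1 (Nat.zero_le _))
  · have := hB.upLevel_of_pos h1 h0
    omega

/-- A nearly horizontal segment that starts in the pocket between the two leftmost lines that
carry lower edges cannot leave it without crossing one of these edges. -/
theorem not_segment_subset_of_flat {x c : Plane} (hc1 : c 1 = 0)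
    (hc : c 0 ∈ Ioo (-intercept N) (-intercept (N - 1))) (hx1 : x 1 < 0)
    (hx : 2 * intercept N + (N + 2) * -x 1 ≤ |x 0 - c 0|) : ¬ segment ℝ c x ⊆ Bᶜ := by
  obtain ⟨M, rfl⟩ : ∃ M, N = M + 1 := ⟨N - 1, by have := hB.one_le; omega⟩
  simp only [Nat.add_sub_cancel] at hc
  obtain ⟨hcl, hcr⟩ := hc
  have hM := intercept_nonneg M
  have hM1 := intercept_succ M
  have hM2 := intercept_succ (M + 1)
  have hMr : (0 : ℝ) ≤ M := by positivity
  have hL (y : ℝ) : left (M + 1) (M + 1) y = -intercept (M + 1) + (M + 1 + 2 / 3) * y := by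
    simp [left, leftSlope]
  have hL' (y : ℝ) : left (M + 1) M y = -intercept M + M * y := by
    simp [left, leftSlope]
  set f : Plane → ℝ :=
    fun z => min (z 0 - left (M + 1) (M + 1) (z 1)) (left (M + 1) M (z 1) - z 0)
  have hf : Continuous f := by
    have := continuous_left (N := M + 1) (M + 1)
    have := continuous_left (N := M + 1) M
    fun_prop
  have bound : ∀ z : Plane, z 1 ≤ 0 → 0 ≤ f z →
      |z 0 - c 0| ≤ intercept (M + 1) + (M + 1 + 2 / 3) * -z 1 := by
    intro z hz1 hz
    obtain ⟨h1, h2⟩ := le_min_iff.1 hz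
    rw [hL] at h1
    rw [hL'] at h2
    have := mul_nonneg hMr (neg_nonneg.2 hz1)
    rw [abs_le]
    constructor <;> nlinarith
  intro hseg
  push_cast at hx
  obtain ⟨z, hz, hz0⟩ : ∃ z ∈ segment ℝ c x, f z = 0 := by
    by_contra! hcon
    have h1 : 0 < f x := by
      rw [← pos_iff_pos_of_segment hf hcon]
      refine lt_min ?_ ?_
      · rw [hc1, left_zero_right]; linarith
      · rw [hc1, left_zero_right]; linarith
    have := bound x hx1.le h1.le
    nlinarith
  refine hseg hz ?_
  have hzB := hz0
  obtain ⟨τ, hτ0, hτ1, hzτ⟩ := mem_segment_iff_add_smul.1 hz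
  have e0 : z 0 - c 0 = τ * (x 0 - c 0) := by simp [hzτ]
  have e1 : z 1 = τ * x 1 := by simp [hzτ, hc1]
  have hz1 : z 1 ≤ 0 := by rw [e1]; nlinarith
  have hb := bound z hz1 hz0.ge
  rw [e0, abs_mul, abs_of_nonneg hτ0, e1] at hb
  have hb2 := mul_le_mul_of_nonneg_left hx hτ0
  -- The segment is so flat that it leaves the pocket above the lower ends of both bounding edges,
  -- hence through one of them.
  have hz2 : -intercept (M + 1) ≤ z 1 := by
    rw [e1]
    nlinarith [mul_nonneg hτ0 (neg_nonneg.2 hx1.le), mul_nonneg hτ0 hM]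
  obtain ⟨h1, h2, h3⟩ := min_eq_zero_iff.1 hz0
  rcases h3 with h3 | h3
  · refine hB.tip z hz1 ?_ (by linarith) (.inr (by linarith))
    have h4 := left_sub_left (N := M + 1) (z 1)
    simp only [depth, lt_irrefl, if_false] at h4
    linarith
  · refine hB.low M (by omega) z hz1 (by linarith) ?_ (.inl (by linarith))
    have h4 := right_sub_left' (N := M + 1) (s := M) (by omega) (z 1)
    simp only [depth, Nat.lt_succ_self, if_true] at h4
    linarith

/-- Paths from a point just above the middle of the top edge to level zero have an edge more than the
levels require, since their first two edges cannot get below level `N`. -/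
theorem exists_add_two_le (hH : H = apex N N / 2) : ∃ m ε : ℝ, 0 < ε ∧
    ∀ a k, level N H a = 0 → Linked Bᶜ k !₂[m, H + ε] a → N + 2 ≤ k := by
  have hHpos := hB.pos
  have hN := hB.one_le
  have hpN := intercept_nonneg N
  set m := (left N (N + 1) H + right N H) / 2 with hm
  have hc : right N H - left N (N + 1) H = H / 3 := by
    obtain ⟨κ, -, -, -, hκ, h⟩ := right_sub_left le_rfl hN
    rw [h, hκ rfl, hH]; ring
  -- In `K * H`, the term `|m|` and one `intercept N` pay for passing from `m` to the crossing `c`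
  -- of the axis. The slope N + 2 and the other two are required by `not_segment_subset_of_flat`.
  set K : ℝ := N + 2 + (|m| + 3 * intercept N) / H with hK
  have hKpos : 0 < K := by positivity
  have hKH : K * H = (N + 2) * H + |m| + 3 * intercept N := by rw [hK]; field_simp; ring
  -- By `hc` the top edge has half-width H / 6, and `K * ε` equals it.
  refine ⟨m, H / (6 * K), by positivity, fun a k ha hk => ?_⟩
  set ε := H / (6 * K) with hε
  have hεpos : 0 < ε := by positivity
  have hεK : 6 * (K * ε) = H := by rw [hε]; field_simp
  set b : Plane := !₂[m, H + ε] with hb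
  have hb0 : b 0 = m := rfl
  have hb1 : b 1 = H + ε := rfl
  have hbup : upLevel N H b = N + 1 := by
    rw [upLevel, Finset.sum_congr rfl (g := fun _ => 1), Finset.sum_const, Finset.card_range,
      smul_eq_mul, mul_one]
    intro s _
    refine if_neg ?_
    simp only [upFun, lt_min_iff, hb1]
    intro h
    linarith
  have hblev : level N H b = N + 1 := by
    rw [level, if_pos (by rw [hb1]; positivity), hbup]
  rcases k with _ | _ | k
  · rw [Linked.zero_iff] at hk
    rw [hk, ha] at hblev
    omega
  · have := hB.level_le hk.symm
    omega
  obtain ⟨x, hbx, hk⟩ := hk.exists_of_succ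
  obtain ⟨y, hxy, hk⟩ := hk.exists_of_succ
  have hk := hB.level_le hk.symm
  have l1 := hB.level_le_of_segment (segment_symm ℝ b x ▸ hbx)
  have l2 := hB.level_le_of_segment (segment_symm ℝ x y ▸ hxy)
  by_contra! hlt
  -- With at most N + 1 edges, each of the first two has to lower the level by one, so each changes
  -- the half-plane.
  have hx1 : x 1 < 0 := by
    by_contra! h
    have h1 := hB.upLevel_eq hbx (by rw [hb1]; positivity) h
    have h2 : level N H x = upLevel N H x := if_pos h
    omega
  have hxl : level N H x = lowLevel N x := if_neg hx1.not_ge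
  have hy1 : 0 ≤ y 1 := by
    by_contra! h
    have h1 := hB.lowLevel_eq hxy hx1.le h.le
    have h2 : level N H y = lowLevel N y := if_neg h.not_ge
    omega
  have hyl : level N H y = upLevel N H y := if_pos hy1
  obtain ⟨c, hcyx, hc1⟩ := exists_mem_segment_eq_zero hy1 hx1.le
  rw [segment_symm] at hxy
  have hcx := (segment_subset_right hcyx).trans hxy
  have hcB : c ∉ B := hxy hcyx
  have h1 := hB.lowLevel_eq hcx hc1.le hx1.le
  have h2 := hB.upLevel_eq ((segment_subset_left hcyx).trans hxy) hy1 hc1.ge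
  have hax := hB.level_axis hcB hc1
  have hcI := hB.mem_Ioo_of_level hcB hc1 (by omega) (by omega)
  refine hB.not_segment_subset_of_flat hc1 hcI hx1 ?_ hcx
  have hden : 0 < H + ε - x 1 := by linarith
  set τ := ε / (H + ε - x 1) with hτ
  have hτm : τ * (H + ε - x 1) = ε := by rw [hτ]; field_simp
  have hτpos : 0 < τ := by positivity
  set z : Plane := b + τ • (x - b) with hz
  have hz1 : z 1 = H := by simp [hz, hb]; linarith
  have hz0 : z 0 = m + τ * (x 0 - m) := by simp [hz, hb]
  have hzB : z ∉ B := hbx (mem_segment_iff_add_smul.2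
    ⟨τ, hτpos.le, (div_le_one hden).2 (by linarith), rfl⟩)
  -- The first edge gets past the top edge within the small fraction `τ` of its length, so `x` is
  -- far away horizontally.
  have habs : H / 6 < |τ * (x 0 - m)| := by
    by_contra! h
    rw [abs_le] at h
    refine hzB (hB.up N le_rfl z (by linarith) hz1.le ?_ ?_ (.inr (.inr hz1))) <;>
      rw [hz1, hz0] <;> linarith [h.1, h.2]
  rw [abs_mul, abs_of_pos hτpos] at habs
  have hfar : K * (H + ε - x 1) < |x 0 - m| := by
    have : τ * (K * (H + ε - x 1)) < τ * |x 0 - m| := by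
      calc _ = K * (τ * (H + ε - x 1)) := by ring
        _ = H / 6 := by rw [hτm]; linarith
        _ < _ := habs
    exact lt_of_mul_lt_mul_left this hτpos.le
  have hc0 : |c 0| ≤ intercept N := by
    have := intercept_nonneg (N - 1)
    rw [abs_le]; constructor <;> linarith [hcI.1, hcI.2]
  have htri : |x 0 - m| ≤ |x 0 - c 0| + |c 0| + |m| := by
    have h3 := abs_add_le (x 0 - c 0) (c 0 - m)
    have h4 := abs_sub (c 0) m
    have h5 : x 0 - c 0 + (c 0 - m) = x 0 - m := by ring
    rw [h5] at h3
    linarith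
  have hKN : (N : ℝ) + 2 ≤ K := by rw [hK]; linarith [show 0 ≤ (|m| + 3 * intercept N) / H by positivity]
  have h8 : (N + 2) * -x 1 ≤ K * -x 1 := mul_le_mul_of_nonneg_right hKN (by linarith)
  have h9 : 0 ≤ ((N : ℝ) + 2) * H := by positivity
  nlinarith [mul_pos hKpos hεpos]

end Barrier

end Spiral

/-! ### A criterion for simplicity, and crossings of the axis -/

namespace Polygon

variable {n : ℕ} {P : Polygon Plane n}

/-- Equal vertices would be common points of two edges and therefore the two ends of one edge, which
`hne` excludes. -/
theorem isSimpleClosed_of (hn : 3 ≤ n)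
    (hinter : ∀ i j : Fin n, i < j → ∀ z ∈ P.edgeSet ℝ i, z ∈ P.edgeSet ℝ j →
      j = finRotate n i ∧ z = P.vertices j ∨ i = finRotate n j ∧ z = P.vertices i)
    (hne : ∀ i, P.vertices i ≠ P.vertices (finRotate n i)) : P.IsSimpleClosed := by
  have hrot (i : Fin n) := (finRotate_finRotate_ne_self hn i).symm
  refine ⟨?_, fun i => ?_, fun i j hij h1 h2 => ?_⟩
  · have key : ∀ i j : Fin n, i < j → P.vertices i ≠ P.vertices j := by
      intro i j hij h
      rcases hinter i j hij _ (left_mem_edgeSet i) (h ▸ left_mem_edgeSet j) with ⟨h1, -⟩ | ⟨h1, -⟩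
      · exact hne i (h1 ▸ h)
      · exact hne j (h1 ▸ h.symm)
    intro i j h
    rcases lt_trichotomy i j with h1 | h1 | h1
    · exact absurd h (key i j h1)
    · exact h1
    · exact absurd h.symm (key j i h1)
  · apply Subset.antisymm
    · rintro z ⟨h1, h2⟩
      rcases lt_trichotomy i (finRotate n i) with h | h | h
      · rcases hinter _ _ h z h1 h2 with ⟨-, h3⟩ | ⟨h3, -⟩
        · exact h3
        · exact absurd h3 (hrot i)
      · exact absurd (congrArg P.vertices h) (hne i)
      · rcases hinter _ _ h z h2 h1 with ⟨h3, -⟩ | ⟨-, h3⟩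
        · exact absurd h3 (hrot i)
        · exact h3
    · rintro z rfl
      exact ⟨right_mem_edgeSet i, left_mem_edgeSet _⟩
  · rw [Set.disjoint_left]
    intro z hi hj
    rcases lt_or_gt_of_ne hij with h | h
    · rcases hinter _ _ h z hi hj with ⟨h3, -⟩ | ⟨h3, -⟩
      exacts [h1 h3, h2 h3]
    · rcases hinter _ _ h z hj hi with ⟨h3, -⟩ | ⟨h3, -⟩
      exacts [h2 h3, h1 h3]

end Polygon

theorem mem_segment_graph_iff {a b : ℝ} {u v z : Plane} (hu : u 0 = a + b * u 1)
    (hv : v 0 = a + b * v 1) (huv : u 1 < v 1) :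
    z ∈ segment ℝ u v ↔ z 0 = a + b * z 1 ∧ u 1 ≤ z 1 ∧ z 1 ≤ v 1 := by
  rw [mem_segment_iff_add_smul]
  constructor
  · rintro ⟨t, h0, h1, rfl⟩
    simp only [PiLp.add_apply, PiLp.smul_apply, PiLp.sub_apply, smul_eq_mul]
    refine ⟨by rw [hu, hv]; ring, by nlinarith, by nlinarith⟩
  · rintro ⟨h0, h1, h2⟩
    have hpos : 0 < v 1 - u 1 := sub_pos.2 huv
    refine ⟨(z 1 - u 1) / (v 1 - u 1), by apply div_nonneg <;> linarith,
      (div_le_one hpos).2 (by linarith), plane_ext ?_ ?_⟩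
    · simp only [PiLp.add_apply, PiLp.smul_apply, PiLp.sub_apply, smul_eq_mul]
      rw [hu, hv, h0]; field_simp; ring
    · simp only [PiLp.add_apply, PiLp.smul_apply, PiLp.sub_apply, smul_eq_mul]
      field_simp; ring

/-- For `b ≥ 0` the direction (b, 1) of the edge is transversal to the displacement (1, -1). -/
theorem exists_crossing {a b : ℝ} {u v : Plane} (hb : 0 ≤ b) (hu : u 0 = a + b * u 1)
    (hv : v 0 = a + b * v 1) (huv : u 1 * v 1 < 0) :
    (∃ τ : ℝ, 0 < τ ∧ τ < 1 ∧ !₂[a, 0] = u + τ • (v - u)) ∧ cr (v - u) !₂[1, -1] ≠ 0 := by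
  have hne : v 1 - u 1 ≠ 0 := by
    intro h
    rw [sub_eq_zero.1 h] at huv
    nlinarith [mul_self_nonneg (u 1)]
  constructor
  · have key : 0 < -u 1 / (v 1 - u 1) ∧ -u 1 / (v 1 - u 1) < 1 := by
      rcases lt_or_ge (u 1) 0 with h | h
      · have : 0 < v 1 := by by_contra! h2; nlinarith
        exact ⟨div_pos (by linarith) (by linarith), (div_lt_one (by linarith)).2 (by linarith)⟩
      · have h3 : 0 < u 1 := lt_of_le_of_ne h (by rintro h3; simp [← h3] at huv)
        have : v 1 < 0 := by by_contra! h2; nlinarith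
        exact ⟨div_pos_of_neg_of_neg (by linarith) (by linarith),
          (div_lt_one_of_neg (by linarith)).2 (by linarith)⟩
    refine ⟨_, key.1, key.2, plane_ext ?_ ?_⟩
    · simp
      rw [hu, hv]; field_simp; ring
    · simp
      field_simp; ring
  · have : cr (v - u) !₂[1, -1] = -((b + 1) * (v 1 - u 1)) := by
      simp [cr, hu, hv]; ring
    rw [this]
    exact neg_ne_zero.2 (mul_ne_zero (by linarith) hne)

/-! ### From barriers to polygonal diameters; construction of the spiral -/

namespace Spiral

variable {N : ℕ} {H : ℝ}

/-- At each of the two crossings the two displaced points have the same level, and one is interior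
and the other exterior. It is therefore irrelevant which is which. -/
theorem Barrier.poldiam_bounds {n : ℕ} {P : Polygon Plane n} (hn : 3 ≤ n) (hP : P.IsSimpleClosed)
    (hB : Barrier N H (P.boundary ℝ)) {i j : Fin n} {a b c d : ℝ}
    (hb : 0 ≤ b) (hd : 0 ≤ d) (ha : a = 0) (hc : c = -intercept (N + 1))
    (hi : P.vertices i 0 = a + b * P.vertices i 1)
    (hi' : P.vertices (finRotate n i) 0 = a + b * P.vertices (finRotate n i) 1)
    (hii : P.vertices i 1 * P.vertices (finRotate n i) 1 < 0)
    (hj : P.vertices j 0 = c + d * P.vertices j 1)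
    (hj' : P.vertices (finRotate n j) 0 = c + d * P.vertices (finRotate n j) 1)
    (hjj : P.vertices j 1 * P.vertices (finRotate n j) 1 < 0) :
    ((N + 1 : ℕ) : ℕ∞) ≤ poldiam P.int ∧ ((N + 1 : ℕ) : ℕ∞) ≤ poldiam P.ext ∧
      ∃ x ∈ P.ext, level N H x = 0 := by
  obtain ⟨⟨τ, hτ0, hτ1, hτ⟩, hcr⟩ := exists_crossing hb hi hi' hii
  obtain ⟨⟨σ, hσ0, hσ1, hσ⟩, hcr'⟩ := exists_crossing hd hj hj' hjj
  obtain ⟨ε, ⟨⟨h1, h2⟩, hε1⟩, hε0⟩ :=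
    (((Polygon.eventually_mem_int_ext hP hn i hτ0 hτ1 hτ hcr).and
      (Polygon.eventually_mem_int_ext hP hn j hσ0 hσ1 hσ hcr')).and
        (eventually_nhdsWithin_of_eventually_nhds (eventually_lt_nhds
          (lt_min one_pos hB.pos)))).and self_mem_nhdsWithin |>.exists
  have hε0 : 0 < ε := hε0
  rw [lt_min_iff] at hε1
  have e1 : !₂[a, 0] + ε • !₂[1, -1] = (!₂[ε, -ε] : Plane) := by
    apply plane_ext <;> simp [ha]
  have e2 : !₂[a, 0] - ε • !₂[1, -1] = (!₂[-ε, ε] : Plane) := by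
    apply plane_ext <;> simp [ha]
  have e3 : !₂[c, 0] + ε • !₂[1, -1] = (!₂[-intercept (N + 1) + ε, -ε] : Plane) := by
    apply plane_ext <;> simp [hc]
  have e4 : !₂[c, 0] - ε • !₂[1, -1] = (!₂[-intercept (N + 1) - ε, ε] : Plane) := by
    apply plane_ext <;> simp [hc]
  rw [e1, e2] at h1
  rw [e3, e4] at h2
  have l1 := level_origin_right (N := N) (H := H) hε0 hε1.1
  have l2 := level_origin_left (N := N) hε0 hε1.1 hε1.2
  have l3 := level_end_right (N := N) (H := H) hε0 hε1.1
  have l4 := level_end_left (N := N) (H := H) hε0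
  obtain ⟨⟨x, hx, hxl⟩, x', hx', hxl'⟩ :
      (∃ x ∈ P.int, level N H x = 0) ∧ ∃ x ∈ P.ext, level N H x = 0 := by
    rcases h1 with ⟨h, h'⟩ | ⟨h, h'⟩
    exacts [⟨⟨_, h, l1⟩, _, h', l2⟩, ⟨⟨_, h', l2⟩, _, h, l1⟩]
  obtain ⟨⟨y, hy, hyl⟩, y', hy', hyl'⟩ :
      (∃ x ∈ P.int, level N H x = N + 1) ∧ ∃ x ∈ P.ext, level N H x = N + 1 := by
    rcases h2 with ⟨h, h'⟩ | ⟨h, h'⟩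
    exacts [⟨⟨_, h, l3⟩, _, h', l4⟩, ⟨⟨_, h', l4⟩, _, h, l3⟩]
  refine ⟨le_poldiam hx hy fun l hl => ?_, le_poldiam hx' hy' fun l hl => ?_, x', hx', hxl'⟩
  · have := hB.level_le (hl.subset Polygon.int_subset); omega
  · have := hB.level_le (hl.subset Polygon.ext_subset); omega

/-! ### The vertices -/

/-- Whether the line that carries the `k`-th edge crosses the axis on the right. -/
def IsRight (N k : ℕ) : Prop := k % 2 = 0 ∧ k ≤ N ∨ k % 2 = 1 ∧ N ≤ k ∧ k ≤ 2 * N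

instance (N k : ℕ) : Decidable (IsRight N k) := inferInstanceAs (Decidable (_ ∨ _))

/-- The index of the line that carries the `k`-th edge. -/
def lineIdx (N k : ℕ) : ℕ := if k ≤ N then N - k else k - N

/-- The index of the upper arch that contains the upper half of the `k`-th edge. -/
def upIdx (N k : ℕ) : ℕ := if IsRight N k then lineIdx N k else lineIdx N k - 1

/-- The index of the lower arch that contains the lower half of the `k`-th edge. -/
def lowIdx (N k : ℕ) : ℕ :=
  if IsRight N k ∨ k = 2 * N + 1 then lineIdx N k - 1 else lineIdx N k

/-- Abscissa at height `y` of the line that carries the `k`-th edge. -/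
noncomputable def line (N k : ℕ) : ℝ → ℝ :=
  if IsRight N k then right (lineIdx N k) else left N (lineIdx N k)

/-- The height at which the upper arches end. -/
noncomputable def height (N : ℕ) (H : ℝ) (s : ℕ) : ℝ := if s = N then H else apex N s

/-- The successive vertices of the double spiral. -/
noncomputable def vertex (N : ℕ) (H : ℝ) (k : ℕ) : Plane :=
  if k = 2 * N + 2 then !₂[left N (N + 1) H, H]
  else if k % 2 = 0 then !₂[right (upIdx N k) (height N H (upIdx N k)), height N H (upIdx N k)]
  else !₂[left N (lowIdx N k) (-depth N (lowIdx N k)), -depth N (lowIdx N k)]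

theorem line_eq_up (hN : 1 ≤ N) {k : ℕ} (hk : k ≤ 2 * N + 1) : upIdx N k ≤ N ∧
    (IsRight N k ∧ line N k = right (upIdx N k) ∨
      ¬ IsRight N k ∧ line N k = left N (upIdx N k + 1)) := by
  by_cases h : IsRight N k
  · refine ⟨?_, .inl ⟨h, ?_⟩⟩
    · simp only [upIdx, lineIdx, h, if_true]
      unfold IsRight at h
      split_ifs <;> omega
    · simp only [line, upIdx, h, if_true]
  · have h1 : 1 ≤ lineIdx N k := by
      unfold IsRight at h
      unfold lineIdx
      split_ifs <;> omega
    refine ⟨?_, .inr ⟨h, ?_⟩⟩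
    · simp only [upIdx, h, if_false]
      unfold lineIdx
      split_ifs <;> omega
    · simp only [line, upIdx, h, if_false]
      rw [Nat.sub_add_cancel h1]

theorem line_eq_low (hN : 1 ≤ N) {k : ℕ} (hk : k ≤ 2 * N + 1) :
    lowIdx N k < N ∧ (IsRight N k ∧ k ≠ N ∧ line N k = right (lowIdx N k + 1) ∨
      (¬ IsRight N k ∨ k = N) ∧ line N k = left N (lowIdx N k)) ∨
    lowIdx N k = N ∧ (k = 2 * N ∧ line N k = left N N ∨
      k = 2 * N + 1 ∧ line N k = left N (N + 1)) := by
  rcases eq_or_ne k (2 * N + 1) with rfl | h0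
  · have h1 : ¬ IsRight N (2 * N + 1) := by unfold IsRight; omega
    have h2 : lineIdx N (2 * N + 1) = N + 1 := by unfold lineIdx; split_ifs <;> omega
    exact .inr ⟨by simp [lowIdx, h2], .inr ⟨rfl, by simp [line, h1, h2]⟩⟩
  rcases eq_or_ne k (2 * N) with rfl | h0'
  · have h1 : ¬ IsRight N (2 * N) := by unfold IsRight; omega
    have h2 : lineIdx N (2 * N) = N := by unfold lineIdx; split_ifs <;> omega
    exact .inr ⟨by simp [lowIdx, h1, h2], .inl ⟨rfl, by simp [line, h1, h2]⟩⟩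
  -- Edge `N` lies on the vertical line through the origin, which is both `right 0` and `left N 0`.
  -- By truncated subtraction its `lowIdx` is 0, and below the axis it serves as the left leg of
  -- arch 0.
  rcases eq_or_ne k N with rfl | hkN
  · have h1 : IsRight k k := by unfold IsRight; omega
    have h2 : lineIdx k k = 0 := by unfold lineIdx; split_ifs <;> omega
    have h3 : lowIdx k k = 0 := by simp [lowIdx, h1, h2]
    refine .inl ⟨by omega, .inr ⟨.inr rfl, ?_⟩⟩
    rw [h3]
    simp only [line, h1, h2, if_true]
    funext y
    rw [right_zero_left, left_zero_left hN]
  left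
  by_cases h : IsRight N k
  · have h1 : 1 ≤ lineIdx N k ∧ lineIdx N k ≤ N := by
      unfold IsRight at h
      unfold lineIdx
      split_ifs <;> omega
    have h2 : lowIdx N k = lineIdx N k - 1 := by simp [lowIdx, h]
    refine ⟨by omega, .inl ⟨h, hkN, ?_⟩⟩
    simp only [line, h, if_true]
    rw [h2, Nat.sub_add_cancel h1.1]
  · have h1 : lineIdx N k < N := by
      unfold IsRight at h
      unfold lineIdx
      split_ifs <;> omega
    have h2 : lowIdx N k = lineIdx N k := by simp [lowIdx, h, h0]
    exact ⟨by omega, .inr ⟨.inl h, by simp only [line, h, if_false]; rw [h2]⟩⟩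

end Spiral

/-! ### Edges as legs of arches -/

namespace Spiral

variable {N : ℕ} {H : ℝ}

/-- The part of the line that carries the `k`-th edge between its two ends. -/
def edge (N : ℕ) (H : ℝ) (k : ℕ) : Set Plane :=
  {z | z 0 = line N k (z 1) ∧ -depth N (lowIdx N k) ≤ z 1 ∧ z 1 ≤ height N H (upIdx N k)}

theorem upIdx_spec (N k : ℕ) : IsRight N k ∧ (k ≤ N ∧ upIdx N k = N - k ∨
    N < k ∧ upIdx N k = k - N) ∨ ¬ IsRight N k ∧ (k ≤ N ∧ upIdx N k = N - k - 1 ∨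
    N < k ∧ upIdx N k = k - N - 1) := by
  by_cases h : IsRight N k <;> simp only [h, upIdx, lineIdx, if_true, if_false] <;>
    split_ifs <;> simp <;> omega

theorem lowIdx_spec (N k : ℕ) : (IsRight N k ∨ k = 2 * N + 1) ∧ (k ≤ N ∧ lowIdx N k = N - k - 1 ∨
    N < k ∧ lowIdx N k = k - N - 1) ∨ ¬ (IsRight N k ∨ k = 2 * N + 1) ∧
    (k ≤ N ∧ lowIdx N k = N - k ∨ N < k ∧ lowIdx N k = k - N) := by
  by_cases h : IsRight N k ∨ k = 2 * N + 1 <;> simp only [h, lowIdx, lineIdx, if_true, if_false] <;>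
    split_ifs <;> simp <;> omega

/-- Both legs of an upper arch belong to consecutive edges, except that the top arch joins the first
edge and the last of the long edges. -/
theorem adjacent_of_upIdx_eq {j k : ℕ} (hjk : j < k) (hk : k ≤ 2 * N + 1)
    (h : upIdx N j = upIdx N k) : (IsRight N j ∧ ¬ IsRight N k ∨ ¬ IsRight N j ∧ IsRight N k) ∧
      (k % 2 = 0 ∧ k = j + 1 ∧ upIdx N k ≠ N ∨ j = 0 ∧ k = 2 * N + 1 ∧ upIdx N k = N) := by
  rcases upIdx_spec N j with ⟨h1, h2⟩ | ⟨h1, h2⟩ <;>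
    rcases upIdx_spec N k with ⟨h3, h4⟩ | ⟨h3, h4⟩ <;> unfold IsRight at * <;>
    rcases h2 with h2 | h2 <;> rcases h4 with h4 | h4 <;> omega

theorem adjacent_of_lowIdx_eq {j k : ℕ} (hjk : j < k) (hk : k ≤ 2 * N + 1)
    (h : lowIdx N j = lowIdx N k) : k % 2 = 1 ∧ k = j + 1 ∧
      (IsRight N j ∧ j ≠ N ∧ (¬ IsRight N k ∨ k = N) ∨
        (¬ IsRight N j ∨ j = N) ∧ IsRight N k ∧ k ≠ N ∨ j = 2 * N) := by
  rcases lowIdx_spec N j with ⟨h1, h2⟩ | ⟨h1, h2⟩ <;>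
    rcases lowIdx_spec N k with ⟨h3, h4⟩ | ⟨h3, h4⟩ <;> unfold IsRight at * <;>
    rcases h2 with h2 | h2 <;> rcases h4 with h4 | h4 <;> omega

theorem lowIdx_two_mul (hN : 1 ≤ N) : lowIdx N (2 * N) = N := by
  have := lowIdx_spec N (2 * N)
  unfold IsRight at *
  omega

theorem exists_line_eq (N k : ℕ) : ∃ a b : ℝ, 0 ≤ b ∧ ∀ y, line N k y = a + b * y := by
  unfold line
  split_ifs
  · exact ⟨intercept (lineIdx N k), lineIdx N k, by positivity, fun y => rfl⟩
  · exact ⟨-intercept (lineIdx N k), leftSlope N (lineIdx N k), leftSlope_nonneg _, fun y => rfl⟩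

theorem height_pos (hH : 0 < H) (s : ℕ) : 0 < height N H s := by
  unfold height
  split_ifs
  exacts [hH, apex_pos s]

/-- Upper vertices are defined by right legs. A left leg leads to the same point because both meet
at the apex; the truncated top arch does not occur here with its left leg. -/
theorem vertex_even (hN : 1 ≤ N) {k : ℕ} (hk : k ≤ 2 * N + 1) (h2 : k % 2 = 0) :
    vertex N H k = !₂[line N k (height N H (upIdx N k)), height N H (upIdx N k)] := by
  rw [vertex, if_neg (by omega), if_pos h2]
  obtain ⟨h1, ⟨-, h⟩ | ⟨h0, h⟩⟩ := line_eq_up hN hk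
  · rw [h]
  · have h3 : upIdx N k ≠ N := by
      have := upIdx_spec N k
      unfold IsRight at *
      omega
    rw [h, (left_eq_right h1 hN).2 (by rw [height, if_neg h3])]

theorem vertex_succ_odd (hN : 1 ≤ N) {k : ℕ} (hk : k ≤ 2 * N + 1) (h2 : k % 2 = 1) :
    vertex N H (k + 1) = !₂[line N k (height N H (upIdx N k)), height N H (upIdx N k)] := by
  rcases eq_or_ne k (2 * N + 1) with rfl | hk1
  · have h1 : ¬ IsRight N (2 * N + 1) := by unfold IsRight; omega
    have h3 : lineIdx N (2 * N + 1) = N + 1 := by unfold lineIdx; split_ifs <;> omega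
    have h4 : upIdx N (2 * N + 1) = N := by simp [upIdx, h1, h3]
    rw [vertex, if_pos rfl, h4, height, if_pos rfl, line, if_neg h1, h3]
  · have e : upIdx N (k + 1) = upIdx N k := by
      have := upIdx_spec N k
      have := upIdx_spec N (k + 1)
      unfold IsRight at *
      omega
    rw [vertex, if_neg (by omega), if_pos (by omega), e]
    obtain ⟨h1, ⟨-, h⟩ | ⟨h0, h⟩⟩ := line_eq_up hN hk
    · rw [h]
    · have h3 : upIdx N k ≠ N := by
        have := upIdx_spec N k
        unfold IsRight at *
        omega
      rw [h, (left_eq_right h1 hN).2 (by rw [height, if_neg h3])]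

theorem line_neg_depth (hN : 1 ≤ N) {k : ℕ} (hk : k ≤ 2 * N + 1) :
    line N k (-depth N (lowIdx N k)) = left N (lowIdx N k) (-depth N (lowIdx N k)) := by
  rcases line_eq_low hN hk with ⟨h1, ⟨-, -, h⟩ | ⟨-, h⟩⟩ | ⟨h1, ⟨-, h⟩ | ⟨-, h⟩⟩
  · rw [h, ← sub_eq_zero, right_sub_left' h1]; ring
  · rw [h]
  · rw [h, h1]
  · rw [h, h1, eq_comm, ← sub_eq_zero, left_sub_left]; ring

theorem vertex_odd (hN : 1 ≤ N) {k : ℕ} (hk : k ≤ 2 * N + 1) (h2 : k % 2 = 1) :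
    vertex N H k = !₂[line N k (-depth N (lowIdx N k)), -depth N (lowIdx N k)] := by
  rw [vertex, if_neg (by omega), if_neg (by omega), line_neg_depth hN hk]

theorem vertex_succ_even (hN : 1 ≤ N) {k : ℕ} (hk : k ≤ 2 * N + 1) (h2 : k % 2 = 0) :
    vertex N H (k + 1) = !₂[line N k (-depth N (lowIdx N k)), -depth N (lowIdx N k)] := by
  have e : lowIdx N (k + 1) = lowIdx N k := by
    have := lowIdx_spec N k
    have := lowIdx_spec N (k + 1)
    unfold IsRight at *
    omega
  rw [vertex, if_neg (by omega), if_neg (by omega), line_neg_depth hN hk, e]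

theorem segment_vertex (hN : 1 ≤ N) (hH : 0 < H) {k : ℕ} (hk : k ≤ 2 * N + 1) :
    segment ℝ (vertex N H k) (vertex N H (k + 1)) = edge N H k := by
  obtain ⟨a, b, -, hl⟩ := exists_line_eq N k
  have h1 := height_pos (N := N) hH (upIdx N k)
  have h2 := depth_pos (N := N) (lowIdx N k)
  ext z
  rcases Nat.mod_two_eq_zero_or_one k with h | h
  · rw [vertex_even hN hk h, vertex_succ_even hN hk h, segment_symm,
      mem_segment_graph_iff (hl _) (hl _) (by simp; linarith), ← hl]
    rfl
  · rw [vertex_odd hN hk h, vertex_succ_odd hN hk h,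
      mem_segment_graph_iff (hl _) (hl _) (by simp; linarith), ← hl]
    rfl

theorem vertex_mul_neg (hN : 1 ≤ N) (hH : 0 < H) {k : ℕ} (hk : k ≤ 2 * N + 1) :
    vertex N H k 1 * vertex N H (k + 1) 1 < 0 := by
  have h1 := height_pos (N := N) hH (upIdx N k)
  have h2 := depth_pos (N := N) (lowIdx N k)
  rcases Nat.mod_two_eq_zero_or_one k with h | h
  · rw [vertex_even hN hk h, vertex_succ_even hN hk h]
    simp; positivity
  · rw [vertex_odd hN hk h, vertex_succ_odd hN hk h]
    simp; positivity

theorem vertex_on_line (hN : 1 ≤ N) {k : ℕ} (hk : k ≤ 2 * N + 1) :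
    vertex N H k 0 = line N k (vertex N H k 1) ∧
      vertex N H (k + 1) 0 = line N k (vertex N H (k + 1) 1) := by
  rcases Nat.mod_two_eq_zero_or_one k with h | h
  · rw [vertex_even hN hk h, vertex_succ_even hN hk h]; exact ⟨rfl, rfl⟩
  · rw [vertex_odd hN hk h, vertex_succ_odd hN hk h]; exact ⟨rfl, rfl⟩

theorem vertex_zero (hN : 1 ≤ N) : vertex N H 0 = !₂[right N H, H] := by
  have h1 : IsRight N 0 := by unfold IsRight; omega
  simp [vertex, upIdx, h1, lineIdx, height]

theorem vertex_last : vertex N H (2 * N + 2) = !₂[left N (N + 1) H, H] := by simp [vertex]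

/-! ### Intersections of edges -/

/-- The top arch may thus be truncated at half its height and still rise above all others. -/
theorem two_mul_apex_lt (hN : 1 ≤ N) {s : ℕ} (hs : s < N) : apex N s < apex N N / 2 := by
  have h : ∀ s, s + 1 = N → apex N s < apex N N / 2 := by
    rintro s rfl
    have := intercept_nonneg s
    simp [apex, intercept_succ]
    linarith
  rcases (show s + 1 ≤ N from hs).eq_or_lt with h1 | h1
  · exact h s h1
  · exact (apex_lt_apex (show s < N - 1 by omega) (by omega)).trans (h _ (by omega))

variable (hN : 1 ≤ N) (hH : apex N N / 2 ≤ H) (hH' : H ≤ apex N N)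
include hN

section
include hH'

omit hN in
theorem height_le_apex (s : ℕ) : height N H s ≤ apex N s := by
  unfold height
  split_ifs with h
  exacts [h ▸ hH', le_rfl]

theorem edge_up {k : ℕ} (hk : k ≤ 2 * N + 1) {z : Plane} (hz : z ∈ edge N H k) :
    left N (upIdx N k + 1) (z 1) ≤ z 0 ∧ z 0 ≤ right (upIdx N k) (z 1) ∧
      z 1 ≤ apex N (upIdx N k) := by
  obtain ⟨h0, -, h2⟩ := hz
  have h3 := h2.trans (height_le_apex hH' _)
  obtain ⟨h4, ⟨-, h⟩ | ⟨-, h⟩⟩ := line_eq_up hN hk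
  · rw [h0, h]
    exact ⟨(left_le_right h4 hN).2 h3, le_rfl, h3⟩
  · rw [h0, h]
    exact ⟨le_rfl, (left_le_right h4 hN).2 h3, h3⟩

/-- At any height that the smaller of two arches reaches, the legs of the larger one are strictly
outside it. -/
theorem upIdx_eq {j k : ℕ} (hj : j ≤ 2 * N + 1) (hk : k ≤ 2 * N + 1) {z : Plane}
    (hzj : z ∈ edge N H j) (hzk : z ∈ edge N H k) (hz : 0 ≤ z 1) : upIdx N j = upIdx N k := by
  have key : ∀ {j k : ℕ}, j ≤ 2 * N + 1 → k ≤ 2 * N + 1 → z ∈ edge N H j → z ∈ edge N H k →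
      ¬ upIdx N j < upIdx N k := by
    intro j k hj hk hzj hzk h
    obtain ⟨h1, h2, h3⟩ := edge_up hN hH' hj hzj
    obtain ⟨h4, h5, -⟩ := edge_up hN hH' hk hzk
    obtain ⟨h0, h6 | h6⟩ := line_eq_up hN hk
    · have := right_lt_right h hz
      rw [hzk.1, h6.2] at h2
      linarith
    · have := left_lt_left h h0 hz h3
      rw [hzk.1, h6.2] at h1
      linarith
  exact le_antisymm (not_lt.1 (key hk hj hzk hzj)) (not_lt.1 (key hj hk hzj hzk))

end

theorem edge_low {k : ℕ} (hk : k ≤ 2 * N + 1) {z : Plane} (hz : z ∈ edge N H k) :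
    lowIdx N k < N ∧ left N (lowIdx N k) (z 1) ≤ z 0 ∧ z 0 ≤ right (lowIdx N k + 1) (z 1) ∨
      lowIdx N k = N ∧ left N (N + 1) (z 1) ≤ z 0 ∧ z 0 ≤ left N N (z 1) := by
  obtain ⟨h0, h1, -⟩ := hz
  rcases line_eq_low hN hk with ⟨h2, h⟩ | ⟨h2, h⟩
  · have := right_sub_left' h2 (z 1)
    rcases h with ⟨-, -, h⟩ | ⟨-, h⟩
    · rw [h0, h]; exact .inl ⟨h2, by linarith, le_rfl⟩
    · rw [h0, h]; exact .inl ⟨h2, le_rfl, by linarith⟩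
  · have := left_sub_left (N := N) (z 1)
    rw [h2] at h1
    rcases h with ⟨-, h⟩ | ⟨-, h⟩
    · rw [h0, h]; exact .inr ⟨h2, by linarith, le_rfl⟩
    · rw [h0, h]; exact .inr ⟨h2, le_rfl, by linarith⟩

theorem lowIdx_eq {j k : ℕ} (hj : j ≤ 2 * N + 1) (hk : k ≤ 2 * N + 1) {z : Plane}
    (hzj : z ∈ edge N H j) (hzk : z ∈ edge N H k) (hz : z 1 ≤ 0) : lowIdx N j = lowIdx N k := by
  have key : ∀ {j k : ℕ}, j ≤ 2 * N + 1 → k ≤ 2 * N + 1 → z ∈ edge N H j → z ∈ edge N H k →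
      ¬ lowIdx N j < lowIdx N k := by
    intro j k hj hk hzj hzk h
    rcases edge_low hN hj hzj with ⟨h1, h2, h3⟩ | ⟨h1, h2, h3⟩
    · rcases line_eq_low hN hk with ⟨h4, ⟨-, -, h5⟩ | ⟨-, h5⟩⟩ | ⟨h4, h5⟩
      · have := right_lt_right' h h4 hzj.2.1
        rw [hzk.1, h5] at h3
        linarith
      · have := left_lt_left' h h4.le hz
        rw [hzk.1, h5] at h2
        linarith
      · have := left_lt_left' (h.trans_eq h4) le_rfl hz
        rcases edge_low hN hk hzk with ⟨h6, h7, h8⟩ | ⟨h6, h7, h8⟩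
        · omega
        · linarith
    · rcases edge_low hN hk hzk with ⟨h6, -⟩ | ⟨h6, -⟩ <;> omega
  exact le_antisymm (not_lt.1 (key hk hj hzk hzj)) (not_lt.1 (key hj hk hzj hzk))

include hH'

/-- By nesting, a common point lies on both legs of one arch, hence at its apex or lowest point. The
second alternative is the top arch, whose legs meet only when it is not truncated. -/
theorem edge_inter {j k : ℕ} (hjk : j < k) (hk : k ≤ 2 * N + 1) {z : Plane}
    (hzj : z ∈ edge N H j) (hzk : z ∈ edge N H k) :
    k = j + 1 ∧ z = vertex N H k ∨
      j = 0 ∧ k = 2 * N + 1 ∧ z = vertex N H 0 ∧ H = apex N N := by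
  have hj : j ≤ 2 * N + 1 := by omega
  rcases le_total 0 (z 1) with h0 | h0
  · have hu := upIdx_eq hN hH' hj hk hzj hzk h0
    obtain ⟨h1, h2⟩ := line_eq_up hN hj
    obtain ⟨h3, h4⟩ := line_eq_up hN hk
    have hcase := adjacent_of_upIdx_eq hjk hk hu
    have hap : z 1 = apex N (upIdx N k) := by
      rw [← left_eq_right h3 hN]
      rcases h2 with ⟨h5, h6⟩ | ⟨h5, h6⟩ <;> rcases h4 with ⟨h7, h8⟩ | ⟨h7, h8⟩
      · tauto
      · rw [← h8, ← hu, ← h6, ← hzj.1, ← hzk.1]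
      · rw [← h8, ← hu, ← h6, ← hzj.1, ← hzk.1]
      · tauto
    rcases hcase.2 with ⟨h5, h6, h7⟩ | ⟨rfl, rfl, h7⟩
    · left
      refine ⟨h6, ?_⟩
      rw [vertex_even hN hk h5, height, if_neg h7, ← hap]
      exact plane_ext hzk.1 rfl
    · right
      have h8 := hzk.2.2
      rw [h7] at hap h8
      rw [height, if_pos rfl, hap] at h8
      have h9 : H = apex N N := le_antisymm hH' h8
      refine ⟨rfl, rfl, ?_, h9⟩
      rw [vertex_even hN (by omega) rfl, hu, h7, height, if_pos rfl, h9, ← hap]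
      exact plane_ext hzj.1 rfl
  · have hu := lowIdx_eq hN hj hk hzj hzk h0
    have h2 := line_eq_low hN hj
    have h4 := line_eq_low hN hk
    obtain ⟨h5, h6, h7⟩ := adjacent_of_lowIdx_eq hjk hk hu
    have hdep : z 1 = -depth N (lowIdx N k) := by
      have ej := hzj.1
      have ek := hzk.1
      rcases h2 with ⟨h8, h9⟩ | ⟨h8, h9⟩
      · have h10 := right_sub_left' h8 (z 1)
        have hj2 : j ≠ 2 * N := by
          rintro rfl
          exact h8.ne (lowIdx_two_mul hN)
        rcases h4 with ⟨h11, h12⟩ | ⟨h11, -⟩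
        · rw [hu] at h9 h10
          rcases h9 with ⟨h13, h14, h15⟩ | ⟨h13, h15⟩ <;>
            rcases h12 with ⟨h16, h17, h18⟩ | ⟨h16, h18⟩
          · tauto
          · rw [h15] at ej; rw [h18] at ek; linarith
          · rw [h15] at ej; rw [h18] at ek; linarith
          · tauto
        · omega
      · rcases h4 with ⟨h11, h12⟩ | ⟨h11, h12⟩
        · omega
        · have h10 := left_sub_left (N := N) (z 1)
          rw [h11]
          rcases h9 with ⟨h13, h15⟩ | ⟨h13, h15⟩ <;> rcases h12 with ⟨h16, h18⟩ | ⟨h16, h18⟩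
          · omega
          · rw [h15] at ej; rw [h18] at ek; linarith
          · omega
          · omega
    left
    refine ⟨h6, ?_⟩
    rw [vertex_odd hN hk h5, ← hdep]
    exact plane_ext hzk.1 rfl

include hH
omit hH'

theorem edge_top {k : ℕ} (hk : k ≤ 2 * N + 1) {z : Plane} (hz : z ∈ edge N H k) (hz1 : z 1 = H) :
    k = 0 ∧ z = vertex N H 0 ∨ k = 2 * N + 1 ∧ z = vertex N H (2 * N + 2) := by
  obtain ⟨h1, h2⟩ := line_eq_up hN hk
  have h3 : upIdx N k = N := by
    by_contra h
    have h4 := hz.2.2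
    rw [height, if_neg h, hz1] at h4
    have := two_mul_apex_lt hN (lt_of_le_of_ne h1 h)
    linarith
  have h4 : k = 0 ∨ k = 2 * N + 1 := by
    clear h2
    have := upIdx_spec N k
    unfold IsRight at *
    omega
  refine h4.imp (fun h4 => ⟨h4, ?_⟩) fun h4 => ⟨h4, ?_⟩
  · subst h4
    rw [vertex_even hN hk rfl, h3, height, if_pos rfl]
    exact plane_ext (by rw [hz.1, hz1]; rfl) hz1
  · subst h4
    rw [vertex_succ_odd hN hk (by omega), h3, height, if_pos rfl]
    exact plane_ext (by rw [hz.1, hz1]; rfl) hz1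

/-- Each leg of an arch is part of an edge. The parity of N - s tells whether this edge belongs to
the inward arm, k ≤ N, or to the outward one. -/
theorem barrier_of {B : Set Plane} (hE : ∀ k ≤ 2 * N + 1, edge N H k ⊆ B)
    (htop : ∀ z : Plane, z 1 = H → left N (N + 1) H ≤ z 0 → z 0 ≤ right N H → z ∈ B) :
    Barrier N H B := by
  have hHpos : 0 < H := lt_of_lt_of_le (half_pos (apex_pos N)) hH
  refine ⟨hN, hHpos, ?_, ?_, ?_⟩
  · intro s hs z hz hzH hl hr h
    have hle := (left_le_right hs hN).1 (hl.trans hr)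
    have hmem : ∀ k ≤ 2 * N + 1, upIdx N k = s → z 0 = line N k (z 1) → z ∈ B := by
      intro k hk hks h0
      refine hE k hk ⟨h0, ?_, ?_⟩
      · linarith [depth_pos (N := N) (lowIdx N k)]
      · rw [hks, height]
        split_ifs
        exacts [hzH, hle]
    rcases h with h | h | h
    · obtain ⟨k, hk, hks, hkr⟩ : ∃ k ≤ 2 * N + 1, upIdx N k = s ∧ ¬ IsRight N k := by
        by_cases hc : s < N ∧ (N - s) % 2 = 0
        · have := upIdx_spec N (N - s - 1)
          refine ⟨N - s - 1, ?_⟩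
          unfold IsRight at *
          omega
        · have := upIdx_spec N (N + s + 1)
          refine ⟨N + s + 1, ?_⟩
          unfold IsRight at *
          omega
      refine hmem k hk hks ?_
      rcases line_eq_up hN hk with ⟨-, ⟨h1, -⟩ | ⟨-, h1⟩⟩
      · exact absurd h1 hkr
      · rw [h1, hks, h]
    · obtain ⟨k, hk, hks, hkr⟩ : ∃ k ≤ 2 * N + 1, upIdx N k = s ∧ IsRight N k := by
        by_cases hc : (N - s) % 2 = 0
        · have := upIdx_spec N (N - s)
          refine ⟨N - s, ?_⟩
          unfold IsRight at *
          omega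
        · have := upIdx_spec N (N + s)
          refine ⟨N + s, ?_⟩
          unfold IsRight at *
          omega
      refine hmem k hk hks ?_
      rcases line_eq_up hN hk with ⟨-, ⟨-, h1⟩ | ⟨h1, -⟩⟩
      · rw [h1, hks, h]
      · exact absurd hkr h1
    · obtain rfl : s = N := by
        by_contra hne
        have := two_mul_apex_lt hN (lt_of_le_of_ne hs hne)
        linarith
      rw [h] at hl hr
      exact htop z h hl hr
  · intro s hs z hz hl hr h
    have h3 := right_sub_left' hs (z 1)
    have hmem : ∀ k ≤ 2 * N + 1, lowIdx N k = s → z 0 = line N k (z 1) → z ∈ B := by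
      intro k hk hks h0
      refine hE k hk ⟨h0, ?_, ?_⟩
      · rw [hks]; linarith
      · linarith [height_pos (N := N) hHpos (upIdx N k)]
    rcases h with h | h
    · obtain ⟨k, hk, hks, hkr⟩ : ∃ k ≤ 2 * N + 1, lowIdx N k = s ∧ (¬ IsRight N k ∨ k = N) := by
        by_cases hc : (N - s) % 2 = 1
        · have := lowIdx_spec N (N - s)
          refine ⟨N - s, ?_⟩
          unfold IsRight at *
          omega
        · have := lowIdx_spec N (N + s)
          refine ⟨N + s, ?_⟩
          unfold IsRight at *
          omega
      refine hmem k hk hks ?_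
      rcases line_eq_low hN hk with ⟨-, ⟨h1, h2, -⟩ | ⟨-, h1⟩⟩ | ⟨h1, -⟩
      · tauto
      · rw [h1, hks, h]
      · omega
    · obtain ⟨k, hk, hks, hkr, hkN⟩ :
          ∃ k ≤ 2 * N + 1, lowIdx N k = s ∧ IsRight N k ∧ k ≠ N := by
        by_cases hc : (N - s - 1) % 2 = 0
        · have := lowIdx_spec N (N - s - 1)
          refine ⟨N - s - 1, ?_⟩
          unfold IsRight at *
          omega
        · have := lowIdx_spec N (N + s + 1)
          refine ⟨N + s + 1, ?_⟩
          unfold IsRight at *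
          omega
      refine hmem k hk hks ?_
      rcases line_eq_low hN hk with ⟨-, ⟨-, -, h1⟩ | ⟨h1, -⟩⟩ | ⟨h1, -⟩
      · rw [h1, hks, h]
      · tauto
      · omega
  · intro z hz hl hr h
    have h3 := left_sub_left (N := N) (z 1)
    have hmem : ∀ k ≤ 2 * N + 1, lowIdx N k = N → z 0 = line N k (z 1) → z ∈ B := by
      intro k hk hks h0
      refine hE k hk ⟨h0, ?_, ?_⟩
      · rw [hks]; linarith
      · linarith [height_pos (N := N) hHpos (upIdx N k)]
    have h5 : lowIdx N (2 * N + 1) = N := by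
      have := lowIdx_spec N (2 * N + 1)
      unfold IsRight at *
      omega
    rcases h with h | h
    · refine hmem (2 * N + 1) le_rfl h5 ?_
      rcases line_eq_low hN (k := 2 * N + 1) le_rfl with ⟨h1, -⟩ | ⟨-, ⟨h1, -⟩ | ⟨-, h1⟩⟩
      · omega
      · omega
      · rw [h1, h]
    · refine hmem (2 * N) (by omega) (lowIdx_two_mul hN) ?_
      rcases line_eq_low hN (k := 2 * N) (by omega) with ⟨h1, -⟩ | ⟨-, ⟨-, h1⟩ | ⟨h1, -⟩⟩
      · exact absurd (lowIdx_two_mul hN) h1.ne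
      · rw [h1, h]
      · omega

end Spiral

/-! ### The extremal polygons -/

namespace Spiral

variable {N : ℕ} {H : ℝ} {n : ℕ}

/-- The polygon with the first `n` vertices of the double spiral. -/
noncomputable def polygon (N : ℕ) (H : ℝ) (n : ℕ) : Polygon Plane n := ⟨fun i => vertex N H i⟩

/-- Without truncation the spiral closes up after 2N + 2 edges. For smaller `H` the horizontal edge
back to the first vertex is added, which gives 2N + 3. -/
theorem vertex_last_eq (hN : 1 ≤ N) : vertex N (apex N N) (2 * N + 2) = vertex N (apex N N) 0 := by
  rw [vertex_last, vertex_zero hN, (left_eq_right le_rfl hN).2 rfl]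

theorem vertices_finRotate (hN : 1 ≤ N) (hn : n = 2 * N + 2 ∧ H = apex N N ∨ n = 2 * N + 3)
    (i : Fin n) (hi : (i : ℕ) ≤ 2 * N + 1) :
    (polygon N H n).vertices (finRotate n i) = vertex N H (i + 1) := by
  change vertex N H (finRotate n i : ℕ) = _
  rw [val_finRotate]
  rcases hn with ⟨rfl, rfl⟩ | rfl
  · rcases hi.lt_or_eq with h | h
    · rw [Nat.mod_eq_of_lt (by omega)]
    · rw [h, Nat.mod_self, vertex_last_eq hN]
  · rw [Nat.mod_eq_of_lt (by omega)]

theorem edgeSet_polygon (hN : 1 ≤ N) (hH : 0 < H)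
    (hn : n = 2 * N + 2 ∧ H = apex N N ∨ n = 2 * N + 3) (i : Fin n) (hi : (i : ℕ) ≤ 2 * N + 1) :
    (polygon N H n).edgeSet ℝ i = edge N H i := by
  rw [Polygon.edgeSet_eq_segment, vertices_finRotate hN hn i hi, ← segment_vertex hN hH hi]
  rfl

theorem edgeSet_polygon_last (hN : 1 ≤ N) (hH : H ≤ apex N N) {z : Plane} :
    z ∈ (polygon N H (2 * N + 3)).edgeSet ℝ (Fin.last _) ↔
      z 1 = H ∧ left N (N + 1) H ≤ z 0 ∧ z 0 ≤ right N H := by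
  have h1 : (polygon N H (2 * N + 3)).vertices (finRotate _ (Fin.last _)) = vertex N H 0 := by
    change vertex N H (finRotate _ (Fin.last _) : ℕ) = _
    rw [val_finRotate, Fin.val_last, Nat.mod_self]
  have h2 : (polygon N H (2 * N + 3)).vertices (Fin.last _) = vertex N H (2 * N + 2) := rfl
  have hle := (left_le_right le_rfl hN).2 hH
  rw [Polygon.edgeSet_eq_segment, h1, h2, vertex_last, vertex_zero hN, mem_segment_iff_add_smul]
  constructor
  · rintro ⟨t, h0, h1, rfl⟩
    simp
    constructor <;> nlinarith
  · rintro ⟨h0, h1, h2⟩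
    rcases hle.eq_or_lt with h | h
    · exact ⟨0, le_rfl, zero_le_one, plane_ext (by simp; linarith) (by simpa using h0)⟩
    · have hpos := sub_pos.2 h
      refine ⟨(z 0 - left N (N + 1) H) / (right N H - left N (N + 1) H),
        div_nonneg (by linarith) hpos.le, (div_le_one hpos).2 (by linarith),
        plane_ext ?_ (by simpa using h0)⟩
      simp
      field_simp
      ring

variable (hN : 1 ≤ N)
include hN

theorem vertex_ne_vertex_succ (hH : 0 < H) {k : ℕ} (hk : k ≤ 2 * N + 1) :
    vertex N H k ≠ vertex N H (k + 1) := by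
  intro h
  have := vertex_mul_neg hN hH hk
  rw [h] at this
  nlinarith [mul_self_nonneg (vertex N H (k + 1) 1)]

theorem isSimpleClosed_even : (polygon N (apex N N) (2 * N + 2)).IsSimpleClosed := by
  have hpos := apex_pos (N := N) N
  have hn : 2 * N + 2 = 2 * N + 2 ∧ apex N N = apex N N ∨ 2 * N + 2 = 2 * N + 3 := .inl ⟨rfl, rfl⟩
  refine Polygon.isSimpleClosed_of (by omega) (fun i j hij z hi hj => ?_) fun i => ?_
  · rw [edgeSet_polygon hN hpos hn _ (by omega)] at hi hj
    rcases edge_inter hN le_rfl (show (i : ℕ) < j from hij) (by omega) hi hj with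
      ⟨h1, h2⟩ | ⟨h1, h2, h3, -⟩
    · refine .inl ⟨Fin.ext ?_, h2⟩
      rw [val_finRotate, Nat.mod_eq_of_lt (by omega), h1]
    · refine .inr ⟨Fin.ext ?_, by rw [h3, ← h1]; rfl⟩
      rw [val_finRotate, h2, h1, Nat.mod_self]
  · rw [vertices_finRotate hN hn i (by omega)]
    exact vertex_ne_vertex_succ hN hpos (by omega)

theorem isSimpleClosed_odd : (polygon N (apex N N / 2) (2 * N + 3)).IsSimpleClosed := by
  have hpos := half_pos (apex_pos (N := N) N)
  have hlt := half_lt_self (apex_pos (N := N) N)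
  set H := apex N N / 2 with hHdef
  have hn : 2 * N + 3 = 2 * N + 2 ∧ H = apex N N ∨ 2 * N + 3 = 2 * N + 3 := .inr rfl
  have hlast : ∀ i : Fin (2 * N + 3), ¬ (i : ℕ) ≤ 2 * N + 1 → i = Fin.last _ :=
    fun i hi => Fin.ext (by rw [Fin.val_last]; omega)
  have hrot : (finRotate (2 * N + 3) (Fin.last _) : ℕ) = 0 := by
    rw [val_finRotate, Fin.val_last, Nat.mod_self]
  refine Polygon.isSimpleClosed_of (by omega) (fun i j hij z hi hj => ?_) fun i => ?_
  · have hij' : (i : ℕ) < j := hij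
    rw [edgeSet_polygon hN hpos hn _ (by omega)] at hi
    by_cases hj1 : (j : ℕ) ≤ 2 * N + 1
    · rw [edgeSet_polygon hN hpos hn _ hj1] at hj
      rcases edge_inter hN hlt.le hij' hj1 hi hj with ⟨h1, h2⟩ | ⟨-, -, -, h⟩
      · refine .inl ⟨Fin.ext ?_, h2⟩
        rw [val_finRotate, Nat.mod_eq_of_lt (by omega), h1]
      · exact absurd h hlt.ne
    · obtain rfl := hlast j hj1
      rw [edgeSet_polygon_last hN hlt.le] at hj
      rcases edge_top hN hHdef.ge (by omega) hi hj.1 with ⟨h1, h2⟩ | ⟨h1, h2⟩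
      · refine .inr ⟨Fin.ext (by rw [hrot, h1]), by rw [h2, ← h1]; rfl⟩
      · refine .inl ⟨Fin.ext ?_, h2⟩
        rw [val_finRotate, h1, Nat.mod_eq_of_lt (by omega), Fin.val_last]
  · by_cases hi : (i : ℕ) ≤ 2 * N + 1
    · rw [vertices_finRotate hN hn i hi]
      exact vertex_ne_vertex_succ hN hpos hi
    · obtain rfl := hlast i hi
      change vertex N H (Fin.last (2 * N + 2) : ℕ) ≠ vertex N H (finRotate (2 * N + 3) (Fin.last _) : ℕ)
      rw [hrot, Fin.val_last, vertex_last, vertex_zero hN]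
      intro h
      have h0 := congrArg (fun z : Plane => z 0) h
      exact hlt.ne ((left_eq_right le_rfl hN).1 h0)

theorem poldiam_polygon
    (hn : n = 2 * N + 2 ∧ H = apex N N ∨ n = 2 * N + 3) (hP : (polygon N H n).IsSimpleClosed)
    (hB : Barrier N H ((polygon N H n).boundary ℝ)) :
    ((N + 1 : ℕ) : ℕ∞) ≤ poldiam (polygon N H n).int ∧
      ((N + 1 : ℕ) : ℕ∞) ≤ poldiam (polygon N H n).ext ∧
      ∃ x ∈ (polygon N H n).ext, level N H x = 0 := by
  have hpos := hB.pos
  obtain ⟨a, b, hb, hab⟩ := exists_line_eq N N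
  obtain ⟨c, d, hd, hcd⟩ := exists_line_eq N (2 * N + 1)
  have key : ∀ k (hk : k ≤ 2 * N + 1), ∃ i : Fin n, (polygon N H n).vertices i = vertex N H k ∧
      (polygon N H n).vertices (finRotate n i) = vertex N H (k + 1) := fun k hk =>
    ⟨⟨k, by omega⟩, rfl, vertices_finRotate hN hn _ hk⟩
  obtain ⟨i, hi, hi'⟩ := key N (by omega)
  obtain ⟨j, hj, hj'⟩ := key (2 * N + 1) le_rfl
  have li := vertex_on_line (H := H) hN (show N ≤ 2 * N + 1 by omega)
  have lj := vertex_on_line (H := H) hN (show 2 * N + 1 ≤ 2 * N + 1 from le_rfl)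
  refine hB.poldiam_bounds (by omega) hP (i := i) (j := j) (a := a) (c := c) hb hd ?_ ?_ ?_ ?_ ?_ ?_ ?_ ?_
  · have h1 : IsRight N N := by unfold IsRight; omega
    have h2 := hab 0
    simp [line, h1, lineIdx, right_zero_left] at h2
    exact h2.symm
  · have h1 : ¬ IsRight N (2 * N + 1) := by unfold IsRight; omega
    have h2 := hcd 0
    have h3 : lineIdx N (2 * N + 1) = N + 1 := by unfold lineIdx; split_ifs <;> omega
    rw [line, if_neg h1, h3, left_zero_right] at h2
    linarith
  · rw [hi, ← hab, li.1]
  · rw [hi', ← hab, li.2]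
  · rw [hi, hi']; exact vertex_mul_neg hN hpos (by omega)
  · rw [hj, ← hcd, lj.1]
  · rw [hj', ← hcd, lj.2]
  · rw [hj, hj']; exact vertex_mul_neg hN hpos le_rfl

theorem edge_subset_boundary (hH : 0 < H) (hn : n = 2 * N + 2 ∧ H = apex N N ∨ n = 2 * N + 3)
    {k : ℕ} (hk : k ≤ 2 * N + 1) : edge N H k ⊆ (polygon N H n).boundary ℝ :=
  (edgeSet_polygon hN hH hn ⟨k, by omega⟩ hk).ge.trans (Polygon.edgeSet_subset_boundary _)

theorem poldiam_even :
    ((N + 1 : ℕ) : ℕ∞) ≤ poldiam (polygon N (apex N N) (2 * N + 2)).int ∧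
      ((N + 1 : ℕ) : ℕ∞) ≤ poldiam (polygon N (apex N N) (2 * N + 2)).ext := by
  have hpos := apex_pos (N := N) N
  have hn : 2 * N + 2 = 2 * N + 2 ∧ apex N N = apex N N ∨ 2 * N + 2 = 2 * N + 3 := .inl ⟨rfl, rfl⟩
  have h := poldiam_polygon hN hn (isSimpleClosed_even hN) ?_
  · exact ⟨h.1, h.2.1⟩
  refine barrier_of hN (half_le_self hpos.le) (fun k hk => edge_subset_boundary hN hpos hn hk)
    -- Here the top edge shrinks to the apex, which is the first vertex.
    fun z h1 h2 h3 => edge_subset_boundary hN hpos hn (Nat.zero_le _) ?_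
  rw [← segment_vertex hN hpos (Nat.zero_le _)]
  convert left_mem_segment ℝ _ _
  rw [vertex_zero hN]
  have := (left_eq_right le_rfl hN).2 (rfl : apex N N = apex N N)
  exact plane_ext (le_antisymm h3 (this ▸ h2)) h1

theorem poldiam_odd :
    ((N + 1 : ℕ) : ℕ∞) ≤ poldiam (polygon N (apex N N / 2) (2 * N + 3)).int ∧
      ((N + 2 : ℕ) : ℕ∞) ≤ poldiam (polygon N (apex N N / 2) (2 * N + 3)).ext := by
  have hpos := half_pos (apex_pos (N := N) N)
  have hlt := half_lt_self (apex_pos (N := N) N)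
  have hn : 2 * N + 3 = 2 * N + 2 ∧ apex N N / 2 = apex N N ∨ 2 * N + 3 = 2 * N + 3 := .inr rfl
  have hB : Barrier N (apex N N / 2) ((polygon N (apex N N / 2) (2 * N + 3)).boundary ℝ) :=
    barrier_of hN le_rfl (fun k hk => edge_subset_boundary hN hpos hn hk) fun z h1 h2 h3 =>
      Polygon.edgeSet_subset_boundary _ ((edgeSet_polygon_last hN hlt.le).2 ⟨h1, h2, h3⟩)
  obtain ⟨h1, -, x, hx, hx0⟩ := poldiam_polygon hN hn (isSimpleClosed_odd hN) hB
  refine ⟨h1, ?_⟩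
  obtain ⟨m, ε, hε, h⟩ := hB.exists_add_two_le rfl
  -- The point above the top edge is exterior because the whole polygon lies at heights at most
  -- `apex N N / 2`.
  refine le_poldiam (IsFree.mem_ext (by omega) ⟨!₂[0, 1], fun p hp => ?_⟩) hx
    fun l hl => h x l hx0 (hl.subset Polygon.ext_subset)
  have hp1 : p 1 ≤ apex N N / 2 := by
    obtain ⟨i, hi⟩ := Polygon.mem_boundary_iff.1 hp
    by_cases hi1 : (i : ℕ) ≤ 2 * N + 1
    · rw [edgeSet_polygon hN hpos hn i hi1] at hi
      refine hi.2.2.trans ?_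
      unfold height
      split_ifs with h2
      · exact le_rfl
      · exact (two_mul_apex_lt hN (lt_of_le_of_ne (line_eq_up hN hi1).1 h2)).le
    · obtain rfl : i = Fin.last _ := Fin.ext (by rw [Fin.val_last]; omega)
      exact ((edgeSet_polygon_last hN hlt.le).1 hi).1.le
  simp [dt]
  linarith

end Spiral

/-! ### Triangles -/

/-- A triangle. -/
noncomputable def standardTriangle : Polygon Plane 3 := ⟨![!₂[0, 0], !₂[1, 0], !₂[0, 1]]⟩

namespace standardTriangle

theorem mem_edgeSet_zero {z : Plane} (h : z ∈ standardTriangle.edgeSet ℝ 0) :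
    0 ≤ z 0 ∧ z 0 ≤ 1 ∧ z 1 = 0 := by
  obtain ⟨t, ⟨h0, h1⟩, rfl⟩ := Polygon.mem_edgeSet_iff.1 h
  change 0 ≤ (!₂[0, 0] + t • (!₂[1, 0] - !₂[0, 0]) : Plane) 0 ∧
    (!₂[0, 0] + t • (!₂[1, 0] - !₂[0, 0]) : Plane) 0 ≤ 1 ∧
    (!₂[0, 0] + t • (!₂[1, 0] - !₂[0, 0]) : Plane) 1 = 0
  simp [h0, h1]

theorem mem_edgeSet_one {z : Plane} (h : z ∈ standardTriangle.edgeSet ℝ 1) :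
    0 ≤ z 0 ∧ 0 ≤ z 1 ∧ z 0 + z 1 = 1 := by
  obtain ⟨t, ⟨h0, h1⟩, rfl⟩ := Polygon.mem_edgeSet_iff.1 h
  change 0 ≤ (!₂[1, 0] + t • (!₂[0, 1] - !₂[1, 0]) : Plane) 0 ∧
    0 ≤ (!₂[1, 0] + t • (!₂[0, 1] - !₂[1, 0]) : Plane) 1 ∧
    (!₂[1, 0] + t • (!₂[0, 1] - !₂[1, 0]) : Plane) 0 +
    (!₂[1, 0] + t • (!₂[0, 1] - !₂[1, 0]) : Plane) 1 = 1
  simp [h0, h1]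

theorem mem_edgeSet_two {z : Plane} (h : z ∈ standardTriangle.edgeSet ℝ 2) :
    z 0 = 0 ∧ 0 ≤ z 1 ∧ z 1 ≤ 1 := by
  obtain ⟨t, ⟨h0, h1⟩, rfl⟩ := Polygon.mem_edgeSet_iff.1 h
  change (!₂[0, 1] + t • (!₂[0, 0] - !₂[0, 1]) : Plane) 0 = 0 ∧
    0 ≤ (!₂[0, 1] + t • (!₂[0, 0] - !₂[0, 1]) : Plane) 1 ∧
    (!₂[0, 1] + t • (!₂[0, 0] - !₂[0, 1]) : Plane) 1 ≤ 1
  simp [h0, h1]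

theorem isSimpleClosed : standardTriangle.IsSimpleClosed := by
  refine Polygon.isSimpleClosed_of le_rfl (fun i j hij z hi hj => ?_) fun i => ?_
  · fin_cases i <;> fin_cases j <;> first | exact absurd hij (by decide) | skip
    · have h1 := mem_edgeSet_zero hi
      have h2 := mem_edgeSet_one hj
      exact .inl ⟨rfl, plane_ext (show z 0 = 1 by linarith) (show z 1 = 0 by linarith)⟩
    · have h1 := mem_edgeSet_zero hi
      have h2 := mem_edgeSet_two hj
      exact .inr ⟨rfl, plane_ext (show z 0 = 0 by linarith) (show z 1 = 0 by linarith)⟩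
    · have h1 := mem_edgeSet_one hi
      have h2 := mem_edgeSet_two hj
      exact .inl ⟨rfl, plane_ext (show z 0 = 0 by linarith) (show z 1 = 1 by linarith)⟩
  · intro h
    have h0 := congrArg (fun z : Plane => z 0) h
    have h1 := congrArg (fun z : Plane => z 1) h
    fin_cases i
    · exact zero_ne_one (α := ℝ) h0
    · exact one_ne_zero (α := ℝ) h0
    · exact one_ne_zero (α := ℝ) h1

theorem one_le_poldiam_int : ((1 : ℕ) : ℕ∞) ≤ poldiam standardTriangle.int := by
  have hcr : cr (standardTriangle.vertices (finRotate 3 0) - standardTriangle.vertices 0)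
      !₂[0, 1] ≠ 0 := by
    change cr ((!₂[1, 0] : Plane) - !₂[0, 0]) !₂[0, 1] ≠ 0
    simp [cr]
  set z := standardTriangle.vertices 0 +
    (1 / 2 : ℝ) • (standardTriangle.vertices (finRotate 3 0) - standardTriangle.vertices 0)
  have hev := Polygon.eventually_mem_int_ext isSimpleClosed le_rfl 0 (z := z) (by norm_num)
    (by norm_num) rfl hcr
  obtain ⟨ε, h1, hε⟩ := (hev.and self_mem_nhdsWithin).exists
  have hε : 0 < ε := hε
  -- The second distance is smaller than the first, so the two interior points differ no matter on
  -- which side of the edge each of them lies.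
  obtain ⟨δ, h2, hδ⟩ := (hev.and (Ioo_mem_nhdsGT hε)).exists
  obtain ⟨x, hx, y, hy, hxy⟩ : ∃ x ∈ standardTriangle.int, ∃ y ∈ standardTriangle.int, x ≠ y := by
    have hne : ∀ {s t : ℝ}, s ≠ t →
        z + s • (!₂[0, 1] : Plane) ≠ z + t • (!₂[0, 1] : Plane) := by
      intro s t hst h
      have := congrArg (fun z : Plane => z 1) h
      simp at this
      exact hst this
    simp only [sub_eq_add_neg, ← neg_smul] at h1 h2
    rcases h1 with ⟨h1, -⟩ | ⟨-, h1⟩ <;> rcases h2 with ⟨h2, -⟩ | ⟨-, h2⟩ <;>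
      exact ⟨_, h1, _, h2, hne (by
        first
        | exact ne_of_gt (by linarith [hδ.1, hδ.2])
        | exact ne_of_lt (by linarith [hδ.1, hδ.2]))⟩
  refine le_poldiam hx hy fun l hl => ?_
  rcases l with _ | l
  · exact absurd (Linked.zero_iff.1 hl) hxy
  · omega

theorem nonneg {z : Plane} (h : z ∈ standardTriangle.boundary ℝ) : 0 ≤ z 1 ∧ z 1 ≤ 1 := by
  obtain ⟨i, hi⟩ := Polygon.mem_boundary_iff.1 h
  fin_cases i
  · have := mem_edgeSet_zero hi
    constructor <;> linarith
  · have := mem_edgeSet_one hi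
    constructor <;> linarith
  · exact (mem_edgeSet_two hi).2

/-- The vertical segment between a point below and a point above the triangle passes through the
midpoint of the bottom edge. -/
theorem two_le_poldiam_ext : ((2 : ℕ) : ℕ∞) ≤ poldiam standardTriangle.ext := by
  have hx : !₂[1 / 2, -1] ∈ standardTriangle.ext := IsFree.mem_ext (by omega)
    ⟨!₂[0, -1], fun p hp => by have := nonneg hp; simp [dt]; linarith⟩
  have hy : !₂[1 / 2, 2] ∈ standardTriangle.ext := IsFree.mem_ext (by omega)
    ⟨!₂[0, 1], fun p hp => by have := nonneg hp; simp [dt]; linarith⟩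
  refine le_poldiam hx hy fun l hl => ?_
  rcases l with _ | _ | l
  · have := congrArg (fun z : Plane => z 1) (Linked.zero_iff.1 hl)
    simp at this
    norm_num at this
  · obtain ⟨w, hw, hl⟩ := hl.exists_of_succ
    rw [Linked.zero_iff.1 hl] at hw
    refine absurd (Polygon.edgeSet_subset_boundary 0 (Polygon.mem_edgeSet_iff.2
      ⟨1 / 2, by norm_num, rfl⟩)) (Polygon.ext_subset (P := standardTriangle)
        (hw (mem_segment_iff_add_smul.2 ⟨1 / 3, by norm_num, by norm_num, ?_⟩)))
    change (!₂[0, 0] : Plane) + (1 / 2 : ℝ) • ((!₂[1, 0] : Plane) - !₂[0, 0]) = _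
    apply plane_ext <;> simp
    norm_num
  · omega

end standardTriangle

theorem theorem4p1 :
    (∀ (n : ℕ), 3 ≤ n → ∀ P : Polygon Plane n, P.IsSimpleClosed →
      poldiam P.int ≤ (⌊(n : ℝ) / 2⌋₊ : ℕ∞) ∧ poldiam P.ext ≤ (⌈(n : ℝ) / 2⌉₊ : ℕ∞)) ∧
    (∀ (n : ℕ), 3 ≤ n → ∃ P : Polygon Plane n, P.IsSimpleClosed ∧
      poldiam P.int = (⌊(n : ℝ) / 2⌋₊ : ℕ∞) ∧ poldiam P.ext = (⌈(n : ℝ) / 2⌉₊ : ℕ∞)) := by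
  simp only [floor_half, ceil_half]
  have hupper : ∀ (n : ℕ), 3 ≤ n → ∀ P : Polygon Plane n, P.IsSimpleClosed →
      poldiam P.int ≤ (n / 2 : ℕ) ∧ poldiam P.ext ≤ ((n + 1) / 2 : ℕ) :=
    fun n hn P hP => ⟨Polygon.poldiam_int_le hP hn, Polygon.poldiam_ext_le hP hn⟩
  refine ⟨hupper, fun n hn => ?_⟩
  suffices h : ∃ P : Polygon Plane n, P.IsSimpleClosed ∧
      ((n / 2 : ℕ) : ℕ∞) ≤ poldiam P.int ∧ (((n + 1) / 2 : ℕ) : ℕ∞) ≤ poldiam P.ext by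
    obtain ⟨P, hP, h1, h2⟩ := h
    exact ⟨P, hP, (hupper n hn P hP).1.antisymm h1, (hupper n hn P hP).2.antisymm h2⟩
  -- The spirals require N ≥ 1, which leaves only n = 3 to the triangle.
  obtain ⟨N, rfl | rfl⟩ : ∃ N, n = 2 * N + 2 ∨ n = 2 * N + 3 := ⟨(n - 2) / 2, by omega⟩
  · have hN : 1 ≤ N := by omega
    rw [show (2 * N + 2) / 2 = N + 1 by omega, show (2 * N + 2 + 1) / 2 = N + 1 by omega]
    exact ⟨_, Spiral.isSimpleClosed_even hN, Spiral.poldiam_even hN⟩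
  · rw [show (2 * N + 3) / 2 = N + 1 by omega, show (2 * N + 3 + 1) / 2 = N + 2 by omega]
    rcases Nat.eq_zero_or_pos N with rfl | hN
    · exact ⟨standardTriangle, standardTriangle.isSimpleClosed,
        standardTriangle.one_le_poldiam_int, standardTriangle.two_le_poldiam_ext⟩
    · exact ⟨_, Spiral.isSimpleClosed_odd hN, Spiral.poldiam_odd hN⟩
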